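/- \textbf{Setting.} Let $T>0$, $n_x,n_u,n_d\ge 0$, and let $A,Q:[0,T]\to\mathbb R^{n_x\times n_x}$, $B:[0,T]\to\mathbb R^{n_x\times n_u}$, $C:[0,T]\to\mathbb R^{n_x\times n_d}$, $H:[0,T]\to\mathbb R^{n_u\times n_x}$, $R:[0,T]\to\mathbb R^{n_u\times n_u}$, $G:[0,T]\to\mathbb R^{n_d\times n_x}$, $W:[0,T]\to\mathbb R^{n_d\times n_u}$ be continuous, $Q_T\in\mathbb R^{n_x\times n_x}$, $G_T\in\mathbb R^{n_d\times n_x}$. For a bounded measurable $d:[0,T]\to\mathbb R^{n_d}$ and $d_0\in\mathbb R^{n_x}$, $d_T\in\mathbb R^{n_d}$ consider the problem of minimizing $$\frac12\int_0^T\begin{bmatrix}x\\u\\d\end{bmatrix}^{\top}\begin{bmatrix}Q&H^\top&G^\top\\H&R&W^\top\\G&W&0\end{bmatrix}\begin{bmatrix}x\\u\\d\end{bmatrix}dt+\frac12\begin{bmatrix}x(T)\\d_T\end{bmatrix}^{\top}\begin{bmatrix}Q_T&G_T^\top\\G_T&0\end{bmatrix}\begin{bmatrix}x(T)\\d_T\end{bmatrix}$$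 over all bounded measurable controls $u:[0,T]\to\mathbb R^{n_u}$ and the corresponding continuous states $x$ with $\dot x=Ax+Bu+Cd$, $x(0)=d_0$ (in integrated form). For an optimal pair $(x,u)$, its adjoint is the continuous solution (in integrated form) of $\dot\lambda=-(Qx+H^\top u+G^\top d+A^\top\lambda)$, $\lambda(T)=Q_Tx(T)+G_T^\top d_T$; we then call $(x,u,\lambda)$ an optimal triple for $(d,d_0,d_T)$. Let $\Phi_A(t,s)$ be the evolution operator of $\dot x=A(t)x$ and $W_{A,B}(t_0,t_1)=\int_{t_0}^{t_1}\Phi_A(t_0,s)B(s)B(s)^\top\Phi_A(t_0,s)^\top ds$ the controllability Gramian. Norms are Euclidean norms and the induced operator norms, and $\preceq$ is the Loewner order on symmetric matrices. \textbf{Assumptions}, with constants $\sigma,\alpha_0,\alpha_1,\beta_0,\beta_1,\lambda_A,\lambda_B,\lambda_C,\lambda_H,\lambda_R,\lambda_G,\lambda_W,\gamma_R>0$ and $\lambda_Q\ge\gamma_Q>0$: (i) $\|M(t)\|\le\lambda_M$ for all $t\in[0,T]$ and $M\in\{A,B,C,Q,H,R,G,W\}$, and $\|G_T\|\le\lambda_G$;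 (ii) $\sigma<T$, and for every $t_0\in[0,T-\sigma]$ there is $t_1\in[t_0,t_0+\sigma]$ with $\alpha_0I\preceq W_{A,B}(t_0,t_1)\preceq\alpha_1I$ and $\beta_0I\preceq\Phi_A(t_1,t_0)W_{A,B}(t_0,t_1)\Phi_A(t_1,t_0)^\top\preceq\beta_1I$; (iii) $R(t)\succeq\gamma_RI$ and $Q(t)-H(t)^\top R(t)^{-1}H(t)\succeq\gamma_QI$ for all $t\in[0,T]$, and $\gamma_QI\preceq Q_T\preceq\lambda_QI$. \textbf{Constants} (none of them depends on $T$). Put $\kappa=\lambda_A+\lambda_B\lambda_H/\gamma_R$, $$\alpha_0'=\Big(\tfrac{2}{\alpha_0}+\tfrac{\lambda_H^2}{\gamma_R^2\lambda_A}\big(1+\tfrac{\alpha_1}{\alpha_0}\big)^2(e^{2\lambda_A\sigma}-1)\Big)^{-1},\qquad \alpha_1'=\frac{\lambda_B^2(e^{2\kappa\sigma}-1)}{2\kappa},$$ $$\tilde\alpha_0=\frac{1-e^{-2\kappa\sigma}}{2\kappa},\qquad\tilde\alpha_1=\frac{e^{2\kappa\sigma}-1}{2\kappa},$$ $$c_0=\min\Big\{2\kappa\Big(\tfrac{\lambda_B^2}{\gamma_R}\big(1+\tfrac{\tilde\alpha_1}{\tilde\alpha_0}\big)^2+\tfrac1{\gamma_Q\tilde\alpha_0^2}\Big)^{-1},\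 \Big(\tfrac{\lambda_B^2}{2\gamma_R\kappa}+\tfrac1{\gamma_Q}\Big)^{-1}\Big\}e^{-2\kappa\sigma},$$ $$c_1=\max\Big\{\Big(\big(\lambda_Q+\tfrac{\lambda_H^2}{\gamma_R}\big)\big(1+\tfrac{\alpha_1'}{\alpha_0'}\big)^2+\tfrac{\lambda_R\lambda_B^2}{(\alpha_0')^2}\Big)\tfrac1{2\kappa},\ \big(\lambda_Q+\tfrac{\lambda_H^2}{\gamma_R}\big)\big(1+\tfrac1{2\kappa}\big)\Big\}e^{2\kappa\sigma},$$ $$c_Z=\sqrt{c_1/c_0},\qquad\rho_Z=\frac{\gamma_Q}{2c_1},\qquad\Lambda_b=\Big(1+\tfrac{\lambda_H}{\gamma_R}+\big(1+\tfrac{\lambda_B}{\gamma_R}\big)(c_1+\lambda_G)\Big)\max\Big\{c_Z,\ \frac{c_Z^2\lambda_B^2\lambda_G}{2\rho_Z\gamma_R}\Big\}.$$ \textbf{Theorem} \label{theorem:eds-for-boundary}. One has $\Lambda_b>0$ and $\rho_Z>0$, and under the assumptions above the following holds for every bounded measurable $d$. For all $d_0,d_T$ an optimal triple exists, and its control can be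 chosen continuous if $d$ is continuous. Moreover, for all $d_0,l_0\in\mathbb R^{n_x}$ and $d_T,l_T\in\mathbb R^{n_d}$, if $(x^*,u^*,\lambda^*)$ is an optimal triple for $(d,d_0,d_T)$ and $(x_p^*,u_p^*,\lambda_p^*)$ is one for $(d,d_0+l_0,d_T+l_T)$, then $$\|x_p^*(t)-x^*(t)\|+\|u_p^*(t)-u^*(t)\|+\|\lambda_p^*(t)-\lambda^*(t)\|\le\Lambda_b\left(\|l_0\|e^{-\rho_Zt}+\|l_T\|e^{-\rho_Z(T-t)}\right)$$ for almost every $t\in[0,T]$, and for every $t\in[0,T]$ if $u^*$ and $u_p^*$ are continuous on $[0,T]$. (In particular, taking $l_0=0$ and $l_T=0$, optimal triples are unique, the control up to null sets.) -/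

import Mathlib

open Set MeasureTheory
open scoped InnerProductSpace InnerProduct

noncomputable section

/-- The column vectors `ℝⁿ` with the Euclidean norm. -/
abbrev Vec (n : ℕ) : Type := EuclideanSpace ℝ (Fin n)

/-- Real `m × n` matrices, as linear maps `ℝⁿ → ℝᵐ`.  The norm is the operator norm for the Euclidean
norms, the adjoint `M†` is the transpose, and `M ≤ N` between square matrices is the Loewner order
(`N - M` is symmetric and positive semidefinite). -/
abbrev Mat (m n : ℕ) : Type := Vec n →L[ℝ] Vec m

/-! ### The evolution operator of `ẋ = A(t) x` and the controllability Gramian -/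

/-- The terms of the Peano–Baker series of `ẋ = A(t) x` started at time `s`:
`P₀(t) = I`, `Pₖ₊₁(t) = ∫ₛᵗ A(τ) Pₖ(τ) dτ`. -/
def peanoBakerTerm {n : ℕ} (A : ℝ → Mat n n) (s : ℝ) : ℕ → ℝ → Mat n n
  | 0, _ => 1
  | k + 1, t => ∫ τ in s..t, A τ * peanoBakerTerm A s k τ

/-- The linear evolution operator `Φ_A(t, s)` of `ẋ = A(t) x` (for `s ≤ t` and for `t ≤ s`). -/
def evolution {n : ℕ} (A : ℝ → Mat n n) (t s : ℝ) : Mat n n :=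
  ∑' k, peanoBakerTerm A s k t

theorem peanoBakerTerm_hasDerivAt {n : ℕ} {A : ℝ → Mat n n} (hA : Continuous A) (s : ℝ) (k : ℕ) :
    Continuous (peanoBakerTerm A s k) ∧
      ∀ t, HasDerivAt (peanoBakerTerm A s (k + 1)) (A t * peanoBakerTerm A s k t) t := by
  induction k with
  | zero =>
    have h0 : Continuous (peanoBakerTerm A s 0) := continuous_const
    exact ⟨h0, fun t => intervalIntegral.integral_hasDerivAt_right
      ((hA.mul h0).intervalIntegrable _ _) (hA.mul h0).aestronglyMeasurable.stronglyMeasurableAtFilter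
      (hA.mul h0).continuousAt⟩
  | succ k ih =>
    have h0 : Continuous (peanoBakerTerm A s (k + 1)) :=
      continuous_iff_continuousAt.2 fun t => (ih.2 t).continuousAt
    exact ⟨h0, fun t => intervalIntegral.integral_hasDerivAt_right
      ((hA.mul h0).intervalIntegrable _ _) (hA.mul h0).aestronglyMeasurable.stronglyMeasurableAtFilter
      (hA.mul h0).continuousAt⟩

theorem norm_peanoBakerTerm_le {n : ℕ} {A : ℝ → Mat n n} {M : ℝ} (hM : ∀ t, ‖A t‖ ≤ M)
    (s : ℝ) (k : ℕ) (t : ℝ) :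
    ‖peanoBakerTerm A s k t‖ ≤ (M * |t - s|) ^ k / (k.factorial : ℝ) := by
  have hM0 : 0 ≤ M := (norm_nonneg _).trans (hM 0)
  induction k generalizing t with
  | zero =>
    have h1 : ‖(1 : Mat n n)‖ ≤ 1 := ContinuousLinearMap.norm_id_le
    simpa [peanoBakerTerm] using h1
  | succ k ih =>
    have hb : ∀ τ, ‖A τ * peanoBakerTerm A s k τ‖ ≤
        M ^ (k + 1) / (k.factorial : ℝ) * |τ - s| ^ k := by
      intro τ
      refine (norm_mul_le _ _).trans ((mul_le_mul (hM τ) (ih τ) (norm_nonneg _) hM0).trans_eq ?_)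
      rw [mul_pow]; ring
    have hint : IntervalIntegrable (fun τ => M ^ (k + 1) / (k.factorial : ℝ) * |τ - s| ^ k)
        volume s t := by
      apply Continuous.intervalIntegrable
      fun_prop
    calc ‖peanoBakerTerm A s (k + 1) t‖
        ≤ ∫ τ in uIoc s t, ‖A τ * peanoBakerTerm A s k τ‖ :=
          intervalIntegral.norm_integral_le_integral_norm_uIoc
      _ ≤ ∫ τ in uIoc s t, M ^ (k + 1) / (k.factorial : ℝ) * |τ - s| ^ k :=
          integral_mono_of_nonneg (Filter.Eventually.of_forall fun _ => norm_nonneg _)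
            hint.def' (Filter.Eventually.of_forall hb)
      _ = (M * |t - s|) ^ (k + 1) / ((k + 1).factorial : ℝ) := by
          rw [integral_const_mul, integral_pow_abs_sub_uIoc, mul_pow, Nat.factorial_succ]
          push_cast
          field_simp

theorem evolution_self {n : ℕ} (A : ℝ → Mat n n) (s : ℝ) : evolution A s s = 1 := by
  rw [evolution, tsum_eq_single 0]
  · rfl
  · rintro (_ | k) hk
    · exact absurd rfl hk
    · simp [peanoBakerTerm]

theorem evolution_hasDerivAt_of_bounded {n : ℕ} {A : ℝ → Mat n n} (hA : Continuous A) {M : ℝ}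
    (hM : ∀ t, ‖A t‖ ≤ M) (s t : ℝ) :
    HasDerivAt (fun r => evolution A r s) (A t * evolution A t s) t := by
  have hM0 : 0 ≤ M := (norm_nonneg _).trans (hM 0)
  have hsum : ∀ r, Summable fun k => peanoBakerTerm A s k r := fun r =>
    Summable.of_norm_bounded (Real.summable_pow_div_factorial (M * |r - s|))
      fun k => norm_peanoBakerTerm_le hM s k r
  set ρ : ℝ := |t - s| + 1 with hρ
  have hsum0 : Summable fun k => peanoBakerTerm A s (k + 1) s :=
    (summable_nat_add_iff (f := fun k => peanoBakerTerm A s k s) 1).2 (hsum s)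
  have hu : Summable fun k : ℕ => M * ((M * ρ) ^ k / (k.factorial : ℝ)) :=
    (Real.summable_pow_div_factorial (M * ρ)).mul_left M
  have hmem : s ∈ Metric.ball s ρ := Metric.mem_ball_self (by positivity)
  have key : HasDerivAt (fun r => ∑' k, peanoBakerTerm A s (k + 1) r)
      (∑' k, A t * peanoBakerTerm A s k t) t := by
    refine hasDerivAt_tsum_of_isPreconnected
      (g := fun k r => peanoBakerTerm A s (k + 1) r)
      (g' := fun k r => A r * peanoBakerTerm A s k r) hu Metric.isOpen_ball
      (convex_ball s ρ).isPreconnected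
      (fun k r _ => (peanoBakerTerm_hasDerivAt hA s k).2 r) (fun k r hr => ?_)
      hmem hsum0 ?_
    · refine (norm_mul_le _ _).trans (mul_le_mul (hM r) ?_ (norm_nonneg _) hM0)
      refine (norm_peanoBakerTerm_le hM s k r).trans ?_
      have : |r - s| ≤ ρ := by
        have := Metric.mem_ball.1 hr
        rw [Real.dist_eq] at this
        exact this.le
      gcongr
    · rw [Metric.mem_ball, Real.dist_eq]
      linarith
  rw [(hsum t).tsum_mul_left] at key
  have heq : (fun r => evolution A r s) = fun r => 1 + ∑' k, peanoBakerTerm A s (k + 1) r := by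
    funext r
    rw [evolution, (hsum r).tsum_eq_zero_add]
    rfl
  rw [heq]
  exact key.const_add 1

theorem evolution_congr {n : ℕ} {A A' : ℝ → Mat n n} {T : ℝ} (h : EqOn A A' (Icc 0 T))
    {s t : ℝ} (hs : s ∈ Icc 0 T) (ht : t ∈ Icc 0 T) : evolution A t s = evolution A' t s := by
  have hk : ∀ k, ∀ r ∈ Icc 0 T, peanoBakerTerm A s k r = peanoBakerTerm A' s k r := by
    intro k
    induction k with
    | zero => intro r _; rfl
    | succ k ih =>
      intro r hr
      refine intervalIntegral.integral_congr fun τ hτ => ?_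
      have hτ' : τ ∈ Icc 0 T := (uIcc_subset_Icc hs hr) hτ
      simp only [h hτ', ih τ hτ']
  exact tsum_congr fun k => hk k t ht

/-- `Φ_A(·, s)` solves `ẋ = A(t) x` on `[0, T]`, with value `I` at `s` (`evolution_self`). -/
theorem evolution_hasDerivWithinAt {n : ℕ} {A : ℝ → Mat n n} {T : ℝ}
    (hA : ContinuousOn A (Icc 0 T)) {s t : ℝ} (hs : s ∈ Icc 0 T) (ht : t ∈ Icc 0 T) :
    HasDerivWithinAt (fun r => evolution A r s) (A t * evolution A t s) (Icc 0 T) t := by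
  have hT : (0 : ℝ) ≤ T := ht.1.trans ht.2
  set A' : ℝ → Mat n n := IccExtend hT ((Icc 0 T).domRestrict A) with hA'
  have hcont : Continuous A' := (continuousOn_iff_continuous_domRestrict.1 hA).Icc_extend'
  have heq : EqOn A A' (Icc 0 T) := fun r hr => by
    rw [hA', IccExtend_of_mem hT _ hr, domRestrict_apply]
  obtain ⟨M, hM⟩ := isCompact_Icc.exists_bound_of_continuousOn hA
  have hM' : ∀ r, ‖A' r‖ ≤ M := fun r => hM _ (projIcc 0 T hT r).2
  have hd := (evolution_hasDerivAt_of_bounded hcont hM' s t).hasDerivWithinAt (s := Icc 0 T)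
  rw [heq ht, evolution_congr heq hs ht]
  exact hd.congr (fun r hr => evolution_congr heq hs hr) (evolution_congr heq hs ht)

/-- The controllability Gramian
`W_{A,B}(t₀, t₁) = ∫_{t₀}^{t₁} Φ_A(t₀, s) B(s) B(s)ᵀ Φ_A(t₀, s)ᵀ ds`. -/
def gramian {n m : ℕ} (A : ℝ → Mat n n) (B : ℝ → Mat n m) (t₀ t₁ : ℝ) : Mat n n :=
  ∫ s in t₀..t₁, evolution A t₀ s ∘L B s ∘L (B s)† ∘L (evolution A t₀ s)†

/-! ### The parameterized linear-quadratic problem -/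

/-- The horizon and the coefficients of the parameterized linear-quadratic problem.  Only the values
of the time-dependent matrices on `[0, T]` matter. -/
structure LQProblem (nx nu nd : ℕ) where
  T : ℝ
  A : ℝ → Mat nx nx
  B : ℝ → Mat nx nu
  C : ℝ → Mat nx nd
  Q : ℝ → Mat nx nx
  H : ℝ → Mat nu nx
  R : ℝ → Mat nu nu
  G : ℝ → Mat nd nx
  W : ℝ → Mat nd nu
  QT : Mat nx nx
  GT : Mat nd nx

namespace LQProblem

variable {nx nu nd : ℕ}

/-- `f` is a bounded measurable function on `[0, T]`. -/
def IsBoundedInput (P : LQProblem nx nu nd) {m : ℕ} (f : ℝ → Vec m) : Prop :=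
  AEStronglyMeasurable f (volume.restrict (Icc 0 P.T)) ∧ ∃ M, ∀ t ∈ Icc 0 P.T, ‖f t‖ ≤ M

/-- The objective
`½ ∫₀ᵀ [x; u; d]ᵀ [Q Hᵀ Gᵀ; H R Wᵀ; G W 0] [x; u; d] dt`
`  + ½ [x(T); d_T]ᵀ [Q_T G_Tᵀ; G_T 0] [x(T); d_T]`. -/
def cost (P : LQProblem nx nu nd) (d : ℝ → Vec nd) (dT : Vec nd)
    (x : ℝ → Vec nx) (u : ℝ → Vec nu) : ℝ :=
  (1 / 2) * (∫ t in (0 : ℝ)..P.T,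
      (⟪x t, P.Q t (x t) + ((P.H t)†) (u t) + ((P.G t)†) (d t)⟫_ℝ
        + ⟪u t, P.H t (x t) + P.R t (u t) + ((P.W t)†) (d t)⟫_ℝ
        + ⟪d t, P.G t (x t) + P.W t (u t)⟫_ℝ))
    + (1 / 2) * (⟪x P.T, P.QT (x P.T) + (P.GT†) dT⟫_ℝ + ⟪dT, P.GT (x P.T)⟫_ℝ)

/-- `(x, u)` is admissible: `u` is bounded and measurable, and `x` is the continuous solution of
`ẋ = A x + B u + C d`, `x(0) = d₀`, on `[0, T]` (in integrated form). -/
structure IsAdmissible (P : LQProblem nx nu nd) (d : ℝ → Vec nd) (d0 : Vec nx)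
    (x : ℝ → Vec nx) (u : ℝ → Vec nu) : Prop where
  control : P.IsBoundedInput u
  continuousOn : ContinuousOn x (Icc 0 P.T)
  dynamics : ∀ t ∈ Icc 0 P.T,
    x t = d0 + ∫ s in (0 : ℝ)..t, (P.A s (x s) + P.B s (u s) + P.C s (d s))

/-- `(x, u, p)` is an optimal state, control and adjoint for the parameters `(d, d₀, d_T)`: the pair
`(x, u)` minimizes the objective among all admissible pairs, and `p` is the continuous solution of
the adjoint equation `ṗ = -(Q x + Hᵀ u + Gᵀ d + Aᵀ p)`, `p(T) = Q_T x(T) + G_Tᵀ d_T`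
(in integrated form). -/
structure IsOptimal (P : LQProblem nx nu nd) (d : ℝ → Vec nd) (d0 : Vec nx) (dT : Vec nd)
    (x : ℝ → Vec nx) (u : ℝ → Vec nu) (p : ℝ → Vec nx) : Prop where
  admissible : P.IsAdmissible d d0 x u
  optimal : ∀ (y : ℝ → Vec nx) (w : ℝ → Vec nu), P.IsAdmissible d d0 y w →
    P.cost d dT x u ≤ P.cost d dT y w
  adjoint_continuousOn : ContinuousOn p (Icc 0 P.T)
  adjoint_equation : ∀ t ∈ Icc 0 P.T,
    p t = P.QT (x P.T) + (P.GT†) dT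
      + ∫ s in t..P.T, (P.Q s (x s) + ((P.H s)†) (u s) + ((P.G s)†) (d s) + ((P.A s)†) (p s))

end LQProblem

/-! ### The constants -/

/-- The constants in the assumptions; the horizon `T` is not among them. -/
structure LQConstants where
  (σ α₀ α₁ β₀ β₁ lamA lamB lamC lamQ lamH lamR lamG lamW γQ γR : ℝ)
  σ_pos : 0 < σ
  α₀_pos : 0 < α₀
  α₁_pos : 0 < α₁
  β₀_pos : 0 < β₀
  β₁_pos : 0 < β₁
  lamA_pos : 0 < lamA
  lamB_pos : 0 < lamB
  lamC_pos : 0 < lamC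
  lamH_pos : 0 < lamH
  lamR_pos : 0 < lamR
  lamG_pos : 0 < lamG
  lamW_pos : 0 < lamW
  γQ_pos : 0 < γQ
  γR_pos : 0 < γR
  γQ_le_lamQ : γQ ≤ lamQ

namespace LQConstants

/-- `κ = λ_A + λ_B λ_H / γ_R`, a bound for `‖A - B R⁻¹ H‖`. -/
def kappa (c : LQConstants) : ℝ := c.lamA + c.lamB * c.lamH / c.γR

/-- The lower Gramian bound `α₀'(σ)` for the pair `(A - B R⁻¹ H, B)`. -/
def α₀' (c : LQConstants) : ℝ :=
  (2 / c.α₀ + (c.lamH / c.γR) ^ 2 / c.lamA * (1 + c.α₁ / c.α₀) ^ 2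
    * (Real.exp (2 * c.lamA * c.σ) - 1))⁻¹

/-- The upper Gramian bound `α₁'(σ)` for the pair `(A - B R⁻¹ H, B)`. -/
def α₁' (c : LQConstants) : ℝ :=
  c.lamB ^ 2 * (Real.exp (2 * c.σ * c.kappa) - 1) / (2 * c.kappa)

/-- The lower Gramian bound `α̃₀(σ)` for the dual pair. -/
def αt₀ (c : LQConstants) : ℝ := 1 / (2 * c.kappa) * (1 - Real.exp (-2 * c.kappa * c.σ))

/-- The upper Gramian bound `α̃₁(σ)` for the dual pair. -/
def αt₁ (c : LQConstants) : ℝ := 1 / (2 * c.kappa) * (Real.exp (2 * c.kappa * c.σ) - 1)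

/-- The lower bound `c₀(σ)` for the Riccati matrix. -/
def c₀ (c : LQConstants) : ℝ :=
  min (2 * c.kappa * (c.lamB ^ 2 / c.γR * (1 + c.αt₁ / c.αt₀) ^ 2 + 1 / (c.γQ * c.αt₀ ^ 2))⁻¹)
      (c.lamB ^ 2 / (2 * c.γR * c.kappa) + 1 / c.γQ)⁻¹
    * Real.exp (-2 * c.kappa * c.σ)

/-- The upper bound `c₁(σ)` for the Riccati matrix. -/
def c₁ (c : LQConstants) : ℝ :=
  max (((c.lamQ + c.lamH ^ 2 / c.γR) * (1 + c.α₁' / c.α₀') ^ 2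
        + c.lamR * c.lamB ^ 2 / c.α₀' ^ 2) * (1 / (2 * c.kappa)))
      ((c.lamQ + c.lamH ^ 2 / c.γR) * (1 + 1 / (2 * c.kappa)))
    * Real.exp (2 * c.kappa * c.σ)

/-- `c_Z(σ) = √(c₁(σ) / c₀(σ))`. -/
def cZ (c : LQConstants) : ℝ := Real.sqrt (c.c₁ / c.c₀)

/-- The decay rate `ρ_Z(σ) = γ_Q / (2 c₁(σ))`. -/
def ρZ (c : LQConstants) : ℝ := c.γQ / (2 * c.c₁)

/-- The sensitivity constant `Λ_b(σ)`. -/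
def Lamb (c : LQConstants) : ℝ :=
  (1 + c.lamH / c.γR + (1 + c.lamB / c.γR) * (c.c₁ + c.lamG))
    * max c.cZ (c.cZ ^ 2 * c.lamB ^ 2 * c.lamG / (2 * c.ρZ * c.γR))

end LQConstants

/-! ### The standing assumptions -/

/-- Boundedness, uniform complete controllability and coercivity, with the constants `c`. -/
structure LQProblem.Assumptions {nx nu nd : ℕ} (P : LQProblem nx nu nd) (c : LQConstants) :
    Prop where
  σ_lt_T : c.σ < P.T
  -- continuity and boundedness of the coefficients
  contA : ContinuousOn P.A (Icc 0 P.T)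
  contB : ContinuousOn P.B (Icc 0 P.T)
  contC : ContinuousOn P.C (Icc 0 P.T)
  contQ : ContinuousOn P.Q (Icc 0 P.T)
  contH : ContinuousOn P.H (Icc 0 P.T)
  contR : ContinuousOn P.R (Icc 0 P.T)
  contG : ContinuousOn P.G (Icc 0 P.T)
  contW : ContinuousOn P.W (Icc 0 P.T)
  boundA : ∀ t ∈ Icc 0 P.T, ‖P.A t‖ ≤ c.lamA
  boundB : ∀ t ∈ Icc 0 P.T, ‖P.B t‖ ≤ c.lamB
  boundC : ∀ t ∈ Icc 0 P.T, ‖P.C t‖ ≤ c.lamC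
  boundQ : ∀ t ∈ Icc 0 P.T, ‖P.Q t‖ ≤ c.lamQ
  boundH : ∀ t ∈ Icc 0 P.T, ‖P.H t‖ ≤ c.lamH
  boundR : ∀ t ∈ Icc 0 P.T, ‖P.R t‖ ≤ c.lamR
  boundG : ∀ t ∈ Icc 0 P.T, ‖P.G t‖ ≤ c.lamG
  boundW : ∀ t ∈ Icc 0 P.T, ‖P.W t‖ ≤ c.lamW
  boundGT : ‖P.GT‖ ≤ c.lamG
  -- uniform complete controllability
  controllable : ∀ t₀ ∈ Icc 0 (P.T - c.σ), ∃ t₁ ∈ Icc t₀ (t₀ + c.σ),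
    c.α₀ • (1 : Mat nx nx) ≤ gramian P.A P.B t₀ t₁ ∧
    gramian P.A P.B t₀ t₁ ≤ c.α₁ • (1 : Mat nx nx) ∧
    c.β₀ • (1 : Mat nx nx) ≤
      evolution P.A t₁ t₀ ∘L gramian P.A P.B t₀ t₁ ∘L (evolution P.A t₁ t₀)† ∧
    evolution P.A t₁ t₀ ∘L gramian P.A P.B t₀ t₁ ∘L (evolution P.A t₁ t₀)† ≤
      c.β₁ • (1 : Mat nx nx)
  -- coercivity
  coerciveR : ∀ t ∈ Icc 0 P.T, c.γR • (1 : Mat nu nu) ≤ P.R t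
  coerciveQ : ∀ t ∈ Icc 0 P.T,
    c.γQ • (1 : Mat nx nx) ≤ P.Q t - (P.H t)† ∘L (P.R t).inverse ∘L P.H t
  coerciveQT : c.γQ • (1 : Mat nx nx) ≤ P.QT
  boundQT : P.QT ≤ c.lamQ • (1 : Mat nx nx)

end

/-!
The feedback `u = v - R⁻¹ H x` turns `H` into `0`, `A` into `A - B R⁻¹ H` and `Q` into the uniformly
positive definite Schur complement `Q - H† R⁻¹ H`, and it preserves complete controllability. By
convexity, optimal triples are exactly the solutions of a linear Hamiltonian two-point boundary
value problem.

Let `Π` solve the Riccati equation with `Π(T) = Q_T`. Along a solution `(x, Π x)` of the homogeneous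
Hamiltonian system, `⟪Π x, x⟫` is the optimal cost to go. Comparison with a control that steers `x`
to zero bounds it above by `c₁ ‖x‖²`, pairing `x` with a solution of the adjoint equation bounds it
below by `c₀ ‖x‖²`, and it decreases at rate at least `γ_Q ‖x‖²`. Hence the closed-loop evolution
from `s` to `t` is bounded by `c_Z e^{-ρ_Z (t - s)}`.

The difference of two optimal triples solves the homogeneous Hamiltonian system. Its defect
`λ - Π x` decays backwards from `T`, because it is transported by the adjoint of the closed-loop
evolution, and variation of constants transfers both decay rates to `x`, `λ` and `u`.
-/

noncomputable section

section InnerProductSpace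

variable {E : Type*} [NormedAddCommGroup E] [InnerProductSpace ℝ E]

theorem opNorm_le_of_abs_inner_le {S : E →L[ℝ] E} (hS : S.IsSymmetric) {c : ℝ} (hc : 0 ≤ c)
    (h : ∀ x, |⟪S x, x⟫_ℝ| ≤ c * ‖x‖ ^ 2) : ‖S‖ ≤ c := by
  rw [S.norm_eq_iSup_rayleighQuotient hS]
  refine ciSup_le fun x => ?_
  rw [ContinuousLinearMap.rayleighQuotient, abs_div, abs_of_nonneg (sq_nonneg ‖x‖)]
  exact div_le_of_le_mul₀ (sq_nonneg _) hc (h x)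

theorem norm_le_norm_apply_div_of_le_inner {S : E →L[ℝ] E} {a : ℝ} (ha : 0 < a)
    (h : ∀ x, a * ‖x‖ ^ 2 ≤ ⟪x, S x⟫_ℝ) (x : E) : ‖x‖ ≤ ‖S x‖ / a := by
  rw [le_div_iff₀ ha]
  rcases (norm_nonneg x).eq_or_lt with hx | hx
  · rw [← hx, zero_mul]
    exact norm_nonneg _
  · refine le_of_mul_le_mul_left ?_ hx
    calc ‖x‖ * (‖x‖ * a) = a * ‖x‖ ^ 2 := by ring
      _ ≤ ‖x‖ * ‖S x‖ := (h x).trans (real_inner_le_norm _ _)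

theorem isUnit_of_le_inner [CompleteSpace E] {S : E →L[ℝ] E} {a : ℝ} (ha : 0 < a)
    (h : ∀ x, a * ‖x‖ ^ 2 ≤ ⟪x, S x⟫_ℝ) : IsUnit S := by
  refine S.isUnit_of_forall_le_norm_inner_map (c := ⟨a, ha.le⟩) ha fun x => ?_
  rw [mul_comm, real_inner_comm]
  exact (h x).trans (le_abs_self _)

theorem exists_apply_eq_of_le_inner [CompleteSpace E] {S : E →L[ℝ] E} {a : ℝ} (ha : 0 < a)
    (h : ∀ x, a * ‖x‖ ^ 2 ≤ ⟪x, S x⟫_ℝ) (z : E) : ∃ w, S w = z ∧ ‖w‖ ≤ ‖z‖ / a := by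
  obtain ⟨w, rfl⟩ := (ContinuousLinearMap.isUnit_iff_bijective.1 (isUnit_of_le_inner ha h)).2 z
  exact ⟨w, rfl, norm_le_norm_apply_div_of_le_inner ha h w⟩

theorem hasDerivAt_inner_adjoint [CompleteSpace E] {A : E →L[ℝ] E} {x y : ℝ → E} {f g : E} {t : ℝ}
    (hy : HasDerivAt y (g - (A†) (y t)) t) (hx : HasDerivAt x (A (x t) + f) t) :
    HasDerivAt (fun t => ⟪y t, x t⟫_ℝ) (⟪y t, f⟫_ℝ + ⟪g, x t⟫_ℝ) t := by
  refine (hy.inner ℝ hx).congr_deriv ?_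
  rw [inner_add_right, inner_sub_left, ContinuousLinearMap.adjoint_inner_left]
  ring

variable {F : Type*} [NormedAddCommGroup F] [InnerProductSpace ℝ F] [CompleteSpace E]
  [CompleteSpace F]

theorem continuous_adjoint {X : Type*} [TopologicalSpace X] {M : X → E →L[ℝ] F}
    (hM : Continuous M) : Continuous fun t => (M t)† :=
  ContinuousLinearMap.adjoint.continuous.comp hM

theorem norm_adjoint_le {M : E →L[ℝ] F} {c : ℝ} (h : ‖M‖ ≤ c) : ‖M†‖ ≤ c := by
  rwa [LinearIsometryEquiv.norm_map]

end InnerProductSpace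

section Volterra

variable {E : Type*} [NormedAddCommGroup E] [NormedSpace ℝ E]

/-- The terms of the Neumann series of the Volterra equation `z(t) = h(t) + ∫ₛᵗ M(τ) z(τ) dτ`;
they play for inhomogeneous equations in a Banach space the role of the Peano–Baker series. -/
def volterraTerm (M : ℝ → E →L[ℝ] E) (h : ℝ → E) (s : ℝ) : ℕ → ℝ → E
  | 0, t => h t
  | k + 1, t => ∫ τ in s..t, M τ (volterraTerm M h s k τ)

variable {M : ℝ → E →L[ℝ] E} {h : ℝ → E} {K D : ℝ}

theorem continuous_volterraTerm (hM : Continuous M) (hh : Continuous h) (s : ℝ) (k : ℕ) :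
    Continuous (volterraTerm M h s k) := by
  induction k with
  | zero => exact hh
  | succ k ih =>
    exact intervalIntegral.continuous_primitive
      (fun a b => (hM.clm_apply ih).intervalIntegrable a b) s

theorem norm_volterraTerm_le (hK : ∀ t, ‖M t‖ ≤ K) (hD : ∀ t, ‖h t‖ ≤ D) (s : ℝ) (k : ℕ)
    (t : ℝ) : ‖volterraTerm M h s k t‖ ≤ D * ((K * |t - s|) ^ k / (k.factorial : ℝ)) := by
  have : 0 ≤ K := (norm_nonneg _).trans (hK 0)
  induction k generalizing t with
  | zero => simpa [volterraTerm] using hD t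
  | succ k ih =>
    have hbound : ∀ τ, ‖M τ (volterraTerm M h s k τ)‖ ≤
        D * K ^ (k + 1) / (k.factorial : ℝ) * |τ - s| ^ k := by
      intro τ
      refine ((M τ).le_of_opNorm_le_of_le (hK τ) (ih τ)).trans_eq ?_
      rw [mul_pow]
      ring
    have hint : IntervalIntegrable (fun τ => D * K ^ (k + 1) / (k.factorial : ℝ) * |τ - s| ^ k)
        volume s t := by
      apply Continuous.intervalIntegrable
      fun_prop
    calc ‖volterraTerm M h s (k + 1) t‖
        ≤ ∫ τ in uIoc s t, ‖M τ (volterraTerm M h s k τ)‖ :=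
          intervalIntegral.norm_integral_le_integral_norm_uIoc
      _ ≤ ∫ τ in uIoc s t, D * K ^ (k + 1) / (k.factorial : ℝ) * |τ - s| ^ k :=
          integral_mono_of_nonneg (Filter.Eventually.of_forall fun _ => norm_nonneg _)
            hint.def' (Filter.Eventually.of_forall hbound)
      _ = D * ((K * |t - s|) ^ (k + 1) / ((k + 1).factorial : ℝ)) := by
          rw [integral_const_mul, integral_pow_abs_sub_uIoc, mul_pow, Nat.factorial_succ]
          push_cast
          field_simp

theorem norm_volterraTerm_le_of_abs_sub_le (hK : ∀ t, ‖M t‖ ≤ K) (hD : ∀ t, ‖h t‖ ≤ D) {s t r : ℝ}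
    (ht : |t - s| ≤ r) (k : ℕ) :
    ‖volterraTerm M h s k t‖ ≤ D * ((K * r) ^ k / (k.factorial : ℝ)) := by
  have hK0 : 0 ≤ K := (norm_nonneg _).trans (hK 0)
  have hD0 : 0 ≤ D := (norm_nonneg _).trans (hD 0)
  exact (norm_volterraTerm_le hK hD s k t).trans (by gcongr)

variable [CompleteSpace E]

theorem summable_volterraTerm (hK : ∀ t, ‖M t‖ ≤ K) (hD : ∀ t, ‖h t‖ ≤ D) (s t : ℝ) :
    Summable fun k => volterraTerm M h s k t :=
  Summable.of_norm_bounded ((Real.summable_pow_div_factorial (K * |t - s|)).mul_left D)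
    fun k => norm_volterraTerm_le hK hD s k t

theorem continuous_tsum_volterraTerm (hM : Continuous M) (hK : ∀ t, ‖M t‖ ≤ K)
    (hh : Continuous h) (hD : ∀ t, ‖h t‖ ≤ D) (s : ℝ) :
    Continuous fun t => ∑' k, volterraTerm M h s k t := by
  refine continuous_iff_continuousAt.2 fun t => ?_
  have hball : ContinuousOn (fun t => ∑' k, volterraTerm M h s k t)
      (Metric.ball s (|t - s| + 1)) :=
    continuousOn_tsum (fun k => (continuous_volterraTerm hM hh s k).continuousOn)
      ((Real.summable_pow_div_factorial _).mul_left D)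
      fun k r hr => norm_volterraTerm_le_of_abs_sub_le hK hD (Metric.mem_ball.1 hr).le k
  refine hball.continuousAt (Metric.isOpen_ball.mem_nhds ?_)
  rw [Metric.mem_ball, Real.dist_eq]
  exact lt_add_one _

theorem exists_volterra_solution (hM : Continuous M) (hK : ∀ t, ‖M t‖ ≤ K) (hh : Continuous h)
    (hD : ∀ t, ‖h t‖ ≤ D) (s : ℝ) :
    ∃ z : ℝ → E, Continuous z ∧ ∀ t, z t = h t + ∫ τ in s..t, M τ (z τ) := by
  have hsum := summable_volterraTerm hK hD s
  refine ⟨fun t => ∑' k, volterraTerm M h s k t, continuous_tsum_volterraTerm hM hK hh hD s,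
    fun t => ?_⟩
  have hdom : Summable fun k : ℕ => K * (D * ((K * |t - s|) ^ k / (k.factorial : ℝ))) :=
    ((Real.summable_pow_div_factorial _).mul_left D).mul_left K
  have hbound : ∀ k, ∀ τ ∈ uIoc s t, ‖M τ (volterraTerm M h s k τ)‖ ≤
      K * (D * ((K * |t - s|) ^ k / (k.factorial : ℝ))) := fun k τ hτ =>
    (M τ).le_of_opNorm_le_of_le (hK τ) (norm_volterraTerm_le_of_abs_sub_le hK hD
      (abs_sub_left_of_mem_uIcc (uIoc_subset_uIcc hτ)) k)
  have hintegral : HasSum (fun k => volterraTerm M h s (k + 1) t)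
      (∫ τ in s..t, M τ (∑' k, volterraTerm M h s k τ)) :=
    intervalIntegral.hasSum_integral_of_dominated_convergence
      (F := fun k τ => M τ (volterraTerm M h s k τ))
      (fun k _ => K * (D * ((K * |t - s|) ^ k / (k.factorial : ℝ))))
      (fun k => (hM.clm_apply (continuous_volterraTerm hM hh s k)).aestronglyMeasurable)
      (fun k => Filter.Eventually.of_forall (hbound k))
      (Filter.Eventually.of_forall fun _ _ => hdom) intervalIntegrable_const
      (Filter.Eventually.of_forall fun τ _ => (M τ).hasSum (hsum τ).hasSum)
  exact (hsum t).tsum_eq_zero_add.trans (congrArg (h t + ·) hintegral.tsum_eq)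

end Volterra

section Calculus

variable {E : Type*} [NormedAddCommGroup E]

theorem norm_le_exp_mul_of_hasDerivAt [NormedSpace ℝ E] {x f : ℝ → E} {K t₀ t₁ : ℝ}
    (hx : ∀ t ∈ Icc t₀ t₁, HasDerivAt x (f t) t) (hf : ∀ t ∈ Icc t₀ t₁, ‖f t‖ ≤ K * ‖x t‖)
    {t : ℝ} (ht : t ∈ Icc t₀ t₁) : ‖x t‖ ≤ Real.exp (K * (t - t₀)) * ‖x t₀‖ := by
  have hgronwall := norm_le_gronwallBound_of_norm_deriv_right_le (ε := 0)
    (fun r hr => (hx r hr).continuousAt.continuousWithinAt)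
    (fun r hr => (hx r (Ico_subset_Icc_self hr)).hasDerivWithinAt) le_rfl
    (fun r hr => by simpa using hf r (Ico_subset_Icc_self hr)) t ht
  rwa [gronwallBound_ε0, mul_comm] at hgronwall

theorem integral_mul_add_mul_primitive {f g x y : ℝ → ℝ} {a b : ℝ}
    (hf : IntervalIntegrable f volume a b) (hg : IntervalIntegrable g volume a b)
    (hx : ∀ t ∈ uIcc a b, x t = x a + ∫ s in a..t, f s)
    (hy : ∀ t ∈ uIcc a b, y t = y a + ∫ s in a..t, g s) :
    ∫ t in a..b, (x t * g t + f t * y t) = x b * y b - x a * y a := by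
  have hac : ∀ {f : ℝ → ℝ} (c : ℝ), IntervalIntegrable f volume a b →
      AbsolutelyContinuousOnInterval (fun t => c + ∫ s in a..t, f s) a b := fun c hf =>
    (LipschitzWith.const c).lipschitzOnWith.absolutelyContinuousOnInterval.fun_add
      (hf.absolutelyContinuousOnInterval_intervalIntegral left_mem_uIcc)
  have hparts := (hac (x a) hf).integral_deriv_mul_eq_sub (hac (y a) hg)
  rw [← hx b right_mem_uIcc, ← hy b right_mem_uIcc] at hparts
  simp only [intervalIntegral.integral_same, add_zero] at hparts
  rw [← hparts]
  refine intervalIntegral.integral_congr_ae ?_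
  filter_upwards [hf.ae_hasDerivAt_integral, hg.ae_hasDerivAt_integral] with t hFt hGt ht
  have ht' := uIoc_subset_uIcc ht
  rw [((hFt ht' a left_mem_uIcc).const_add (x a)).deriv,
    ((hGt ht' a left_mem_uIcc).const_add (y a)).deriv, ← hx t ht', ← hy t ht']
  ring

theorem integral_inner_add_inner_primitive [InnerProductSpace ℝ E] [FiniteDimensional ℝ E]
    {f g x y : ℝ → E} {a b : ℝ} (hf : IntervalIntegrable f volume a b)
    (hg : IntervalIntegrable g volume a b)
    (hx : ∀ t ∈ uIcc a b, x t = x a + ∫ s in a..t, f s)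
    (hy : ∀ t ∈ uIcc a b, y t = y a + ∫ s in a..t, g s) :
    ∫ t in a..b, (⟪x t, g t⟫_ℝ + ⟪f t, y t⟫_ℝ) = ⟪x b, y b⟫_ℝ - ⟪x a, y a⟫_ℝ := by
  set e := stdOrthonormalBasis ℝ E
  have hint : ∀ {f : ℝ → E} (i), IntervalIntegrable f volume a b →
      IntervalIntegrable (fun t => ⟪e i, f t⟫_ℝ) volume a b := fun i hf =>
    ⟨hf.1.const_inner _, hf.2.const_inner _⟩
  have hcoord : ∀ {f x : ℝ → E} (i), IntervalIntegrable f volume a b →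
      (∀ t ∈ uIcc a b, x t = x a + ∫ s in a..t, f s) →
      ∀ t ∈ uIcc a b, ⟪e i, x t⟫_ℝ = ⟪e i, x a⟫_ℝ + ∫ s in a..t, ⟪e i, f s⟫_ℝ := by
    intro f x i hf hx t ht
    have hft := hf.mono_set (uIcc_subset_uIcc_left ht)
    rw [hx t ht, inner_add_right]
    exact congrArg _ ((innerSL ℝ (e i)).intervalIntegral_comp_comm hft).symm
  have hcont : ∀ {f x : ℝ → E}, IntervalIntegrable f volume a b →
      (∀ t ∈ uIcc a b, x t = x a + ∫ s in a..t, f s) → ContinuousOn x (uIcc a b) :=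
    fun hf hx => (continuousOn_const.add
      (intervalIntegral.continuousOn_primitive_interval' hf left_mem_uIcc)).congr hx
  have hinner : ∀ v w : E, ⟪v, w⟫_ℝ = ∑ i, ⟪e i, v⟫_ℝ * ⟪e i, w⟫_ℝ := fun v w => by
    simp only [← e.sum_inner_mul_inner v w, real_inner_comm v]
  have hintegrand : ∀ t, ⟪x t, g t⟫_ℝ + ⟪f t, y t⟫_ℝ =
      ∑ i, (⟪e i, x t⟫_ℝ * ⟪e i, g t⟫_ℝ + ⟪e i, f t⟫_ℝ * ⟪e i, y t⟫_ℝ) := fun t => by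
    rw [hinner (x t), hinner (f t), Finset.sum_add_distrib]
  rw [funext hintegrand, hinner (x b), hinner (x a), ← Finset.sum_sub_distrib,
    intervalIntegral.integral_finsetSum fun i _ =>
    ((hint i hg).continuousOn_mul (continuousOn_const.inner (hcont hf hx))).add
      ((hint i hf).mul_continuousOn (continuousOn_const.inner (hcont hg hy)))]
  exact Finset.sum_congr rfl fun i _ =>
    integral_mul_add_mul_primitive (hint i hf) (hint i hg) (hcoord i hf hx) (hcoord i hg hy)

theorem sub_le_integral_of_hasDerivAt {g g' φ : ℝ → ℝ} {a b : ℝ} (hab : a ≤ b)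
    (hg : ∀ t ∈ Icc a b, HasDerivAt g (g' t) t) (hφ : IntegrableOn φ (Icc a b))
    (h : ∀ t ∈ Ioo a b, g' t ≤ φ t) : g b - g a ≤ ∫ t in a..b, φ t :=
  intervalIntegral.sub_le_integral_of_hasDeriv_right_of_le hab
    (fun t ht => (hg t ht).continuousAt.continuousWithinAt)
    (fun t ht => (hg t (Ioo_subset_Icc_self ht)).hasDerivWithinAt) hφ h

theorem integral_exp_mul_sub {c : ℝ} (hc : c ≠ 0) (a b : ℝ) :
    ∫ s in a..b, Real.exp (c * (s - a)) = (Real.exp (c * (b - a)) - 1) / c := by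
  rw [intervalIntegral.integral_comp_sub_right (fun s => Real.exp (c * s)),
    intervalIntegral.integral_comp_mul_left Real.exp hc, integral_exp, sub_self, mul_zero,
    Real.exp_zero, smul_eq_mul, inv_mul_eq_div]

theorem integral_exp_mul_sub_mul_le {c D a b σ : ℝ} (hc : 0 < c) (hb : b ≤ a + σ) (hD : 0 ≤ D) :
    ∫ s in a..b, Real.exp (c * (s - a)) * D ≤ (Real.exp (c * σ) - 1) / c * D := by
  rw [intervalIntegral.integral_mul_const, integral_exp_mul_sub hc.ne']
  gcongr
  linarith

theorem sq_le_exp_mul_sq {r k τ b : ℝ} (hr : 0 ≤ r) (h : r ≤ Real.exp (k * τ) * b) :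
    r ^ 2 ≤ Real.exp (2 * k * τ) * b ^ 2 :=
  calc r ^ 2 ≤ (Real.exp (k * τ) * b) ^ 2 := by gcongr
    _ = Real.exp (2 * k * τ) * b ^ 2 := by
        rw [mul_pow, ← Real.exp_nat_mul, Nat.cast_ofNat, mul_assoc]

end Calculus

section Evolution

variable {n : ℕ} {A : ℝ → Mat n n} {K : ℝ}

theorem evolution_apply_hasDerivAt (hA : Continuous A) (hK : ∀ t, ‖A t‖ ≤ K) (s : ℝ) (z : Vec n)
    (t : ℝ) : HasDerivAt (fun r => evolution A r s z) (A t (evolution A t s z)) t := by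
  simpa using (evolution_hasDerivAt_of_bounded hA hK s t).clm_apply (hasDerivAt_const t z)

/-- The evolution operator of the adjoint equation `y' = -Aᵀ y`; it equals `Φ_A(s, t)ᵀ`
(`evolution_adjoint`). -/
def adjointEvolution (A : ℝ → Mat n n) (t s : ℝ) : Mat n n := evolution (fun r => -(A r)†) t s

theorem adjointEvolution_hasDerivAt (hA : Continuous A) (hK : ∀ t, ‖A t‖ ≤ K) (s t : ℝ) :
    HasDerivAt (fun r => adjointEvolution A r s) (-(A t)† * adjointEvolution A t s) t :=
  evolution_hasDerivAt_of_bounded (continuous_adjoint hA).neg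
    (fun t => (norm_neg _).trans_le (norm_adjoint_le (hK t))) s t

theorem adjointEvolution_apply_hasDerivAt (hA : Continuous A) (hK : ∀ t, ‖A t‖ ≤ K) (s : ℝ)
    (z : Vec n) (t : ℝ) : HasDerivAt (fun r => adjointEvolution A r s z)
      (0 - ((A t)†) (adjointEvolution A t s z)) t := by
  simpa using (adjointEvolution_hasDerivAt hA hK s t).clm_apply (hasDerivAt_const t z)

theorem adjointEvolution_self (A : ℝ → Mat n n) (s : ℝ) : adjointEvolution A s s = 1 :=
  evolution_self _ s

theorem inner_adjointEvolution_evolution (hA : Continuous A) (hK : ∀ t, ‖A t‖ ≤ K) (r s t : ℝ)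
    (a b : Vec n) :
    ⟪adjointEvolution A r s a, evolution A r t b⟫_ℝ = ⟪a, evolution A s t b⟫_ℝ := by
  have hderiv : ∀ r, HasDerivAt (fun r => ⟪adjointEvolution A r s a, evolution A r t b⟫_ℝ) 0 r :=
    fun r => by
      simpa using hasDerivAt_inner_adjoint (f := 0) (g := 0) (A := A r)
        (adjointEvolution_apply_hasDerivAt hA hK s a r)
        (by simpa using evolution_apply_hasDerivAt hA hK t b r)
  have hconst := is_const_of_deriv_eq_zero (fun r => (hderiv r).differentiableAt)
    (fun r => (hderiv r).deriv) r s
  simpa [adjointEvolution_self] using hconst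

theorem evolution_adjoint (hA : Continuous A) (hK : ∀ t, ‖A t‖ ≤ K) (s t : ℝ) :
    (evolution A s t)† = adjointEvolution A t s := by
  refine ContinuousLinearMap.ext fun a => ext_inner_right ℝ fun b => ?_
  rw [ContinuousLinearMap.adjoint_inner_left, ← inner_adjointEvolution_evolution hA hK t s t,
    evolution_self]
  rfl

theorem evolution_evolution_swap (hA : Continuous A) (hK : ∀ t, ‖A t‖ ≤ K) (s t : ℝ)
    (b : Vec n) : evolution A s t (evolution A t s b) = b := by
  refine ext_inner_left ℝ fun a => ?_
  rw [← ContinuousLinearMap.adjoint_inner_left, evolution_adjoint hA hK,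
    inner_adjointEvolution_evolution hA hK, evolution_self]
  rfl

theorem continuous_adjointEvolution (hA : Continuous A) (hK : ∀ t, ‖A t‖ ≤ K) (s : ℝ) :
    Continuous fun t => adjointEvolution A t s :=
  continuous_iff_continuousAt.2 fun t => (adjointEvolution_hasDerivAt hA hK s t).continuousAt

theorem continuous_evolution_right (hA : Continuous A) (hK : ∀ t, ‖A t‖ ≤ K) (t : ℝ) :
    Continuous fun s => evolution A t s := by
  simpa only [← evolution_adjoint hA hK, ContinuousLinearMap.adjoint_adjoint] using
    continuous_adjoint (continuous_adjointEvolution hA hK t)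

theorem norm_evolution_apply_le (hA : Continuous A) (hK : ∀ t, ‖A t‖ ≤ K) {s t : ℝ} (hst : s ≤ t)
    (z : Vec n) : ‖evolution A t s z‖ ≤ Real.exp (K * (t - s)) * ‖z‖ := by
  simpa [evolution_self] using norm_le_exp_mul_of_hasDerivAt
    (fun r _ => evolution_apply_hasDerivAt hA hK s z r)
    (fun r _ => (A r).le_of_opNorm_le (hK r) _) ⟨hst, le_rfl⟩

theorem norm_adjointEvolution_apply_le (hA : Continuous A) (hK : ∀ t, ‖A t‖ ≤ K) {s t : ℝ}
    (hst : s ≤ t) (z : Vec n) : ‖adjointEvolution A t s z‖ ≤ Real.exp (K * (t - s)) * ‖z‖ :=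
  norm_evolution_apply_le (continuous_adjoint hA).neg
    (fun t => (norm_neg _).trans_le (norm_adjoint_le (hK t))) hst z

end Evolution

section Gramian

variable {n m : ℕ} {A : ℝ → Mat n n} {B : ℝ → Mat n m} {K : ℝ}

theorem continuous_gramian_integrand (hA : Continuous A) (hK : ∀ t, ‖A t‖ ≤ K)
    (hB : Continuous B) (t₀ : ℝ) :
    Continuous fun s => evolution A t₀ s ∘L B s ∘L (B s)† ∘L (evolution A t₀ s)† :=
  (continuous_evolution_right hA hK t₀).clm_comp (hB.clm_comp ((continuous_adjoint hB).clm_comp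
    (continuous_adjoint (continuous_evolution_right hA hK t₀))))

theorem gramian_hasDerivAt (hA : Continuous A) (hK : ∀ t, ‖A t‖ ≤ K) (hB : Continuous B)
    (t₀ t : ℝ) : HasDerivAt (fun t => gramian A B t₀ t)
      (evolution A t₀ t ∘L B t ∘L (B t)† ∘L (evolution A t₀ t)†) t :=
  ((continuous_gramian_integrand hA hK hB t₀).integral_hasStrictDerivAt t₀ t).hasDerivAt

theorem inner_gramian_apply (hA : Continuous A) (hK : ∀ t, ‖A t‖ ≤ K) (hB : Continuous B)
    (t₀ t₁ : ℝ) (a b : Vec n) : ⟪a, gramian A B t₀ t₁ b⟫_ℝ =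
      ∫ s in t₀..t₁, ⟪((B s)†) (adjointEvolution A s t₀ a),
        ((B s)†) (adjointEvolution A s t₀ b)⟫_ℝ := by
  have hc := continuous_gramian_integrand hA hK hB t₀
  rw [gramian, ContinuousLinearMap.intervalIntegral_apply (hc.intervalIntegrable _ _),
    ← innerSL_apply_apply ℝ, ← (innerSL ℝ a).intervalIntegral_comp_comm
      ((hc.clm_apply continuous_const).intervalIntegrable _ _)]
  refine intervalIntegral.integral_congr fun s _ => ?_
  simp only [ContinuousLinearMap.comp_apply, innerSL_apply_apply]
  rw [← evolution_adjoint hA hK, ContinuousLinearMap.adjoint_inner_left,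
    ContinuousLinearMap.adjoint_inner_left]

theorem inner_gramian_self (hA : Continuous A) (hK : ∀ t, ‖A t‖ ≤ K) (hB : Continuous B)
    (t₀ t₁ : ℝ) (a : Vec n) : ⟪a, gramian A B t₀ t₁ a⟫_ℝ =
      ∫ s in t₀..t₁, ‖((B s)†) (adjointEvolution A s t₀ a)‖ ^ 2 := by
  simp only [inner_gramian_apply hA hK hB, real_inner_self_eq_norm_sq]

theorem continuous_adjoint_apply_adjointEvolution (hA : Continuous A) (hK : ∀ t, ‖A t‖ ≤ K)
    (hB : Continuous B) (s : ℝ) (a : Vec n) :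
    Continuous fun t => ((B t)†) (adjointEvolution A t s a) :=
  (continuous_adjoint hB).clm_apply
    ((continuous_adjointEvolution hA hK s).clm_apply continuous_const)

theorem gramian_isSymmetric (hA : Continuous A) (hK : ∀ t, ‖A t‖ ≤ K) (hB : Continuous B)
    (t₀ t₁ : ℝ) : (gramian A B t₀ t₁).IsSymmetric := fun a b => by
  rw [ContinuousLinearMap.coe_coe, real_inner_comm, inner_gramian_apply hA hK hB,
    inner_gramian_apply hA hK hB]
  simp only [real_inner_comm]

theorem inner_gramian_nonneg (hA : Continuous A) (hK : ∀ t, ‖A t‖ ≤ K) (hB : Continuous B)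
    {t₀ t₁ : ℝ} (ht : t₀ ≤ t₁) (z : Vec n) : 0 ≤ ⟪z, gramian A B t₀ t₁ z⟫_ℝ := by
  rw [inner_gramian_self hA hK hB]
  exact intervalIntegral.integral_nonneg ht fun _ _ => sq_nonneg _

theorem inner_gramian_mono (hA : Continuous A) (hK : ∀ t, ‖A t‖ ≤ K) (hB : Continuous B)
    {t₀ s t : ℝ} (hs : t₀ ≤ s) (hst : s ≤ t) (z : Vec n) :
    ⟪z, gramian A B t₀ s z⟫_ℝ ≤ ⟪z, gramian A B t₀ t z⟫_ℝ := by
  rw [inner_gramian_self hA hK hB, inner_gramian_self hA hK hB]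
  exact intervalIntegral.integral_mono_interval le_rfl hs hst
    (Filter.Eventually.of_forall fun _ => sq_nonneg _)
    (((continuous_adjoint_apply_adjointEvolution hA hK hB t₀ z).norm.pow 2).intervalIntegrable _ _)

theorem norm_gramian_le (hA : Continuous A) (hK : ∀ t, ‖A t‖ ≤ K) (hB : Continuous B)
    {t₀ t₁ a₁ : ℝ} (ha₁ : 0 ≤ a₁) (h : ∀ z, ⟪z, gramian A B t₀ t₁ z⟫_ℝ ≤ a₁ * ‖z‖ ^ 2)
    {s : ℝ} (hs : s ∈ Icc t₀ t₁) : ‖gramian A B t₀ s‖ ≤ a₁ := by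
  refine opNorm_le_of_abs_inner_le (gramian_isSymmetric hA hK hB t₀ s) ha₁ fun z => ?_
  rw [real_inner_comm, abs_of_nonneg (inner_gramian_nonneg hA hK hB hs.1 z)]
  exact (inner_gramian_mono hA hK hB hs.1 hs.2 z).trans (h z)

theorem inner_gramian_le (hA : Continuous A) (hK : ∀ t, ‖A t‖ ≤ K) (hB : Continuous B)
    (hK0 : 0 < K) {b : ℝ} (hb : ∀ t, ‖B t‖ ≤ b) {t₀ t₁ σ : ℝ} (ht : t₀ ≤ t₁) (ht₁ : t₁ ≤ t₀ + σ)
    (z : Vec n) : ⟪z, gramian A B t₀ t₁ z⟫_ℝ ≤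
      b ^ 2 * (Real.exp (2 * K * σ) - 1) / (2 * K) * ‖z‖ ^ 2 := by
  have hbound : ∀ s ∈ Icc t₀ t₁, ‖((B s)†) (adjointEvolution A s t₀ z)‖ ^ 2 ≤
      Real.exp (2 * K * (s - t₀)) * (b ^ 2 * ‖z‖ ^ 2) := fun s hs =>
    calc ‖((B s)†) (adjointEvolution A s t₀ z)‖ ^ 2
        ≤ Real.exp (2 * K * (s - t₀)) * (b * ‖z‖) ^ 2 :=
          sq_le_exp_mul_sq (norm_nonneg _) ((((B s)†).le_of_opNorm_le_of_le
            (norm_adjoint_le (hb s)) (norm_adjointEvolution_apply_le hA hK hs.1 z)).trans_eq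
              (mul_left_comm _ _ _))
      _ = Real.exp (2 * K * (s - t₀)) * (b ^ 2 * ‖z‖ ^ 2) := by rw [mul_pow]
  rw [inner_gramian_self hA hK hB]
  have hcont := (continuous_adjoint_apply_adjointEvolution hA hK hB t₀ z).norm.pow 2
  refine (intervalIntegral.integral_mono_on ht (hcont.intervalIntegrable _ _)
    ((by fun_prop : Continuous _).intervalIntegrable _ _) hbound).trans
    ((integral_exp_mul_sub_mul_le (by positivity) ht₁ (by positivity)).trans_eq (by ring))

/-- The response of `ẋ = A x + B v`, `x(t₀) = z`, to the control `v = -Bᵀ y`, where `y` is the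
solution of `y' = -Aᵀ y` with `y(t₀) = w`. -/
def steeredState (A : ℝ → Mat n n) (B : ℝ → Mat n m) (t₀ : ℝ) (z w : Vec n) (t : ℝ) : Vec n :=
  evolution A t t₀ (z - gramian A B t₀ t w)

theorem steeredState_left (A : ℝ → Mat n n) (B : ℝ → Mat n m) (t₀ : ℝ) (z w : Vec n) :
    steeredState A B t₀ z w t₀ = z := by
  simp [steeredState, evolution_self, gramian]

theorem steeredState_hasDerivAt (hA : Continuous A) (hK : ∀ t, ‖A t‖ ≤ K) (hB : Continuous B)
    (t₀ : ℝ) (z w : Vec n) (t : ℝ) : HasDerivAt (steeredState A B t₀ z w)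
      (A t (steeredState A B t₀ z w t) + B t (-((B t)†) (adjointEvolution A t t₀ w))) t := by
  refine ((evolution_hasDerivAt_of_bounded hA hK t₀ t).clm_apply
    (((gramian_hasDerivAt hA hK hB t₀ t).clm_apply (hasDerivAt_const t w)).const_sub
      z)).congr_deriv ?_
  simp only [ContinuousLinearMap.comp_apply, map_zero, add_zero, map_neg,
    evolution_evolution_swap hA hK, evolution_adjoint hA hK]
  rfl

theorem norm_steeredState_le (hA : Continuous A) (hK : ∀ t, ‖A t‖ ≤ K) (hB : Continuous B)
    {t₀ t₁ a₁ r : ℝ} (ha₁ : 0 ≤ a₁) (hhi : ∀ z, ⟪z, gramian A B t₀ t₁ z⟫_ℝ ≤ a₁ * ‖z‖ ^ 2)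
    (z : Vec n) {w : Vec n} (hw : ‖w‖ ≤ r) {t : ℝ} (ht : t ∈ Icc t₀ t₁) :
    ‖steeredState A B t₀ z w t‖ ≤ Real.exp (K * (t - t₀)) * (‖z‖ + a₁ * r) := by
  refine (norm_evolution_apply_le hA hK ht.1 _).trans ?_
  gcongr
  exact norm_sub_le_of_le le_rfl
    ((gramian A B t₀ t).le_of_opNorm_le_of_le (norm_gramian_le hA hK hB ha₁ hhi ht) hw)

theorem exists_steering (hA : Continuous A) (hK : ∀ t, ‖A t‖ ≤ K) (hB : Continuous B)
    {t₀ t₁ a₀ a₁ : ℝ} (ha₀ : 0 < a₀) (ha₁ : 0 ≤ a₁)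
    (hlo : ∀ z, a₀ * ‖z‖ ^ 2 ≤ ⟪z, gramian A B t₀ t₁ z⟫_ℝ)
    (hhi : ∀ z, ⟪z, gramian A B t₀ t₁ z⟫_ℝ ≤ a₁ * ‖z‖ ^ 2) (z : Vec n) :
    ∃ x y : ℝ → Vec n, x t₀ = z ∧ x t₁ = 0 ∧
      (∀ t, HasDerivAt x (A t (x t) + B t (-((B t)†) (y t))) t) ∧ Continuous y ∧
      (∀ t ∈ Icc t₀ t₁, ‖x t‖ ≤ Real.exp (K * (t - t₀)) * ((1 + a₁ / a₀) * ‖z‖)) ∧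
      (∀ t ∈ Icc t₀ t₁, ‖y t‖ ≤ Real.exp (K * (t - t₀)) * (‖z‖ / a₀)) ∧
      ∫ t in t₀..t₁, ‖((B t)†) (y t)‖ ^ 2 ≤ ‖z‖ ^ 2 / a₀ := by
  obtain ⟨w, hw, hwz⟩ := exists_apply_eq_of_le_inner ha₀ hlo z
  refine ⟨steeredState A B t₀ z w, fun t => adjointEvolution A t t₀ w, steeredState_left A B t₀ z w,
    by simp [steeredState, hw], steeredState_hasDerivAt hA hK hB t₀ z w,
    (continuous_adjointEvolution hA hK t₀).clm_apply continuous_const, fun t ht => ?_,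
    fun t ht => ?_, ?_⟩
  · exact (norm_steeredState_le hA hK hB ha₁ hhi z hwz ht).trans_eq (by ring)
  · exact (norm_adjointEvolution_apply_le hA hK ht.1 _).trans (by gcongr)
  · rw [← inner_gramian_self hA hK hB, hw]
    calc ⟪w, z⟫_ℝ ≤ ‖w‖ * ‖z‖ := real_inner_le_norm _ _
      _ ≤ ‖z‖ / a₀ * ‖z‖ := by gcongr
      _ = ‖z‖ ^ 2 / a₀ := by ring

theorem neg_inner_le_norm_sq_add_norm_sq {E : Type*} [NormedAddCommGroup E] [InnerProductSpace ℝ E]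
    {a : ℝ} (ha : 0 < a) (p v : E) : -⟪p, v⟫_ℝ ≤ 1 / (2 * a) * ‖p‖ ^ 2 + a / 2 * ‖v‖ ^ 2 := by
  have hsq : 0 ≤ ‖p + a • v‖ ^ 2 / (2 * a) := by positivity
  rw [norm_add_sq_real, inner_smul_right, norm_smul, Real.norm_of_nonneg ha.le] at hsq
  have hexpand : (‖p‖ ^ 2 + 2 * (a * ⟪p, v⟫_ℝ) + (a * ‖v‖) ^ 2) / (2 * a) =
      1 / (2 * a) * ‖p‖ ^ 2 + a / 2 * ‖v‖ ^ 2 + ⟪p, v⟫_ℝ := by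
    field_simp
    ring
  linarith

theorem le_inner_gramian_of_steering (hA : Continuous A) (hK : ∀ t, ‖A t‖ ≤ K) (hB : Continuous B)
    {t₀ t₁ a : ℝ} (ht : t₀ ≤ t₁) (ha : 0 < a) {z : Vec n} {x : ℝ → Vec n} {v : ℝ → Vec m}
    (hx₀ : x t₀ = z) (hx₁ : x t₁ = 0) (hx : ∀ t, HasDerivAt x (A t (x t) + B t (v t)) t)
    (hv : Continuous v) (hE : ∫ t in t₀..t₁, ‖v t‖ ^ 2 ≤ ‖z‖ ^ 2 / a) :
    a * ‖z‖ ^ 2 ≤ ⟪z, gramian A B t₀ t₁ z⟫_ℝ := by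
  set p : ℝ → Vec m := fun t => ((B t)†) (adjointEvolution A t t₀ z) with hp
  have hpc : Continuous p := continuous_adjoint_apply_adjointEvolution hA hK hB t₀ z
  have hderiv : ∀ t, HasDerivAt (fun t => -⟪adjointEvolution A t t₀ z, x t⟫_ℝ) (-⟪p t, v t⟫_ℝ) t :=
    fun t => (hasDerivAt_inner_adjoint (adjointEvolution_apply_hasDerivAt hA hK t₀ z t)
      (hx t)).neg.congr_deriv (by
        rw [inner_zero_left, add_zero, hp, ContinuousLinearMap.adjoint_inner_left])
  have hpint : Continuous fun t => 1 / (2 * a) * ‖p t‖ ^ 2 := by fun_prop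
  have hvint : Continuous fun t => a / 2 * ‖v t‖ ^ 2 := by fun_prop
  have hduality : ‖z‖ ^ 2 ≤ 1 / (2 * a) * ⟪z, gramian A B t₀ t₁ z⟫_ℝ
      + a / 2 * ∫ t in t₀..t₁, ‖v t‖ ^ 2 := by
    have hle := sub_le_integral_of_hasDerivAt ht (fun t _ => hderiv t)
      (hpint.fun_add hvint).integrableOn_Icc
      fun t _ => neg_inner_le_norm_sq_add_norm_sq ha (p t) (v t)
    rw [intervalIntegral.integral_add (hpint.intervalIntegrable _ _)
      (hvint.intervalIntegrable _ _), intervalIntegral.integral_const_mul,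
      intervalIntegral.integral_const_mul, ← inner_gramian_self hA hK hB, hx₀, hx₁,
      adjointEvolution_self] at hle
    simpa only [inner_zero_right, neg_zero, one_apply_eq_self, real_inner_self_eq_norm_sq,
      sub_neg_eq_add, zero_add] using hle
  have henergy : a / 2 * ∫ t in t₀..t₁, ‖v t‖ ^ 2 ≤ ‖z‖ ^ 2 / 2 :=
    calc a / 2 * ∫ t in t₀..t₁, ‖v t‖ ^ 2 ≤ a / 2 * (‖z‖ ^ 2 / a) := by gcongr
      _ = ‖z‖ ^ 2 / 2 := by field_simp
  calc a * ‖z‖ ^ 2 = 2 * a * (‖z‖ ^ 2 - ‖z‖ ^ 2 / 2) := by ring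
    _ ≤ 2 * a * (1 / (2 * a) * ⟪z, gramian A B t₀ t₁ z⟫_ℝ) := by
        gcongr
        linarith
    _ = ⟪z, gramian A B t₀ t₁ z⟫_ℝ := by field_simp

end Gramian

section LoewnerOrder

variable {E : Type*} [NormedAddCommGroup E] [InnerProductSpace ℝ E] {M : E →L[ℝ] E} {a : ℝ}

theorem isPositive_of_smul_one_le (ha : 0 ≤ a) (h : a • (1 : E →L[ℝ] E) ≤ M) : M.IsPositive :=
  M.nonneg_iff_isPositive.1 <| h.trans' <| (ContinuousLinearMap.nonneg_iff_isPositive _).2 <|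
    ContinuousLinearMap.isPositive_one.smul_of_nonneg ha

theorem le_inner_of_smul_one_le (h : a • (1 : E →L[ℝ] E) ≤ M) (x : E) :
    a * ‖x‖ ^ 2 ≤ ⟪x, M x⟫_ℝ := by
  have := ((ContinuousLinearMap.le_def _ _).1 h).inner_nonneg_right x
  simp only [sub_apply, smul_apply, one_apply_eq_self,
    inner_sub_right, inner_smul_right, real_inner_self_eq_norm_sq] at this
  linarith

theorem inner_le_of_le_smul_one (h : M ≤ a • (1 : E →L[ℝ] E)) (x : E) :
    ⟪x, M x⟫_ℝ ≤ a * ‖x‖ ^ 2 := by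
  have := ((ContinuousLinearMap.le_def _ _).1 h).inner_nonneg_right x
  simp only [sub_apply, smul_apply, one_apply_eq_self,
    inner_sub_right, inner_smul_right, real_inner_self_eq_norm_sq] at this
  linarith

theorem inner_apply_le_of_norm_le (h : ‖M‖ ≤ a) (x : E) : ⟪x, M x⟫_ℝ ≤ a * ‖x‖ ^ 2 :=
  calc ⟪x, M x⟫_ℝ ≤ ‖x‖ * (a * ‖x‖) :=
        (real_inner_le_norm _ _).trans (by gcongr; exact M.le_of_opNorm_le h x)
    _ = a * ‖x‖ ^ 2 := by ring

theorem two_mul_inner_le_of_isPositive (hM : M.IsPositive) (x z : E) :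
    2 * ⟪z, M x⟫_ℝ ≤ ⟪x, M x⟫_ℝ + ⟪z, M z⟫_ℝ := by
  have hsq := hM.inner_nonneg_right (z - x)
  have hsymm : ⟪x, M z⟫_ℝ = ⟪z, M x⟫_ℝ := by rw [← hM.inner_left_eq_inner_right, real_inner_comm]
  rw [map_sub, inner_sub_left, inner_sub_right, inner_sub_right, hsymm] at hsq
  linarith

theorem inner_sub_half_mul_inner_le {N : ℝ} (ha : 0 < a) (hN : 0 < N) {x : E}
    (h : a * ‖x‖ ^ 2 ≤ ⟪x, M x⟫_ℝ) (p : E) :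
    ⟪p, x⟫_ℝ - N / 2 * ⟪x, M x⟫_ℝ ≤ ‖p‖ ^ 2 / (2 * (N * a)) := by
  have hyoung := neg_inner_le_norm_sq_add_norm_sq (mul_pos hN ha) (-p) x
  rw [inner_neg_left, neg_neg, norm_neg] at hyoung
  calc ⟪p, x⟫_ℝ - N / 2 * ⟪x, M x⟫_ℝ ≤ ⟪p, x⟫_ℝ - N / 2 * (a * ‖x‖ ^ 2) := by gcongr
    _ ≤ 1 / (2 * (N * a)) * ‖p‖ ^ 2 := by linarith
    _ = ‖p‖ ^ 2 / (2 * (N * a)) := one_div_mul_eq_div _ _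

end LoewnerOrder

theorem norm_add_sq_le_two_mul {E : Type*} [SeminormedAddCommGroup E] (x y : E) :
    ‖x + y‖ ^ 2 ≤ 2 * ‖x‖ ^ 2 + 2 * ‖y‖ ^ 2 :=
  calc ‖x + y‖ ^ 2 ≤ (‖x‖ + ‖y‖) ^ 2 := by gcongr; exact norm_add_le x y
    _ ≤ 2 * ‖x‖ ^ 2 + 2 * ‖y‖ ^ 2 := by linarith [add_sq_le (a := ‖x‖) (b := ‖y‖)]

theorem norm_comp_comp_le {E F G H : Type*} [SeminormedAddCommGroup E] [NormedSpace ℝ E]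
    [SeminormedAddCommGroup F] [NormedSpace ℝ F] [SeminormedAddCommGroup G] [NormedSpace ℝ G]
    [SeminormedAddCommGroup H] [NormedSpace ℝ H] {L : G →L[ℝ] H} {M : F →L[ℝ] G} {N : E →L[ℝ] F}
    {l m n : ℝ} (hL : ‖L‖ ≤ l) (hM : ‖M‖ ≤ m) (hN : ‖N‖ ≤ n) : ‖L ∘L M ∘L N‖ ≤ l * (m * n) := by
  have hl : 0 ≤ l := (norm_nonneg _).trans hL
  have hm : 0 ≤ m := (norm_nonneg _).trans hM
  calc ‖L ∘L M ∘L N‖ ≤ ‖L‖ * (‖M‖ * ‖N‖) := (L.opNorm_comp_le _).trans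
        (mul_le_mul_of_nonneg_left (M.opNorm_comp_le N) (norm_nonneg _))
    _ ≤ l * (m * n) := by gcongr

namespace LQConstants

variable (c : LQConstants)

theorem lamQ_pos : 0 < c.lamQ := c.γQ_pos.trans_le c.γQ_le_lamQ

theorem kappa_pos : 0 < c.kappa := by
  have := c.lamA_pos; have := c.lamB_pos; have := c.lamH_pos; have := c.γR_pos
  unfold kappa; positivity

theorem one_lt_exp_kappa : 1 < Real.exp (2 * c.kappa * c.σ) := by
  have := c.kappa_pos; have := c.σ_pos
  exact Real.one_lt_exp_iff.2 (by positivity)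

theorem exp_neg_mul_exp_kappa :
    Real.exp (-2 * c.kappa * c.σ) * Real.exp (2 * c.kappa * c.σ) = 1 := by
  rw [← Real.exp_add]
  ring_nf
  exact Real.exp_zero

theorem α₀'_pos : 0 < c.α₀' := by
  have := c.lamA_pos; have := c.lamH_pos; have := c.γR_pos; have := c.α₀_pos; have := c.α₁_pos
  have := c.σ_pos
  have : 0 < Real.exp (2 * c.lamA * c.σ) - 1 := sub_pos.2 (Real.one_lt_exp_iff.2 (by positivity))
  unfold α₀'; positivity

theorem α₁'_eq : c.α₁' = c.lamB ^ 2 * (Real.exp (2 * c.kappa * c.σ) - 1) / (2 * c.kappa) := by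
  unfold α₁'; ring_nf

theorem α₁'_pos : 0 < c.α₁' := by
  have := c.kappa_pos; have := c.lamB_pos; have := sub_pos.2 c.one_lt_exp_kappa
  rw [α₁'_eq]; positivity

theorem αt₀_pos : 0 < c.αt₀ := by
  have := c.kappa_pos
  have : Real.exp (-2 * c.kappa * c.σ) < 1 :=
    Real.exp_lt_one_iff.2 (by linarith [mul_pos c.kappa_pos c.σ_pos])
  have := sub_pos.2 this
  unfold αt₀; positivity

theorem αt₀_le_σ : c.αt₀ ≤ c.σ := by
  have := c.kappa_pos
  have := Real.add_one_le_exp (-2 * c.kappa * c.σ)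
  rw [αt₀, one_div, inv_mul_le_iff₀ (by positivity)]
  linarith

theorem αt₁_pos : 0 < c.αt₁ := by
  have := c.kappa_pos; have := sub_pos.2 c.one_lt_exp_kappa
  unfold αt₁; positivity

theorem c₀_pos : 0 < c.c₀ := by
  have := c.kappa_pos; have := c.lamB_pos; have := c.γR_pos; have := c.γQ_pos
  have := c.αt₀_pos; have := c.αt₁_pos
  unfold c₀
  exact mul_pos (lt_min (by positivity) (by positivity)) (Real.exp_pos _)

theorem c₁_pos : 0 < c.c₁ := by
  have := c.kappa_pos; have := c.lamQ_pos; have := c.lamH_pos; have := c.γR_pos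
  unfold c₁
  exact mul_pos (lt_max_of_lt_right (by positivity)) (Real.exp_pos _)

theorem ρZ_pos : 0 < c.ρZ := by
  have := c.c₁_pos; have := c.γQ_pos
  unfold ρZ; positivity

theorem cZ_pos : 0 < c.cZ := Real.sqrt_pos.2 (div_pos c.c₁_pos c.c₀_pos)

theorem Lamb_pos : 0 < c.Lamb := by
  have := c.c₁_pos; have := c.lamB_pos; have := c.lamH_pos; have := c.γR_pos; have := c.lamG_pos
  unfold Lamb
  exact mul_pos (by positivity) (lt_max_of_lt_left c.cZ_pos)

theorem weight_le_dual_weight : c.lamB ^ 2 / c.γR + 1 / (c.γQ * c.σ ^ 2) ≤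
    c.lamB ^ 2 / c.γR * (1 + c.αt₁ / c.αt₀) ^ 2 + 1 / (c.γQ * c.αt₀ ^ 2) := by
  have := c.lamB_pos; have := c.γR_pos; have := c.γQ_pos
  have := c.αt₀_pos; have := c.αt₁_pos
  have : 1 ≤ (1 + c.αt₁ / c.αt₀) ^ 2 := one_le_pow₀ (le_add_of_nonneg_right (by positivity))
  gcongr
  · exact le_mul_of_one_le_right (by positivity) this
  · exact c.αt₀_le_σ

theorem c₀_mul_interior_le_one : c.c₀ * ((c.lamB ^ 2 / c.γR + 1 / (c.γQ * c.σ ^ 2)) *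
    ((Real.exp (2 * c.kappa * c.σ) - 1) / (2 * c.kappa))) ≤ 1 := by
  have := c.kappa_pos; have := c.lamB_pos; have := c.γR_pos; have := c.γQ_pos
  have := c.αt₀_pos; have := c.αt₁_pos; have := c.σ_pos
  have hweight := c.weight_le_dual_weight
  set w : ℝ := c.lamB ^ 2 / c.γR * (1 + c.αt₁ / c.αt₀) ^ 2 + 1 / (c.γQ * c.αt₀ ^ 2)
  have hw_pos : 0 < w := by positivity
  have hc₀ : c.c₀ ≤ 2 * c.kappa * w⁻¹ * Real.exp (-2 * c.kappa * c.σ) :=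
    mul_le_mul_of_nonneg_right (min_le_left _ _) (Real.exp_pos _).le
  have := c.c₀_pos; have := sub_pos.2 c.one_lt_exp_kappa
  calc c.c₀ * ((c.lamB ^ 2 / c.γR + 1 / (c.γQ * c.σ ^ 2)) *
        ((Real.exp (2 * c.kappa * c.σ) - 1) / (2 * c.kappa)))
      ≤ c.c₀ * (w * (Real.exp (2 * c.kappa * c.σ) / (2 * c.kappa))) := by
        gcongr
        linarith
    _ ≤ (2 * c.kappa * w⁻¹ * Real.exp (-2 * c.kappa * c.σ)) *
        (w * (Real.exp (2 * c.kappa * c.σ) / (2 * c.kappa))) :=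
        mul_le_mul_of_nonneg_right hc₀ (by positivity)
    _ = Real.exp (-2 * c.kappa * c.σ) * Real.exp (2 * c.kappa * c.σ) := by field_simp
    _ = 1 := c.exp_neg_mul_exp_kappa

theorem c₀_mul_terminal_le_one : c.c₀ * (Real.exp (2 * c.kappa * c.σ) *
    (c.lamB ^ 2 / (2 * c.γR * c.kappa) + 1 / c.γQ)) ≤ 1 := by
  have := c.kappa_pos; have := c.lamB_pos; have := c.γR_pos; have := c.γQ_pos
  set w : ℝ := c.lamB ^ 2 / (2 * c.γR * c.kappa) + 1 / c.γQ
  have hw_pos : 0 < w := by positivity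
  have hc₀ : c.c₀ ≤ w⁻¹ * Real.exp (-2 * c.kappa * c.σ) :=
    mul_le_mul_of_nonneg_right (min_le_right _ _) (Real.exp_pos _).le
  calc c.c₀ * (Real.exp (2 * c.kappa * c.σ) * w)
      ≤ (w⁻¹ * Real.exp (-2 * c.kappa * c.σ)) * (Real.exp (2 * c.kappa * c.σ) * w) :=
        mul_le_mul_of_nonneg_right hc₀ (by positivity)
    _ = Real.exp (-2 * c.kappa * c.σ) * Real.exp (2 * c.kappa * c.σ) := by field_simp
    _ = 1 := c.exp_neg_mul_exp_kappa

theorem lamQ_le_add : c.lamQ ≤ c.lamQ + c.lamH ^ 2 / c.γR :=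
  le_add_of_nonneg_right (div_nonneg (sq_nonneg _) c.γR_pos.le)

theorem steering_cost_le_c₁ : (Real.exp (2 * c.kappa * c.σ) - 1) / (2 * c.kappa) *
    (c.lamQ * (1 + c.α₁' / c.α₀') ^ 2 + c.lamR * c.lamB ^ 2 / c.α₀' ^ 2) ≤ c.c₁ := by
  have := c.kappa_pos; have := c.lamQ_pos; have := c.lamR_pos; have := c.lamB_pos
  have := c.α₀'_pos; have := c.α₁'_pos; have := c.lamQ_le_add
  refine le_trans ?_ (mul_le_mul_of_nonneg_right (le_max_left _ _) (Real.exp_pos _).le)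
  calc _ ≤ Real.exp (2 * c.kappa * c.σ) / (2 * c.kappa) *
        ((c.lamQ + c.lamH ^ 2 / c.γR) * (1 + c.α₁' / c.α₀') ^ 2
          + c.lamR * c.lamB ^ 2 / c.α₀' ^ 2) := by gcongr; linarith
    _ = _ := by ring

theorem terminal_cost_le_c₁ : c.lamQ * Real.exp (2 * c.kappa * c.σ) +
    (Real.exp (2 * c.kappa * c.σ) - 1) / (2 * c.kappa) * c.lamQ ≤ c.c₁ := by
  have := c.kappa_pos; have := c.lamQ_pos; have := c.lamQ_le_add
  refine le_trans ?_ (mul_le_mul_of_nonneg_right (le_max_right _ _) (Real.exp_pos _).le)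
  calc _ ≤ (c.lamQ + c.lamH ^ 2 / c.γR) * Real.exp (2 * c.kappa * c.σ) +
        Real.exp (2 * c.kappa * c.σ) / (2 * c.kappa) * (c.lamQ + c.lamH ^ 2 / c.γR) := by
        gcongr
        linarith
    _ = _ := by ring

end LQConstants

namespace LQProblem

variable {nx nu nd : ℕ} {P : LQProblem nx nu nd} {c : LQConstants}

/-- The standing assumptions for coefficients that are continuous, bounded and coercive on the whole
line. A problem satisfying `LQProblem.Assumptions` has such an extension, and working with it avoids
one-sided derivatives at the ends of `[0, T]`. -/
structure Regular (P : LQProblem nx nu nd) (c : LQConstants) : Prop where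
  σ_lt_T : c.σ < P.T
  contA : Continuous P.A
  contB : Continuous P.B
  contC : Continuous P.C
  contQ : Continuous P.Q
  contH : Continuous P.H
  contR : Continuous P.R
  contG : Continuous P.G
  contW : Continuous P.W
  boundA : ∀ t, ‖P.A t‖ ≤ c.lamA
  boundB : ∀ t, ‖P.B t‖ ≤ c.lamB
  boundQ : ∀ t, ‖P.Q t‖ ≤ c.lamQ
  boundH : ∀ t, ‖P.H t‖ ≤ c.lamH
  boundR : ∀ t, ‖P.R t‖ ≤ c.lamR
  boundGT : ‖P.GT‖ ≤ c.lamG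
  controllable : ∀ t₀ ∈ Icc 0 (P.T - c.σ), ∃ t₁ ∈ Icc t₀ (t₀ + c.σ),
    c.α₀ • (1 : Mat nx nx) ≤ gramian P.A P.B t₀ t₁ ∧
    gramian P.A P.B t₀ t₁ ≤ c.α₁ • (1 : Mat nx nx)
  coerciveR : ∀ t, c.γR • (1 : Mat nu nu) ≤ P.R t
  coerciveQ : ∀ t, c.γQ • (1 : Mat nx nx) ≤ P.Q t - (P.H t)† ∘L (P.R t).inverse ∘L P.H t
  coerciveQT : c.γQ • (1 : Mat nx nx) ≤ P.QT
  boundQT : P.QT ≤ c.lamQ • (1 : Mat nx nx)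

/-- The inverse `R⁻¹` of the control weight. -/
def Rinv (P : LQProblem nx nu nd) (t : ℝ) : Mat nu nu := (P.R t).inverse

/-- The drift `A - B R⁻¹ H` left after the cross term `H` is removed by the feedback
`u = v - R⁻¹ H x`. -/
def reducedA (P : LQProblem nx nu nd) (t : ℝ) : Mat nx nx := P.A t - P.B t ∘L P.Rinv t ∘L P.H t

/-- The state weight `Q - Hᵀ R⁻¹ H` left after the cross term `H` is removed by the feedback
`u = v - R⁻¹ H x`. -/
def reducedQ (P : LQProblem nx nu nd) (t : ℝ) : Mat nx nx :=
  P.Q t - (P.H t)† ∘L P.Rinv t ∘L P.H t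

/-- The quadratic term `B R⁻¹ Bᵀ` of the Hamiltonian system. -/
def inputWeight (P : LQProblem nx nu nd) (t : ℝ) : Mat nx nx := P.B t ∘L P.Rinv t ∘L (P.B t)†

theorem inner_inputWeight (t : ℝ) (x y : Vec nx) :
    ⟪x, P.inputWeight t y⟫_ℝ = ⟪((P.B t)†) x, P.Rinv t (((P.B t)†) y)⟫_ℝ := by
  rw [ContinuousLinearMap.adjoint_inner_left]; rfl

namespace Regular

theorem T_pos (h : P.Regular c) : 0 < P.T := c.σ_pos.trans h.σ_lt_T

theorem isPositive_R (h : P.Regular c) (t : ℝ) : (P.R t).IsPositive :=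
  isPositive_of_smul_one_le c.γR_pos.le (h.coerciveR t)

theorem le_inner_R (h : P.Regular c) (t : ℝ) (x : Vec nu) : c.γR * ‖x‖ ^ 2 ≤ ⟪x, P.R t x⟫_ℝ :=
  le_inner_of_smul_one_le (h.coerciveR t) x

theorem isUnit_R (h : P.Regular c) (t : ℝ) : IsUnit (P.R t) :=
  isUnit_of_le_inner c.γR_pos (h.le_inner_R t)

theorem R_Rinv (h : P.Regular c) (t : ℝ) (x : Vec nu) : P.R t (P.Rinv t x) = x := by
  have := Ring.mul_inverse_cancel _ (h.isUnit_R t)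
  rw [ContinuousLinearMap.ringInverse_eq_inverse] at this
  exact DFunLike.congr_fun this x

theorem continuous_Rinv (h : P.Regular c) : Continuous P.Rinv := by
  have hRinv : P.Rinv = fun t => Ring.inverse (P.R t) := by
    funext t; rw [ContinuousLinearMap.ringInverse_eq_inverse]; rfl
  rw [hRinv]
  refine continuous_iff_continuousAt.2 fun t => ?_
  obtain ⟨u, hu⟩ := h.isUnit_R t
  have hinv := NormedRing.inverse_continuousAt u
  rw [hu] at hinv
  exact ContinuousAt.comp (f := P.R) hinv h.contR.continuousAt

theorem isPositive_Rinv (h : P.Regular c) (t : ℝ) : (P.Rinv t).IsPositive := by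
  refine (ContinuousLinearMap.isPositive_iff _).2 ⟨fun x y => ?_, fun x => ?_⟩
  · simp only [ContinuousLinearMap.coe_coe]
    conv_lhs => rw [← h.R_Rinv t y]
    rw [← (h.isPositive_R t).inner_left_eq_inner_right, h.R_Rinv]
  · simpa only [h.R_Rinv] using (h.isPositive_R t).inner_nonneg_right (P.Rinv t x)

theorem norm_Rinv_le (h : P.Regular c) (t : ℝ) : ‖P.Rinv t‖ ≤ 1 / c.γR := by
  refine ContinuousLinearMap.opNorm_le_bound _ (one_div_pos.2 c.γR_pos).le fun x => ?_
  have hx := norm_le_norm_apply_div_of_le_inner c.γR_pos (h.le_inner_R t) (P.Rinv t x)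
  rwa [h.R_Rinv, div_eq_inv_mul, ← one_div] at hx

theorem norm_Rinv_apply_le (h : P.Regular c) (t : ℝ) (x : Vec nu) :
    ‖P.Rinv t x‖ ≤ 1 / c.γR * ‖x‖ :=
  (P.Rinv t).le_of_opNorm_le (h.norm_Rinv_le t) x

theorem norm_Rinv_H_apply_le (h : P.Regular c) (t : ℝ) (x : Vec nx) :
    ‖P.Rinv t (P.H t x)‖ ≤ c.lamH / c.γR * ‖x‖ := by
  have := c.γR_pos
  calc ‖P.Rinv t (P.H t x)‖ ≤ 1 / c.γR * (c.lamH * ‖x‖) :=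
        (h.norm_Rinv_apply_le t _).trans (by
          gcongr
          exact (P.H t).le_of_opNorm_le (h.boundH t) _)
    _ = c.lamH / c.γR * ‖x‖ := by ring

theorem continuous_reducedA (h : P.Regular c) : Continuous P.reducedA :=
  h.contA.sub (h.contB.clm_comp (h.continuous_Rinv.clm_comp h.contH))

theorem continuous_reducedQ (h : P.Regular c) : Continuous P.reducedQ :=
  h.contQ.sub ((continuous_adjoint h.contH).clm_comp (h.continuous_Rinv.clm_comp h.contH))

theorem continuous_inputWeight (h : P.Regular c) : Continuous P.inputWeight :=
  h.contB.clm_comp (h.continuous_Rinv.clm_comp (continuous_adjoint h.contB))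

theorem norm_reducedA_le (h : P.Regular c) (t : ℝ) : ‖P.reducedA t‖ ≤ c.kappa :=
  calc ‖P.reducedA t‖ ≤ c.lamA + c.lamB * (1 / c.γR * c.lamH) := (norm_sub_le _ _).trans
        (add_le_add (h.boundA t) (norm_comp_comp_le (h.boundB t) (h.norm_Rinv_le t) (h.boundH t)))
    _ = c.kappa := by unfold LQConstants.kappa; ring

theorem norm_inputWeight_le (h : P.Regular c) (t : ℝ) : ‖P.inputWeight t‖ ≤ c.lamB ^ 2 / c.γR :=
  calc ‖P.inputWeight t‖ ≤ c.lamB * (1 / c.γR * c.lamB) :=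
        norm_comp_comp_le (h.boundB t) (h.norm_Rinv_le t) (norm_adjoint_le (h.boundB t))
    _ = c.lamB ^ 2 / c.γR := by ring

theorem norm_reducedQ_le (h : P.Regular c) (t : ℝ) :
    ‖P.reducedQ t‖ ≤ c.lamQ + c.lamH ^ 2 / c.γR :=
  calc ‖P.reducedQ t‖ ≤ c.lamQ + c.lamH * (1 / c.γR * c.lamH) :=
        (norm_sub_le _ _).trans (add_le_add (h.boundQ t)
          (norm_comp_comp_le (norm_adjoint_le (h.boundH t)) (h.norm_Rinv_le t) (h.boundH t)))
    _ = c.lamQ + c.lamH ^ 2 / c.γR := by ring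

theorem isPositive_reducedQ (h : P.Regular c) (t : ℝ) : (P.reducedQ t).IsPositive :=
  isPositive_of_smul_one_le c.γQ_pos.le (h.coerciveQ t)

theorem le_inner_reducedQ (h : P.Regular c) (t : ℝ) (x : Vec nx) :
    c.γQ * ‖x‖ ^ 2 ≤ ⟪x, P.reducedQ t x⟫_ℝ :=
  le_inner_of_smul_one_le (h.coerciveQ t) x

theorem inner_reducedQ_le (h : P.Regular c) (t : ℝ) (x : Vec nx) :
    ⟪x, P.reducedQ t x⟫_ℝ ≤ c.lamQ * ‖x‖ ^ 2 :=
  calc ⟪x, P.reducedQ t x⟫_ℝ = ⟪x, P.Q t x⟫_ℝ - ⟪P.H t x, P.Rinv t (P.H t x)⟫_ℝ := by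
        simp only [reducedQ, sub_apply, ContinuousLinearMap.comp_apply, inner_sub_right,
          ContinuousLinearMap.adjoint_inner_right]
    _ ≤ ⟪x, P.Q t x⟫_ℝ := sub_le_self _ ((h.isPositive_Rinv t).inner_nonneg_right _)
    _ ≤ c.lamQ * ‖x‖ ^ 2 := inner_apply_le_of_norm_le (h.boundQ t) x

theorem inner_R_le (h : P.Regular c) (t : ℝ) (x : Vec nu) :
    ⟪x, P.R t x⟫_ℝ ≤ c.lamR * ‖x‖ ^ 2 :=
  inner_apply_le_of_norm_le (h.boundR t) x

theorem isPositive_QT (h : P.Regular c) : P.QT.IsPositive :=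
  isPositive_of_smul_one_le c.γQ_pos.le h.coerciveQT

theorem isPositive_inputWeight (h : P.Regular c) (t : ℝ) : (P.inputWeight t).IsPositive :=
  (h.isPositive_Rinv t).conj_adjoint (P.B t)

theorem inner_inputWeight_self (h : P.Regular c) (t : ℝ) (y : Vec nx) :
    ⟪y, P.inputWeight t y⟫_ℝ =
      ⟪P.Rinv t (((P.B t)†) y), P.R t (P.Rinv t (((P.B t)†) y))⟫_ℝ := by
  rw [inner_inputWeight, h.R_Rinv, real_inner_comm]

theorem integral_norm_add_Rinv_H_sq_le (h : P.Regular c) {t₀ t₁ r : ℝ} (ht : t₀ ≤ t₁)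
    (ht₁ : t₁ ≤ t₀ + c.σ) {x : ℝ → Vec nx} (hx : Continuous x)
    (hxr : ∀ t ∈ Icc t₀ t₁, ‖x t‖ ≤ Real.exp (c.lamA * (t - t₀)) * r) {w : ℝ → Vec nu}
    (hw : Continuous w) :
    ∫ t in t₀..t₁, ‖w t + P.Rinv t (P.H t (x t))‖ ^ 2 ≤ 2 * (∫ t in t₀..t₁, ‖w t‖ ^ 2) +
      (Real.exp (2 * c.lamA * c.σ) - 1) / (2 * c.lamA) * (2 * (c.lamH / c.γR * r) ^ 2) := by
  have := c.lamA_pos; have := c.lamH_pos; have := c.γR_pos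
  set D : ℝ := 2 * (c.lamH / c.γR * r) ^ 2
  have hfeedback : ∀ t ∈ Icc t₀ t₁,
      2 * ‖P.Rinv t (P.H t (x t))‖ ^ 2 ≤ Real.exp (2 * c.lamA * (t - t₀)) * D := fun t ht =>
    calc 2 * ‖P.Rinv t (P.H t (x t))‖ ^ 2
        ≤ 2 * (Real.exp (2 * c.lamA * (t - t₀)) * (c.lamH / c.γR * r) ^ 2) := by
          refine mul_le_mul_of_nonneg_left (sq_le_exp_mul_sq (norm_nonneg _) ?_) zero_le_two
          calc ‖P.Rinv t (P.H t (x t))‖ ≤ c.lamH / c.γR * ‖x t‖ := h.norm_Rinv_H_apply_le t _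
            _ ≤ c.lamH / c.γR * (Real.exp (c.lamA * (t - t₀)) * r) := by gcongr; exact hxr t ht
            _ = Real.exp (c.lamA * (t - t₀)) * (c.lamH / c.γR * r) := mul_left_comm _ _ _
      _ = Real.exp (2 * c.lamA * (t - t₀)) * D := mul_left_comm _ _ _
  have hsum : Continuous fun t => w t + P.Rinv t (P.H t (x t)) :=
    hw.add (h.continuous_Rinv.clm_apply (h.contH.clm_apply hx))
  have hw₂ : Continuous fun t => 2 * ‖w t‖ ^ 2 := by fun_prop
  have hexp : Continuous fun t => Real.exp (2 * c.lamA * (t - t₀)) * D := by fun_prop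
  calc ∫ t in t₀..t₁, ‖w t + P.Rinv t (P.H t (x t))‖ ^ 2
      ≤ ∫ t in t₀..t₁, (2 * ‖w t‖ ^ 2 + Real.exp (2 * c.lamA * (t - t₀)) * D) :=
        intervalIntegral.integral_mono_on ht ((hsum.norm.pow 2).intervalIntegrable _ _)
          ((hw₂.add hexp).intervalIntegrable _ _) fun t ht =>
            (norm_add_sq_le_two_mul _ _).trans (add_le_add_right (hfeedback t ht) _)
    _ = 2 * (∫ t in t₀..t₁, ‖w t‖ ^ 2) + ∫ t in t₀..t₁, Real.exp (2 * c.lamA * (t - t₀)) * D := by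
        rw [intervalIntegral.integral_add (hw₂.intervalIntegrable _ _)
          (hexp.intervalIntegrable _ _), intervalIntegral.integral_const_mul]
    _ ≤ _ := by
        gcongr
        exact integral_exp_mul_sub_mul_le (by positivity) ht₁ (by positivity)

/- A control `w` steering the state of `(A, B)` to zero becomes the control `w + R⁻¹ H x` steering
the same state of `(A - B R⁻¹ H, B)`. -/
theorem le_inner_gramian_reducedA (h : P.Regular c) {t₀ t₁ : ℝ} (ht₁ : t₁ ∈ Icc t₀ (t₀ + c.σ))
    (hlo : c.α₀ • (1 : Mat nx nx) ≤ gramian P.A P.B t₀ t₁)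
    (hhi : gramian P.A P.B t₀ t₁ ≤ c.α₁ • (1 : Mat nx nx)) (z : Vec nx) :
    c.α₀' * ‖z‖ ^ 2 ≤ ⟪z, gramian P.reducedA P.B t₀ t₁ z⟫_ℝ := by
  have := c.lamA_pos; have := c.γR_pos; have := c.α₀_pos
  obtain ⟨x, y, hx₀, hx₁, hx, hy, hxb, -, hE⟩ := exists_steering h.contA h.boundA h.contB c.α₀_pos
    c.α₁_pos.le (le_inner_of_smul_one_le hlo) (inner_le_of_le_smul_one hhi) z
  have hxc : Continuous x := continuous_iff_continuousAt.2 fun t => (hx t).continuousAt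
  have hBy : Continuous fun t => -((P.B t)†) (y t) :=
    ((continuous_adjoint h.contB).clm_apply hy).neg
  refine le_inner_gramian_of_steering h.continuous_reducedA h.norm_reducedA_le h.contB ht₁.1
    c.α₀'_pos hx₀ hx₁ (v := fun t => -((P.B t)†) (y t) + P.Rinv t (P.H t (x t)))
    (fun t => (hx t).congr_deriv ?_)
    (hBy.add (h.continuous_Rinv.clm_apply (h.contH.clm_apply hxc))) ?_
  · simp only [reducedA, sub_apply, ContinuousLinearMap.comp_apply, map_add]
    abel
  · refine (h.integral_norm_add_Rinv_H_sq_le ht₁.1 ht₁.2 hxc hxb hBy).trans ?_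
    simp only [norm_neg]
    calc _ ≤ 2 * (‖z‖ ^ 2 / c.α₀) + _ := by gcongr
      _ = ‖z‖ ^ 2 / c.α₀' := by
          rw [LQConstants.α₀', div_inv_eq_mul]
          field_simp

theorem exists_gramian_reducedA_bounds (h : P.Regular c) {t₀ : ℝ}
    (ht₀ : t₀ ∈ Icc 0 (P.T - c.σ)) :
    ∃ t₁ ∈ Icc t₀ (t₀ + c.σ),
      (∀ z, c.α₀' * ‖z‖ ^ 2 ≤ ⟪z, gramian P.reducedA P.B t₀ t₁ z⟫_ℝ) ∧
      ∀ z, ⟪z, gramian P.reducedA P.B t₀ t₁ z⟫_ℝ ≤ c.α₁' * ‖z‖ ^ 2 := by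
  obtain ⟨t₁, ht₁, hlo, hhi⟩ := h.controllable t₀ ht₀
  refine ⟨t₁, ht₁, h.le_inner_gramian_reducedA ht₁ hlo hhi, ?_⟩
  rw [c.α₁'_eq]
  exact inner_gramian_le h.continuous_reducedA h.norm_reducedA_le h.contB c.kappa_pos h.boundB
    ht₁.1 ht₁.2

end Regular

end LQProblem

theorem mul_le_of_sub_half_mul_le {k N a v : ℝ} (hk : 0 ≤ k) (hkN : k * N ≤ 1) (hv : 0 ≤ v)
    (h : a - N / 2 * v ≤ a / 2) : k * a ≤ v :=
  calc k * a ≤ k * (N * v) := by gcongr; linarith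
    _ = k * N * v := (mul_assoc _ _ _).symm
    _ ≤ v := mul_le_of_le_one_left hv hkN

namespace LQProblem

variable {nx nu nd : ℕ} {P : LQProblem nx nu nd} {c : LQConstants} {x y : ℝ → Vec nx}

namespace Regular

theorem inner_sub_half_mul_rate_le (h : P.Regular c) {φ N : ℝ} (hφ : φ ∈ Icc 0 1) (hN : 0 < N)
    (m t : ℝ) (ψ x y : Vec nx) :
    m * ⟪ψ, x⟫_ℝ + φ * ⟪ψ, P.inputWeight t y⟫_ℝ -
        N / 2 * (⟪x, P.reducedQ t x⟫_ℝ + ⟪y, P.inputWeight t y⟫_ℝ) ≤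
      ‖ψ‖ ^ 2 * (1 / (2 * N) * (m ^ 2 / c.γQ + c.lamB ^ 2 / c.γR)) := by
  have := c.γQ_pos; have := c.γR_pos
  set p : Vec nu := ((P.B t)†) ψ
  set v : Vec nu := P.Rinv t (((P.B t)†) y)
  have hstate : m * ⟪ψ, x⟫_ℝ - N / 2 * ⟪x, P.reducedQ t x⟫_ℝ ≤ ‖m • ψ‖ ^ 2 / (2 * (N * c.γQ)) := by
    rw [← real_inner_smul_left]
    exact inner_sub_half_mul_inner_le c.γQ_pos hN (h.le_inner_reducedQ t x) _
  have hcontrol : φ * ⟪p, v⟫_ℝ - N / 2 * ⟪v, P.R t v⟫_ℝ ≤ ‖φ • p‖ ^ 2 / (2 * (N * c.γR)) := by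
    rw [← real_inner_smul_left]
    exact inner_sub_half_mul_inner_le c.γR_pos hN (h.le_inner_R t v) _
  have hp : ‖φ • p‖ ≤ c.lamB * ‖ψ‖ := by
    rw [norm_smul, Real.norm_of_nonneg hφ.1]
    exact (mul_le_of_le_one_left (norm_nonneg _) hφ.2).trans
      (ContinuousLinearMap.le_of_opNorm_le _ (norm_adjoint_le (h.boundB t)) ψ)
  rw [inner_inputWeight, h.inner_inputWeight_self]
  calc _ = (m * ⟪ψ, x⟫_ℝ - N / 2 * ⟪x, P.reducedQ t x⟫_ℝ) +
        (φ * ⟪p, v⟫_ℝ - N / 2 * ⟪v, P.R t v⟫_ℝ) := by ring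
    _ ≤ ‖m • ψ‖ ^ 2 / (2 * (N * c.γQ)) + (c.lamB * ‖ψ‖) ^ 2 / (2 * (N * c.γR)) :=
        add_le_add hstate (hcontrol.trans (by gcongr))
    _ = _ := by
        rw [norm_smul, mul_pow, Real.norm_eq_abs, sq_abs]
        field_simp

theorem two_mul_inner_sub_rate_le (h : P.Regular c) (t : ℝ) (x y ξ : Vec nx) (v : Vec nu) :
    2 * ⟪ξ, P.reducedQ t x⟫_ℝ - 2 * ⟪y, P.B t v⟫_ℝ -
        (⟪x, P.reducedQ t x⟫_ℝ + ⟪y, P.inputWeight t y⟫_ℝ) ≤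
      c.lamQ * ‖ξ‖ ^ 2 + c.lamR * ‖v‖ ^ 2 := by
  have hstate := two_mul_inner_le_of_isPositive (h.isPositive_reducedQ t) x ξ
  have hcontrol := two_mul_inner_le_of_isPositive (h.isPositive_R t) (P.Rinv t (((P.B t)†) y)) (-v)
  rw [← h.inner_inputWeight_self, h.R_Rinv, ContinuousLinearMap.adjoint_inner_right, map_neg,
    map_neg, inner_neg_neg, inner_neg_left, real_inner_comm] at hcontrol
  linarith [h.inner_reducedQ_le t ξ, h.inner_R_le t v]

end Regular

/-- `(x, y)` solves the Hamiltonian system of the problem without the input `d`, in the variables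
reduced by the feedback `u = v - R⁻¹ H x`. -/
structure IsHamiltonian (P : LQProblem nx nu nd) (x y : ℝ → Vec nx) : Prop where
  state : ∀ t, HasDerivAt x (P.reducedA t (x t) - P.inputWeight t (y t)) t
  costate : ∀ t, HasDerivAt y (-(P.reducedQ t (x t)) - ((P.reducedA t)†) (y t)) t

/-- `(x, y)` is a trajectory of the optimal feedback for the problem without inputs: in terms of the
Riccati matrix `Π`, the condition on `y` says `y = Π x`, and `⟪y, x⟫` is the optimal cost-to-go. -/
structure IsClosedLoop (P : LQProblem nx nu nd) (x y : ℝ → Vec nx) : Prop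
    extends P.IsHamiltonian x y where
  terminal : y P.T = P.QT (x P.T)

namespace IsHamiltonian

theorem hasDerivAt_inner (hxy : P.IsHamiltonian x y) (t : ℝ) :
    HasDerivAt (fun t => ⟪y t, x t⟫_ℝ)
      (-(⟪x t, P.reducedQ t (x t)⟫_ℝ + ⟪y t, P.inputWeight t (y t)⟫_ℝ)) t := by
  refine (hasDerivAt_inner_adjoint (hxy.costate t)
    ((hxy.state t).congr_deriv (sub_eq_add_neg _ _))).congr_deriv ?_
  rw [inner_neg_left, inner_neg_right, real_inner_comm (x t) (P.reducedQ t (x t)), neg_add_rev]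

theorem antitone_inner (h : P.Regular c) (hxy : P.IsHamiltonian x y) :
    Antitone fun t => ⟪y t, x t⟫_ℝ := by
  refine antitone_of_deriv_nonpos (fun t => (hxy.hasDerivAt_inner t).differentiableAt) fun t => ?_
  rw [(hxy.hasDerivAt_inner t).deriv, neg_nonpos]
  exact add_nonneg ((h.isPositive_reducedQ t).inner_nonneg_right _)
    ((h.isPositive_inputWeight t).inner_nonneg_right _)

theorem hasDerivAt_half_mul_inner_sub (hxy : P.IsHamiltonian x y) {ψ : ℝ → Vec nx}
    (hψ : ∀ s, HasDerivAt ψ (0 - ((P.reducedA s)†) (ψ s)) s) (t m N s : ℝ) :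
    HasDerivAt (fun s => N / 2 * ⟪y s, x s⟫_ℝ - (1 - m * (s - t)) * ⟪ψ s, x s⟫_ℝ)
      (m * ⟪ψ s, x s⟫_ℝ + (1 - m * (s - t)) * ⟪ψ s, P.inputWeight s (y s)⟫_ℝ - N / 2 *
        (⟪x s, P.reducedQ s (x s)⟫_ℝ + ⟪y s, P.inputWeight s (y s)⟫_ℝ)) s := by
  have hweight : HasDerivAt (fun s => 1 - m * (s - t)) (-m) s := by
    simpa using (((hasDerivAt_id s).sub_const t).const_mul m).const_sub 1
  have hψx := hasDerivAt_inner_adjoint (hψ s)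
    ((hxy.state s).congr_deriv (sub_eq_add_neg _ _))
  refine (((hxy.hasDerivAt_inner s).const_mul (N / 2)).sub (hweight.mul hψx)).congr_deriv ?_
  rw [inner_zero_left, add_zero, inner_neg_right]
  ring

/- The state is tested against the backward flow of `x t`, with the weight `1 - m (s - t)`. -/
theorem norm_sq_sub_inner_le (h : P.Regular c) (hxy : P.IsHamiltonian x y) {t t₁ m N : ℝ}
    (ht₁ : t₁ ∈ Icc t (t + c.σ)) (hm : 0 ≤ m) (hm₁ : m * (t₁ - t) ≤ 1) (hN : 0 < N) :
    ‖x t‖ ^ 2 - N / 2 * ⟪y t, x t⟫_ℝ ≤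
      (1 - m * (t₁ - t)) * ⟪adjointEvolution P.reducedA t₁ t (x t), x t₁⟫_ℝ -
        N / 2 * ⟪y t₁, x t₁⟫_ℝ +
      (Real.exp (2 * c.kappa * c.σ) - 1) / (2 * c.kappa) *
        (‖x t‖ ^ 2 * (1 / (2 * N) * (m ^ 2 / c.γQ + c.lamB ^ 2 / c.γR))) := by
  have := c.γQ_pos; have := c.γR_pos; have := c.kappa_pos
  set ψ : ℝ → Vec nx := fun s => adjointEvolution P.reducedA s t (x t)
  set b : ℝ := 1 / (2 * N) * (m ^ 2 / c.γQ + c.lamB ^ 2 / c.γR)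
  have hderiv := hxy.hasDerivAt_half_mul_inner_sub (ψ := ψ)
    (adjointEvolution_apply_hasDerivAt h.continuous_reducedA h.norm_reducedA_le t (x t)) t m N
  have hrate : ∀ s ∈ Ioo t t₁,
      m * ⟪ψ s, x s⟫_ℝ + (1 - m * (s - t)) * ⟪ψ s, P.inputWeight s (y s)⟫_ℝ - N / 2 *
        (⟪x s, P.reducedQ s (x s)⟫_ℝ + ⟪y s, P.inputWeight s (y s)⟫_ℝ) ≤
      Real.exp (2 * c.kappa * (s - t)) * (‖x t‖ ^ 2 * b) := fun s hs => by
    have hms : m * (s - t) ∈ Icc 0 1 :=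
      ⟨mul_nonneg hm (sub_nonneg.2 hs.1.le), hm₁.trans' (by gcongr; exact hs.2.le)⟩
    refine (h.inner_sub_half_mul_rate_le (sub_mem_Icc_zero_iff_right.2 hms) hN m s _ _ _).trans ?_
    exact (mul_le_mul_of_nonneg_right (sq_le_exp_mul_sq (norm_nonneg _)
      (norm_adjointEvolution_apply_le h.continuous_reducedA h.norm_reducedA_le hs.1.le _))
      (by positivity)).trans_eq (mul_assoc _ _ _)
  have hle := (sub_le_integral_of_hasDerivAt ht₁.1 (fun s _ => hderiv s)
    (Continuous.integrableOn_Icc (by fun_prop)) hrate).trans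
      (integral_exp_mul_sub_mul_le (by positivity) ht₁.2 (by positivity))
  have hψ : ψ t = x t := by simp only [ψ, adjointEvolution_self, one_apply_eq_self]
  simp only [hψ, sub_self, mul_zero, sub_zero, one_mul, real_inner_self_eq_norm_sq] at hle
  linarith

theorem inner_le_add_integral (h : P.Regular c) (hxy : P.IsHamiltonian x y) {ξ : ℝ → Vec nx}
    {v : ℝ → Vec nu} (hξ : ∀ s, HasDerivAt ξ (P.reducedA s (ξ s) + P.B s (v s)) s) {t t₁ : ℝ}
    (ht : t ≤ t₁) (hξt : ξ t = x t) {φ : ℝ → ℝ} (hφ : IntegrableOn φ (Icc t t₁))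
    (hle : ∀ s ∈ Icc t t₁, c.lamQ * ‖ξ s‖ ^ 2 + c.lamR * ‖v s‖ ^ 2 ≤ φ s) :
    ⟪y t, x t⟫_ℝ ≤ 2 * ⟪y t₁, ξ t₁⟫_ℝ - ⟪y t₁, x t₁⟫_ℝ + ∫ s in t..t₁, φ s := by
  have hderiv : ∀ s, HasDerivAt (fun s => ⟪y s, x s⟫_ℝ - 2 * ⟪y s, ξ s⟫_ℝ)
      (2 * ⟪ξ s, P.reducedQ s (x s)⟫_ℝ - 2 * ⟪y s, P.B s (v s)⟫_ℝ -
        (⟪x s, P.reducedQ s (x s)⟫_ℝ + ⟪y s, P.inputWeight s (y s)⟫_ℝ)) s := fun s => by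
    refine ((hxy.hasDerivAt_inner s).sub ((hasDerivAt_inner_adjoint (hxy.costate s)
      (hξ s)).const_mul 2)).congr_deriv ?_
    rw [inner_neg_left, real_inner_comm (ξ s)]
    ring
  have hle := sub_le_integral_of_hasDerivAt ht (fun s _ => hderiv s) hφ fun s hs =>
    (h.two_mul_inner_sub_rate_le s _ _ _ _).trans (hle s (Ioo_subset_Icc_self hs))
  rw [hξt] at hle
  linarith

end IsHamiltonian

namespace IsClosedLoop

theorem le_inner_terminal (h : P.Regular c) (hxy : P.IsClosedLoop x y) :
    c.γQ * ‖x P.T‖ ^ 2 ≤ ⟪y P.T, x P.T⟫_ℝ := by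
  rw [hxy.terminal, real_inner_comm]
  exact le_inner_of_smul_one_le h.coerciveQT _

theorem inner_nonneg (h : P.Regular c) (hxy : P.IsClosedLoop x y) {t : ℝ} (ht : t ≤ P.T) :
    0 ≤ ⟪y t, x t⟫_ℝ :=
  calc 0 ≤ c.γQ * ‖x P.T‖ ^ 2 := mul_nonneg c.γQ_pos.le (sq_nonneg _)
    _ ≤ ⟪y P.T, x P.T⟫_ℝ := hxy.le_inner_terminal h
    _ ≤ ⟪y t, x t⟫_ℝ := hxy.antitone_inner h ht

theorem c₀_mul_le_inner_of_add_le (h : P.Regular c) (hxy : P.IsClosedLoop x y) {t : ℝ}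
    (ht : t + c.σ ≤ P.T) : c.c₀ * ‖x t‖ ^ 2 ≤ ⟪y t, x t⟫_ℝ := by
  have := c.γQ_pos; have := c.γR_pos; have := c.kappa_pos; have := c.lamB_pos; have hσ := c.σ_pos
  have := sub_pos.2 c.one_lt_exp_kappa
  set N : ℝ := (c.lamB ^ 2 / c.γR + 1 / (c.γQ * c.σ ^ 2)) *
    ((Real.exp (2 * c.kappa * c.σ) - 1) / (2 * c.kappa)) with hN_def
  have hN : 0 < N := by positivity
  refine mul_le_of_sub_half_mul_le c.c₀_pos.le c.c₀_mul_interior_le_one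
    (hxy.inner_nonneg h (by linarith)) ?_
  have hle := hxy.norm_sq_sub_inner_le h (t := t) (t₁ := t + c.σ) (m := 1 / c.σ) (N := N)
    ⟨by linarith, le_rfl⟩ (by positivity) (by rw [add_sub_cancel_left, one_div_mul_cancel hσ.ne'])
    hN
  rw [add_sub_cancel_left, one_div_mul_cancel hσ.ne', sub_self, zero_mul] at hle
  have hterminal := mul_nonneg hN.le (hxy.inner_nonneg h ht)
  have hrest : (Real.exp (2 * c.kappa * c.σ) - 1) / (2 * c.kappa) *
      (‖x t‖ ^ 2 * (1 / (2 * N) * ((1 / c.σ) ^ 2 / c.γQ + c.lamB ^ 2 / c.γR))) = ‖x t‖ ^ 2 / 2 :=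
    calc _ = ‖x t‖ ^ 2 * (1 / (2 * N)) * N := by rw [hN_def]; field_simp; ring
      _ = ‖x t‖ ^ 2 / 2 := by field_simp
  linarith

theorem c₀_mul_le_inner_of_lt_add (h : P.Regular c) (hxy : P.IsClosedLoop x y) {t : ℝ}
    (ht : t ≤ P.T) (htσ : P.T < t + c.σ) : c.c₀ * ‖x t‖ ^ 2 ≤ ⟪y t, x t⟫_ℝ := by
  have := c.γQ_pos; have := c.γR_pos; have := c.kappa_pos; have := c.lamB_pos
  set N : ℝ := Real.exp (2 * c.kappa * c.σ) *
    (c.lamB ^ 2 / (2 * c.γR * c.kappa) + 1 / c.γQ) with hN_def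
  have hN : 0 < N := by positivity
  refine mul_le_of_sub_half_mul_le c.c₀_pos.le c.c₀_mul_terminal_le_one (hxy.inner_nonneg h ht) ?_
  set ψ := adjointEvolution P.reducedA P.T t (x t) with hψ_def
  have hle := hxy.norm_sq_sub_inner_le h (m := 0) ⟨ht, htσ.le⟩ le_rfl (by simp) hN
  simp only [zero_mul, sub_zero, one_mul, ← hψ_def] at hle
  have hψ : ‖ψ‖ ^ 2 ≤ Real.exp (2 * c.kappa * c.σ) * ‖x t‖ ^ 2 :=
    (sq_le_exp_mul_sq (norm_nonneg _) (norm_adjointEvolution_apply_le h.continuous_reducedA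
      h.norm_reducedA_le ht _)).trans (by gcongr; linarith)
  have hterminal : ⟪ψ, x P.T⟫_ℝ - N / 2 * ⟪y P.T, x P.T⟫_ℝ ≤
      Real.exp (2 * c.kappa * c.σ) * ‖x t‖ ^ 2 / (2 * (N * c.γQ)) := by
    rw [hxy.terminal, real_inner_comm (x P.T) (P.QT (x P.T))]
    exact (inner_sub_half_mul_inner_le c.γQ_pos hN (le_inner_of_smul_one_le h.coerciveQT _) ψ).trans
      (by gcongr)
  calc _ ≤ Real.exp (2 * c.kappa * c.σ) * ‖x t‖ ^ 2 / (2 * (N * c.γQ)) +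
        Real.exp (2 * c.kappa * c.σ) / (2 * c.kappa) *
          (‖x t‖ ^ 2 * (1 / (2 * N) * (0 ^ 2 / c.γQ + c.lamB ^ 2 / c.γR))) := by
        refine hle.trans (add_le_add hterminal ?_)
        gcongr
        linarith
    _ = ‖x t‖ ^ 2 * (1 / (2 * N)) * N := by rw [hN_def]; field_simp; ring
    _ = ‖x t‖ ^ 2 / 2 := by field_simp

theorem c₀_mul_le_inner (h : P.Regular c) (hxy : P.IsClosedLoop x y) {t : ℝ} (ht : t ≤ P.T) :
    c.c₀ * ‖x t‖ ^ 2 ≤ ⟪y t, x t⟫_ℝ :=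
  (le_or_gt (t + c.σ) P.T).elim (hxy.c₀_mul_le_inner_of_add_le h)
    (hxy.c₀_mul_le_inner_of_lt_add h ht)

theorem two_mul_inner_terminal_sub_le (h : P.Regular c) (hxy : P.IsClosedLoop x y) (z : Vec nx) :
    2 * ⟪y P.T, z⟫_ℝ - ⟪y P.T, x P.T⟫_ℝ ≤ c.lamQ * ‖z‖ ^ 2 := by
  rw [hxy.terminal, real_inner_comm z, real_inner_comm (x P.T)]
  linarith [two_mul_inner_le_of_isPositive h.isPositive_QT (x P.T) z,
    inner_le_of_le_smul_one h.boundQT z]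

/- Compare with the control that steers `x(t)` to zero within time `σ`. -/
theorem inner_le_c₁_mul_of_add_le (h : P.Regular c) (hxy : P.IsClosedLoop x y) {t : ℝ}
    (ht : 0 ≤ t) (htσ : t + c.σ ≤ P.T) : ⟪y t, x t⟫_ℝ ≤ c.c₁ * ‖x t‖ ^ 2 := by
  have := c.kappa_pos; have := c.lamB_pos; have := c.lamQ_pos; have := c.lamR_pos
  have hα₀ := c.α₀'_pos; have hα₁ := c.α₁'_pos
  obtain ⟨t₁, ht₁, hlo, hhi⟩ := h.exists_gramian_reducedA_bounds (t₀ := t) ⟨ht, by linarith⟩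
  obtain ⟨ξ, η, hξt, hξt₁, hξ, -, hξb, hηb, -⟩ := exists_steering h.continuous_reducedA
    h.norm_reducedA_le h.contB hα₀ hα₁.le hlo hhi (x t)
  set k : ℝ := c.lamQ * (1 + c.α₁' / c.α₀') ^ 2 + c.lamR * c.lamB ^ 2 / c.α₀' ^ 2 with hk
  have hcost : ∀ s ∈ Icc t t₁, c.lamQ * ‖ξ s‖ ^ 2 + c.lamR * ‖-((P.B s)†) (η s)‖ ^ 2 ≤
      Real.exp (2 * c.kappa * (s - t)) * (k * ‖x t‖ ^ 2) := fun s hs => by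
    have hv : ‖-((P.B s)†) (η s)‖ ≤
        Real.exp (c.kappa * (s - t)) * (c.lamB * (‖x t‖ / c.α₀')) := by
      rw [norm_neg]
      exact (((P.B s)†).le_of_opNorm_le_of_le (norm_adjoint_le (h.boundB s)) (hηb s hs)).trans_eq
        (mul_left_comm _ _ _)
    calc _ ≤ c.lamQ * (Real.exp (2 * c.kappa * (s - t)) * ((1 + c.α₁' / c.α₀') * ‖x t‖) ^ 2) +
          c.lamR * (Real.exp (2 * c.kappa * (s - t)) * (c.lamB * (‖x t‖ / c.α₀')) ^ 2) := by
          gcongr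
          · exact sq_le_exp_mul_sq (norm_nonneg _) (hξb s hs)
          · exact sq_le_exp_mul_sq (norm_nonneg _) hv
      _ = _ := by rw [hk]; ring
  have hle := hxy.inner_le_add_integral h hξ ht₁.1 hξt
    (Continuous.integrableOn_Icc (by fun_prop)) hcost
  rw [hξt₁, inner_zero_right, mul_zero, zero_sub] at hle
  calc ⟪y t, x t⟫_ℝ ≤ ∫ s in t..t₁, Real.exp (2 * c.kappa * (s - t)) * (k * ‖x t‖ ^ 2) := by
        linarith [hxy.inner_nonneg h (ht₁.2.trans htσ)]
    _ ≤ (Real.exp (2 * c.kappa * c.σ) - 1) / (2 * c.kappa) * (k * ‖x t‖ ^ 2) :=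
        integral_exp_mul_sub_mul_le (by positivity) ht₁.2 (by positivity)
    _ = (Real.exp (2 * c.kappa * c.σ) - 1) / (2 * c.kappa) * k * ‖x t‖ ^ 2 :=
        (mul_assoc _ _ _).symm
    _ ≤ c.c₁ * ‖x t‖ ^ 2 := by gcongr; exact c.steering_cost_le_c₁

/- Compare with the zero control on the last piece of length at most `σ`. -/
theorem inner_le_c₁_mul_of_lt_add (h : P.Regular c) (hxy : P.IsClosedLoop x y) {t : ℝ}
    (ht : t ≤ P.T) (htσ : P.T < t + c.σ) : ⟪y t, x t⟫_ℝ ≤ c.c₁ * ‖x t‖ ^ 2 := by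
  have := c.kappa_pos; have := c.lamQ_pos
  set ξ : ℝ → Vec nx := fun s => evolution P.reducedA s t (x t) with hξ_def
  have hξ : ∀ s ∈ Icc t P.T, ‖ξ s‖ ^ 2 ≤ Real.exp (2 * c.kappa * (s - t)) * ‖x t‖ ^ 2 :=
    fun s hs => sq_le_exp_mul_sq (norm_nonneg _)
      (norm_evolution_apply_le h.continuous_reducedA h.norm_reducedA_le hs.1 _)
  have hterminal : 2 * ⟪y P.T, ξ P.T⟫_ℝ - ⟪y P.T, x P.T⟫_ℝ ≤
      c.lamQ * (Real.exp (2 * c.kappa * c.σ) * ‖x t‖ ^ 2) :=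
    calc _ ≤ c.lamQ * ‖ξ P.T‖ ^ 2 := hxy.two_mul_inner_terminal_sub_le h _
      _ ≤ c.lamQ * (Real.exp (2 * c.kappa * (P.T - t)) * ‖x t‖ ^ 2) := by
          gcongr
          exact hξ P.T ⟨ht, le_rfl⟩
      _ ≤ _ := by gcongr; linarith
  have hle := hxy.inner_le_add_integral h (ξ := ξ) (v := fun _ => 0)
    (fun s => by simpa only [map_zero, add_zero] using
      evolution_apply_hasDerivAt h.continuous_reducedA h.norm_reducedA_le t (x t) s)
    ht (by simp only [hξ_def, evolution_self, one_apply_eq_self])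
    (φ := fun s => Real.exp (2 * c.kappa * (s - t)) * (c.lamQ * ‖x t‖ ^ 2))
    (Continuous.integrableOn_Icc (by fun_prop)) fun s hs => by
      rw [norm_zero, zero_pow two_ne_zero, mul_zero, add_zero, mul_left_comm]
      exact mul_le_mul_of_nonneg_left (hξ s hs) c.lamQ_pos.le
  calc ⟪y t, x t⟫_ℝ ≤ c.lamQ * (Real.exp (2 * c.kappa * c.σ) * ‖x t‖ ^ 2) +
        (Real.exp (2 * c.kappa * c.σ) - 1) / (2 * c.kappa) * (c.lamQ * ‖x t‖ ^ 2) :=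
        hle.trans (add_le_add hterminal
          (integral_exp_mul_sub_mul_le (by positivity) htσ.le (by positivity)))
    _ = (c.lamQ * Real.exp (2 * c.kappa * c.σ) +
        (Real.exp (2 * c.kappa * c.σ) - 1) / (2 * c.kappa) * c.lamQ) * ‖x t‖ ^ 2 := by ring
    _ ≤ c.c₁ * ‖x t‖ ^ 2 := by gcongr; exact c.terminal_cost_le_c₁

theorem inner_le_c₁_mul (h : P.Regular c) (hxy : P.IsClosedLoop x y) {t : ℝ}
    (ht : t ∈ Icc 0 P.T) : ⟪y t, x t⟫_ℝ ≤ c.c₁ * ‖x t‖ ^ 2 :=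
  (le_or_gt (t + c.σ) P.T).elim (hxy.inner_le_c₁_mul_of_add_le h ht.1)
    (hxy.inner_le_c₁_mul_of_lt_add h ht.2)

theorem exp_mul_inner_le (h : P.Regular c) (hxy : P.IsClosedLoop x y) {s t : ℝ} (hs : 0 ≤ s)
    (hst : s ≤ t) (ht : t ≤ P.T) :
    Real.exp (2 * c.ρZ * (t - s)) * ⟪y t, x t⟫_ℝ ≤ ⟪y s, x s⟫_ℝ := by
  have := c.c₁_pos; have := c.γQ_pos
  set rate : ℝ → ℝ := fun r => ⟪x r, P.reducedQ r (x r)⟫_ℝ + ⟪y r, P.inputWeight r (y r)⟫_ℝ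
  have hderiv : ∀ r, HasDerivAt (fun r => Real.exp (2 * c.ρZ * (r - s)) * ⟪y r, x r⟫_ℝ)
      (Real.exp (2 * c.ρZ * (r - s)) * (2 * c.ρZ * ⟪y r, x r⟫_ℝ - rate r)) r := fun r => by
    have hexponent : HasDerivAt (fun r => 2 * c.ρZ * (r - s)) (2 * c.ρZ) r := by
      simpa using ((hasDerivAt_id r).sub_const s).const_mul (2 * c.ρZ)
    exact (hexponent.exp.mul (hxy.hasDerivAt_inner r)).congr_deriv (by ring)
  have hrate : ∀ r ∈ Icc s t, 2 * c.ρZ * ⟪y r, x r⟫_ℝ ≤ rate r := fun r hr =>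
    calc 2 * c.ρZ * ⟪y r, x r⟫_ℝ = c.γQ / c.c₁ * ⟪y r, x r⟫_ℝ := by
          rw [LQConstants.ρZ]; field_simp
      _ ≤ c.γQ / c.c₁ * (c.c₁ * ‖x r‖ ^ 2) := by
          gcongr
          exact hxy.inner_le_c₁_mul h ⟨hs.trans hr.1, hr.2.trans ht⟩
      _ = c.γQ * ‖x r‖ ^ 2 := by field_simp
      _ ≤ rate r := (h.le_inner_reducedQ r (x r)).trans
          (le_add_of_nonneg_right ((h.isPositive_inputWeight r).inner_nonneg_right _))
  have hle := sub_le_integral_of_hasDerivAt hst (fun r _ => hderiv r) (φ := fun _ => 0)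
    integrableOn_zero fun r hr => mul_nonpos_of_nonneg_of_nonpos (Real.exp_pos _).le
      (sub_nonpos.2 (hrate r (Ioo_subset_Icc_self hr)))
  simpa only [sub_self, mul_zero, Real.exp_zero, one_mul, intervalIntegral.integral_zero,
    sub_nonpos] using hle

theorem norm_le_decay (h : P.Regular c) (hxy : P.IsClosedLoop x y) {s t : ℝ} (hs : 0 ≤ s)
    (hst : s ≤ t) (ht : t ≤ P.T) : ‖x t‖ ≤ c.cZ * Real.exp (-c.ρZ * (t - s)) * ‖x s‖ := by
  have hc₀ := c.c₀_pos; have := c.c₁_pos; have := c.cZ_pos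
  have hexp : Real.exp (-c.ρZ * (t - s)) ^ 2 * Real.exp (2 * c.ρZ * (t - s)) = 1 := by
    rw [← Real.exp_nat_mul, ← Real.exp_add, Real.exp_eq_one_iff]
    push_cast
    ring
  set e : ℝ := Real.exp (-c.ρZ * (t - s))
  have hvalue : c.c₀ * ‖x t‖ ^ 2 ≤ e ^ 2 * (c.c₁ * ‖x s‖ ^ 2) :=
    calc c.c₀ * ‖x t‖ ^ 2 ≤ ⟪y t, x t⟫_ℝ := hxy.c₀_mul_le_inner h ht
      _ = e ^ 2 * (Real.exp (2 * c.ρZ * (t - s)) * ⟪y t, x t⟫_ℝ) := by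
          rw [← mul_assoc, hexp, one_mul]
      _ ≤ e ^ 2 * ⟪y s, x s⟫_ℝ := by gcongr; exact hxy.exp_mul_inner_le h hs hst ht
      _ ≤ e ^ 2 * (c.c₁ * ‖x s‖ ^ 2) := by
          gcongr
          exact hxy.inner_le_c₁_mul h ⟨hs, hst.trans ht⟩
  refine le_of_sq_le_sq ?_ (by positivity)
  calc ‖x t‖ ^ 2 ≤ e ^ 2 * (c.c₁ * ‖x s‖ ^ 2) / c.c₀ := (le_div_iff₀' hc₀).2 hvalue
    _ = c.c₁ / c.c₀ * (e ^ 2 * ‖x s‖ ^ 2) := by ring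
    _ = (c.cZ * e * ‖x s‖) ^ 2 := by
        rw [mul_pow, mul_pow, LQConstants.cZ, Real.sq_sqrt (by positivity), mul_assoc]

end IsClosedLoop

end LQProblem

section LinearIntegralEquation

variable {E F : Type*} [NormedAddCommGroup E] [NormedSpace ℝ E] [CompleteSpace E]
  [NormedAddCommGroup F] [NormedSpace ℝ F] {M : ℝ → E →L[ℝ] E} {K : ℝ}

theorem exists_eq_add_integral_add_integral (hM : Continuous M) (hK : ∀ t, ‖M t‖ ≤ K)
    {f : ℝ → E} (hf : Integrable f) (s : ℝ) (z₀ : E) :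
    ∃ z : ℝ → E, Continuous z ∧
      ∀ t, z t = z₀ + (∫ τ in s..t, f τ) + ∫ τ in s..t, M τ (z τ) :=
  exists_volterra_solution (D := ‖z₀‖ + ∫ τ, ‖f τ‖) hM hK
    (continuous_const.add
      (intervalIntegral.continuous_primitive (fun _ _ => hf.intervalIntegrable) s))
    (fun _ => (norm_add_le _ _).trans (add_le_add_right
      (intervalIntegral.norm_integral_le_integral_norm_uIoc.trans
        (setIntegral_le_integral hf.norm (.of_forall fun _ => norm_nonneg _))) _)) s

theorem exists_hasDerivAt_comp (hM : Continuous M) (hK : ∀ t, ‖M t‖ ≤ K) (s : ℝ)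
    (J : F →L[ℝ] E) :
    ∃ Φ : ℝ → F →L[ℝ] E, Φ s = J ∧ ∀ t, HasDerivAt Φ (M t ∘L Φ t) t := by
  set L : ℝ → (F →L[ℝ] E) →L[ℝ] (F →L[ℝ] E) :=
    fun t => ContinuousLinearMap.compL ℝ F E E (M t)
  have hL : Continuous L := (ContinuousLinearMap.compL ℝ F E E).continuous.comp hM
  have hLK : ∀ t, ‖L t‖ ≤ K := fun t =>
    ContinuousLinearMap.opNorm_le_bound _ ((norm_nonneg _).trans (hK t)) fun Ψ =>
      (ContinuousLinearMap.opNorm_comp_le (M t) Ψ).trans (by gcongr; exact hK t)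
  obtain ⟨Φ, hΦ, heq⟩ := exists_volterra_solution (M := L) hL hLK (continuous_const (y := J))
    (fun _ => le_rfl) s
  refine ⟨Φ, by rw [heq, intervalIntegral.integral_same, add_zero], fun t => ?_⟩
  have hderiv := ((hL.clm_apply hΦ).integral_hasStrictDerivAt s t).hasDerivAt.const_add J
  exact hderiv.congr_of_eventuallyEq (.of_forall heq)

end LinearIntegralEquation

namespace LQProblem

variable {nx nu nd : ℕ} {P : LQProblem nx nu nd} {c : LQConstants} {x y : ℝ → Vec nx}
  {X Y : ℝ → Mat nx nx}

/-- The matrix `[A - B R⁻¹ H, -B R⁻¹ Bᵀ; -(Q - Hᵀ R⁻¹ H), -(A - B R⁻¹ H)ᵀ]` of the Hamiltonian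
system, acting on pairs of a state and a costate. -/
def hamiltonian (P : LQProblem nx nu nd) (t : ℝ) : (Vec nx × Vec nx) →L[ℝ] (Vec nx × Vec nx) :=
  ((P.reducedA t).coprod (-P.inputWeight t)).prod ((-P.reducedQ t).coprod (-(P.reducedA t)†))

theorem hamiltonian_apply (t : ℝ) (z : Vec nx × Vec nx) :
    P.hamiltonian t z = (P.reducedA t z.1 - P.inputWeight t z.2,
      -(P.reducedQ t z.1) - ((P.reducedA t)†) z.2) := by
  simp only [hamiltonian, ContinuousLinearMap.prod_apply, ContinuousLinearMap.coprod_apply,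
    neg_apply, sub_eq_add_neg]

theorem isHamiltonian_iff_hasDerivAt_prod : P.IsHamiltonian x y ↔
    ∀ t, HasDerivAt (fun t => (x t, y t)) (P.hamiltonian t (x t, y t)) t := by
  simp only [hamiltonian_apply]
  exact ⟨fun h t => (h.state t).prodMk (h.costate t), fun h =>
    ⟨fun t => (h t).fst, fun t => (h t).snd⟩⟩

namespace Regular

theorem continuous_hamiltonian (h : P.Regular c) : Continuous P.hamiltonian := by
  refine continuous_clm_apply.2 fun z => ?_
  simp only [hamiltonian_apply]
  exact ((h.continuous_reducedA.clm_apply continuous_const).sub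
    (h.continuous_inputWeight.clm_apply continuous_const)).prodMk
    ((h.continuous_reducedQ.clm_apply continuous_const).neg.sub
      ((continuous_adjoint h.continuous_reducedA).clm_apply continuous_const))

theorem exists_norm_hamiltonian_le (h : P.Regular c) : ∃ K, ∀ t, ‖P.hamiltonian t‖ ≤ K := by
  have := c.kappa_pos; have := c.γR_pos; have := c.lamQ_pos
  refine ⟨max (c.kappa + c.lamB ^ 2 / c.γR) (c.lamQ + c.lamH ^ 2 / c.γR + c.kappa),
    fun t => ContinuousLinearMap.opNorm_le_bound _ (by positivity) fun z => ?_⟩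
  have hz₁ : ‖z.1‖ ≤ ‖z‖ := norm_fst_le z
  have hz₂ : ‖z.2‖ ≤ ‖z‖ := norm_snd_le z
  rw [hamiltonian_apply, max_mul_of_nonneg _ _ (norm_nonneg z), add_mul, add_mul _ c.kappa]
  refine max_le_max ((norm_sub_le _ _).trans (add_le_add ?_ ?_))
    ((norm_sub_le _ _).trans (add_le_add ?_ ?_))
  · exact (P.reducedA t).le_of_opNorm_le_of_le (h.norm_reducedA_le t) hz₁
  · exact (P.inputWeight t).le_of_opNorm_le_of_le (h.norm_inputWeight_le t) hz₂
  · rw [norm_neg]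
    exact (P.reducedQ t).le_of_opNorm_le_of_le (h.norm_reducedQ_le t) hz₁
  · exact ContinuousLinearMap.le_of_opNorm_le_of_le _ (norm_adjoint_le (h.norm_reducedA_le t)) hz₂

end Regular

/-- `X` and `Y` are the state and costate parts of the solution of the Hamiltonian system with
terminal value `(I, Q_T)`; the Riccati matrix is `Y X⁻¹`. -/
structure IsFundamental (P : LQProblem nx nu nd) (X Y : ℝ → Mat nx nx) : Prop where
  state : ∀ t, HasDerivAt X (P.reducedA t ∘L X t - P.inputWeight t ∘L Y t) t
  costate : ∀ t, HasDerivAt Y (-(P.reducedQ t ∘L X t) - (P.reducedA t)† ∘L Y t) t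
  X_terminal : X P.T = 1
  Y_terminal : Y P.T = P.QT

theorem Regular.exists_isFundamental (h : P.Regular c) : ∃ X Y, P.IsFundamental X Y := by
  obtain ⟨K, hK⟩ := h.exists_norm_hamiltonian_le
  obtain ⟨Φ, hΦT, hΦ⟩ := exists_hasDerivAt_comp h.continuous_hamiltonian hK P.T
    ((1 : Mat nx nx).prod P.QT)
  have hproj : ∀ (π : Vec nx × Vec nx →L[ℝ] Vec nx) (t : ℝ),
      HasDerivAt (fun t => π ∘L Φ t) (π ∘L P.hamiltonian t ∘L Φ t) t := fun π t => by
    simpa only [ContinuousLinearMap.zero_comp, zero_add] using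
      (hasDerivAt_const t π).clm_comp (hΦ t)
  refine ⟨fun t => .fst ℝ _ _ ∘L Φ t, fun t => .snd ℝ _ _ ∘L Φ t,
    fun t => (hproj _ t).congr_deriv ?_, fun t => (hproj _ t).congr_deriv ?_, ?_, ?_⟩
  · ext1 b; simp [hamiltonian_apply]
  · ext1 b; simp [hamiltonian_apply]
  · rw [hΦT, ContinuousLinearMap.fst_comp_prod]
  · rw [hΦT, ContinuousLinearMap.snd_comp_prod]

namespace IsFundamental

theorem isClosedLoop (hXY : P.IsFundamental X Y) (b : Vec nx) :
    P.IsClosedLoop (fun t => X t b) (fun t => Y t b) where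
  state t := by simpa using (hXY.state t).clm_apply (hasDerivAt_const t b)
  costate t := by simpa using (hXY.costate t).clm_apply (hasDerivAt_const t b)
  terminal := by rw [hXY.X_terminal, hXY.Y_terminal, one_apply_eq_self]

/- A closed-loop state decays forwards in time, so it cannot vanish before its terminal value
does. -/
theorem injective_X (h : P.Regular c) (hXY : P.IsFundamental X Y) {t : ℝ} (ht : t ∈ Icc 0 P.T) :
    Function.Injective (X t) := by
  refine (injective_iff_map_eq_zero _).2 fun b hb => norm_le_zero_iff.1 ?_
  have hdecay := (hXY.isClosedLoop b).norm_le_decay h ht.1 ht.2 le_rfl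
  simpa only [hXY.X_terminal, one_apply_eq_self, hb, norm_zero, mul_zero] using hdecay

theorem isUnit_X (h : P.Regular c) (hXY : P.IsFundamental X Y) {t : ℝ} (ht : t ∈ Icc 0 P.T) :
    IsUnit (X t) :=
  ContinuousLinearMap.isUnit_iff_bijective.2
    ⟨hXY.injective_X h ht, LinearMap.injective_iff_surjective.1 (hXY.injective_X h ht)⟩

end IsFundamental

theorem Regular.exists_trajectory (h : P.Regular c) {f : ℝ → Vec nx × Vec nx} (hf : Integrable f)
    (x₀ g : Vec nx) : ∃ z : ℝ → Vec nx × Vec nx, Continuous z ∧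
      (∀ t, z t = z P.T + (∫ s in P.T..t, f s) + ∫ s in P.T..t, P.hamiltonian s (z s)) ∧
      (z 0).1 = x₀ ∧ (z P.T).2 = P.QT (z P.T).1 + g := by
  obtain ⟨K, hK⟩ := h.exists_norm_hamiltonian_le
  obtain ⟨X, Y, hXY⟩ := h.exists_isFundamental
  obtain ⟨z, hz, hz_eq⟩ :=
    exists_eq_add_integral_add_integral h.continuous_hamiltonian hK hf P.T (0, g)
  have hzT : z P.T = (0, g) := by simp [hz_eq P.T]
  obtain ⟨b, hb⟩ : ∃ b, X 0 b = x₀ - (z 0).1 :=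
    (ContinuousLinearMap.isUnit_iff_bijective.1 (hXY.isUnit_X h ⟨le_rfl, h.T_pos.le⟩)).2 _
  set w : ℝ → Vec nx × Vec nx := fun t => (X t b, Y t b)
  have hw' := isHamiltonian_iff_hasDerivAt_prod.1 (hXY.isClosedLoop b).toIsHamiltonian
  have hw : Continuous w := continuous_iff_continuousAt.2 fun t => (hw' t).continuousAt
  have hw_eq : ∀ t, w t = w P.T + ∫ s in P.T..t, P.hamiltonian s (w s) := fun t => by
    rw [intervalIntegral.integral_eq_sub_of_hasDerivAt (fun s _ => hw' s)
      ((h.continuous_hamiltonian.clm_apply hw).intervalIntegrable _ _), add_sub_cancel]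
  have hwT : w P.T = (b, P.QT b) := by
    simp only [w, hXY.X_terminal, hXY.Y_terminal, one_apply_eq_self]
  refine ⟨fun t => z t + w t, hz.add hw, fun t => ?_, by simp [w, hb], by simp [hzT, hwT, add_comm]⟩
  simp only [map_add]
  rw [intervalIntegral.integral_add
      ((h.continuous_hamiltonian.clm_apply hz).intervalIntegrable _ _)
      ((h.continuous_hamiltonian.clm_apply hw).intervalIntegrable _ _),
    hz_eq t, hw_eq t, hzT]
  abel

end LQProblem

section IntegralEquation

variable {E : Type*} [NormedAddCommGroup E] [NormedSpace ℝ E] [CompleteSpace E]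

theorem eqOn_zero_of_eq_integral {M : ℝ → E →L[ℝ] E} {w : ℝ → E} {a b : ℝ}
    (hM : ContinuousOn M (Icc a b)) (hw : ContinuousOn w (Icc a b))
    (h : ∀ t ∈ Icc a b, w t = ∫ s in t..b, M s (w s)) : EqOn w 0 (Icc a b) := by
  obtain ⟨K, hK⟩ := isCompact_Icc.exists_bound_of_continuousOn hM
  have hMw : ContinuousOn (fun s => M s (w s)) (Icc a b) := hM.clm_apply hw
  have hderiv : ∀ t ∈ Ioc a b, HasDerivWithinAt w (-(M t (w t))) (Iic t) t := fun t ht => by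
    have htb : uIcc t b ⊆ Icc a b := by
      rw [uIcc_of_le ht.2]; exact Icc_subset_Icc_left ht.1.le
    have hnhds : Icc a b ∈ nhdsWithin t (Iic t) :=
      Filter.mem_of_superset (Ioc_mem_nhdsLE ht.1)
        (Ioc_subset_Icc_self.trans (Icc_subset_Icc_right ht.2))
    have hcont : ContinuousWithinAt (fun s => M s (w s)) (Iic t) t :=
      (hMw t (Ioc_subset_Icc_self ht)).mono_of_mem_nhdsWithin hnhds
    refine (intervalIntegral.integral_hasDerivWithinAt_left
      (hMw.mono htb).intervalIntegrable ⟨_, hnhds, hMw.aestronglyMeasurable measurableSet_Icc⟩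
      hcont).congr_of_eventuallyEq ?_ (h t (Ioc_subset_Icc_self ht))
    filter_upwards [hnhds] with s hs using h s hs
  have hlip : ∀ t ∈ Ioc a b, LipschitzOnWith K.toNNReal (fun z => -(M t z)) univ := fun t ht =>
    ((M t).lipschitz.weaken
      (NNReal.le_toNNReal_of_coe_le (hK t (Ioc_subset_Icc_self ht)))).neg.lipschitzOnWith
  have hzero : ∀ t ∈ Ioc a b,
      HasDerivWithinAt (fun _ => (0 : E)) (-(M t 0)) (Iic t) t := fun t _ => by
    simpa only [map_zero, neg_zero] using hasDerivWithinAt_const t (Iic t) (0 : E)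
  rcases le_or_gt a b with hab | hab
  · refine ODE_solution_unique_of_mem_Icc_left hlip hw hderiv (fun _ _ => mem_univ _)
      continuousOn_const hzero (fun _ _ => mem_univ _) ?_
    rw [h b (right_mem_Icc.2 hab), intervalIntegral.integral_same, Pi.zero_apply]
  · rw [Icc_eq_empty hab.not_ge]
    exact eqOn_empty _ _

end IntegralEquation

section QuadraticForm

variable {E : Type*} [NormedAddCommGroup E] [InnerProductSpace ℝ E]

theorem inner_add_apply_add_self {S : E →L[ℝ] E} (hS : S.IsSymmetric) (x δ : E) :
    ⟪x + δ, S (x + δ)⟫_ℝ = ⟪x, S x⟫_ℝ + 2 * ⟪S x, δ⟫_ℝ + ⟪δ, S δ⟫_ℝ := by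
  have hxδ : ⟪x, S δ⟫_ℝ = ⟪S x, δ⟫_ℝ := (hS x δ).symm
  rw [map_add, inner_add_left, inner_add_right, inner_add_right, hxδ, real_inner_comm (S x) δ]
  ring

end QuadraticForm

namespace LQProblem

variable {nx nu nd : ℕ} {P : LQProblem nx nu nd} {c : LQConstants}

namespace IsBoundedInput

variable {k m : ℕ} {f g : ℝ → Vec m}

theorem of_continuousOn (hf : ContinuousOn f (Icc 0 P.T)) : P.IsBoundedInput f :=
  ⟨hf.aestronglyMeasurable measurableSet_Icc, isCompact_Icc.exists_bound_of_continuousOn hf⟩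

theorem of_continuous (hf : Continuous f) : P.IsBoundedInput f :=
  of_continuousOn hf.continuousOn

theorem add (hf : P.IsBoundedInput f) (hg : P.IsBoundedInput g) :
    P.IsBoundedInput fun t => f t + g t := by
  obtain ⟨M, hM⟩ := hf.2
  obtain ⟨N, hN⟩ := hg.2
  exact ⟨hf.1.add hg.1, M + N, fun t ht => norm_add_le_of_le (hM t ht) (hN t ht)⟩

theorem neg (hf : P.IsBoundedInput f) : P.IsBoundedInput fun t => -f t := by
  obtain ⟨M, hM⟩ := hf.2
  exact ⟨hf.1.neg, M, fun t ht => (norm_neg (f t)).trans_le (hM t ht)⟩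

theorem sub (hf : P.IsBoundedInput f) (hg : P.IsBoundedInput g) :
    P.IsBoundedInput fun t => f t - g t := by
  simpa only [sub_eq_add_neg] using hf.add hg.neg

theorem clm_apply {L : ℝ → Mat k m} (hL : Continuous L) (hf : P.IsBoundedInput f) :
    P.IsBoundedInput fun t => L t (f t) := by
  obtain ⟨M, hM⟩ := hf.2
  obtain ⟨N, hN⟩ := isCompact_Icc.exists_bound_of_continuousOn (hL.continuousOn (s := Icc 0 P.T))
  exact ⟨isBoundedBilinearMap_apply.continuous.comp_aestronglyMeasurable
      (hL.aestronglyMeasurable.prodMk hf.1),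
    N * M, fun t ht => (L t).le_of_opNorm_le_of_le (hN t ht) (hM t ht)⟩

theorem integrableOn (hf : P.IsBoundedInput f) : IntegrableOn f (Icc 0 P.T) := by
  obtain ⟨M, hM⟩ := hf.2
  exact .of_bound measure_Icc_lt_top hf.1 M
    ((ae_restrict_iff' measurableSet_Icc).2 (.of_forall hM))

theorem intervalIntegrable (hf : P.IsBoundedInput f) {a b : ℝ} (ha : a ∈ Icc 0 P.T)
    (hb : b ∈ Icc 0 P.T) : IntervalIntegrable f volume a b :=
  (hf.integrableOn.mono_set (uIcc_subset_Icc ha hb)).intervalIntegrable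

theorem intervalIntegrable_inner (hf : P.IsBoundedInput f) (hg : P.IsBoundedInput g) {a b : ℝ}
    (ha : a ∈ Icc 0 P.T) (hb : b ∈ Icc 0 P.T) :
    IntervalIntegrable (fun t => ⟪f t, g t⟫_ℝ) volume a b := by
  obtain ⟨M, hM⟩ := hf.2
  obtain ⟨N, hN⟩ := hg.2
  have hint : IntegrableOn (fun t => ⟪f t, g t⟫_ℝ) (Icc 0 P.T) :=
    .of_bound measure_Icc_lt_top (hf.1.inner hg.1) (M * N)
      ((ae_restrict_iff' measurableSet_Icc).2 (.of_forall fun t ht =>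
        (norm_inner_le_norm _ _).trans (mul_le_mul (hM t ht) (hN t ht) (norm_nonneg _)
          ((norm_nonneg _).trans (hM t ht)))))
  exact (hint.mono_set (uIcc_subset_Icc ha hb)).intervalIntegrable

end IsBoundedInput

/-- The first block row `Q x + Hᵀ u + Gᵀ d` of the quadratic form in the running cost, which is the
gradient of the running cost in the state. -/
def stateGradient (P : LQProblem nx nu nd) (t : ℝ) (x : Vec nx) (u : Vec nu) (d : Vec nd) :
    Vec nx :=
  P.Q t x + ((P.H t)†) u + ((P.G t)†) d

/-- The second block row `H x + R u + Wᵀ d` of the quadratic form in the running cost, which is the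
gradient of the running cost in the control. -/
def controlGradient (P : LQProblem nx nu nd) (t : ℝ) (x : Vec nx) (u : Vec nu) (d : Vec nd) :
    Vec nu :=
  P.H t x + P.R t u + ((P.W t)†) d

/-- The quadratic form in the running cost, that is, twice the running cost. With `d = 0` it is the
second variation of the cost. -/
def runningForm (P : LQProblem nx nu nd) (t : ℝ) (x : Vec nx) (u : Vec nu) (d : Vec nd) : ℝ :=
  ⟪x, P.stateGradient t x u d⟫_ℝ + ⟪u, P.controlGradient t x u d⟫_ℝ + ⟪d, P.G t x + P.W t u⟫_ℝ

/-- The quadratic form in the terminal cost, that is, twice the terminal cost. -/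
def terminalForm (P : LQProblem nx nu nd) (x : Vec nx) (d : Vec nd) : ℝ :=
  ⟪x, P.QT x + (P.GT†) d⟫_ℝ + ⟪d, P.GT x⟫_ℝ

theorem cost_eq (d : ℝ → Vec nd) (dT : Vec nd) (x : ℝ → Vec nx) (u : ℝ → Vec nu) :
    P.cost d dT x u = 1 / 2 * (∫ t in (0 : ℝ)..P.T, P.runningForm t (x t) (u t) (d t)) +
      1 / 2 * P.terminalForm (x P.T) dT :=
  rfl

namespace Regular

theorem zero_mem (h : P.Regular c) : (0 : ℝ) ∈ Icc 0 P.T := ⟨le_rfl, h.T_pos.le⟩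

theorem T_mem (h : P.Regular c) : P.T ∈ Icc 0 P.T := ⟨h.T_pos.le, le_rfl⟩

theorem isPositive_Q (h : P.Regular c) (t : ℝ) : (P.Q t).IsPositive := by
  have hQ : P.Q t = P.reducedQ t + (P.H t)† ∘L P.Rinv t ∘L P.H t := (sub_add_cancel _ _).symm
  rw [hQ]
  exact (h.isPositive_reducedQ t).add ((h.isPositive_Rinv t).adjoint_conj (P.H t))

theorem runningForm_zero (h : P.Regular c) (t : ℝ) (x : Vec nx) (u : Vec nu) :
    P.runningForm t x u 0 = ⟪x, P.reducedQ t x⟫_ℝ +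
      ⟪u + P.Rinv t (P.H t x), P.R t (u + P.Rinv t (P.H t x))⟫_ℝ := by
  have hcross : ⟪P.Rinv t (P.H t x), P.R t u⟫_ℝ = ⟪u, P.H t x⟫_ℝ := by
    rw [← (h.isPositive_R t).inner_left_eq_inner_right, h.R_Rinv, real_inner_comm]
  have hRinv : ⟪P.Rinv t (P.H t x), P.H t x⟫_ℝ = ⟪P.H t x, P.Rinv t (P.H t x)⟫_ℝ :=
    real_inner_comm _ _
  simp only [runningForm, stateGradient, controlGradient, reducedQ, map_add, map_zero, h.R_Rinv,
    sub_apply, ContinuousLinearMap.comp_apply, inner_add_left, inner_add_right, inner_sub_right,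
    ContinuousLinearMap.adjoint_inner_right, inner_zero_left, add_zero, hcross, hRinv,
    real_inner_comm u (P.H t x)]
  ring

theorem le_runningForm_zero (h : P.Regular c) (t : ℝ) (x : Vec nx) (u : Vec nu) :
    c.γQ * ‖x‖ ^ 2 + c.γR * ‖u + P.Rinv t (P.H t x)‖ ^ 2 ≤ P.runningForm t x u 0 := by
  rw [h.runningForm_zero]
  exact add_le_add (h.le_inner_reducedQ t x) (h.le_inner_R t _)

theorem runningForm_zero_nonneg (h : P.Regular c) (t : ℝ) (x : Vec nx) (u : Vec nu) :
    0 ≤ P.runningForm t x u 0 := by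
  have := c.γQ_pos; have := c.γR_pos
  exact le_trans (by positivity) (h.le_runningForm_zero t x u)

theorem eq_zero_of_runningForm_zero_eq_zero (h : P.Regular c) {t : ℝ} {x : Vec nx} {u : Vec nu}
    (hxu : P.runningForm t x u 0 = 0) : x = 0 ∧ u = 0 := by
  have hγQ := c.γQ_pos
  have hγR := c.γR_pos
  have hle := h.le_runningForm_zero t x u
  have hxsq : 0 ≤ c.γQ * ‖x‖ ^ 2 := by positivity
  have husq : 0 ≤ c.γR * ‖u + P.Rinv t (P.H t x)‖ ^ 2 := by positivity
  have hx : x = 0 := by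
    simpa [hγQ.ne'] using (by linarith : c.γQ * ‖x‖ ^ 2 = 0)
  have hu : u + P.Rinv t (P.H t x) = 0 := by
    simpa [hγR.ne'] using (by linarith : c.γR * ‖u + P.Rinv t (P.H t x)‖ ^ 2 = 0)
  exact ⟨hx, by simpa [hx] using hu⟩

theorem runningForm_add (h : P.Regular c) (t : ℝ) (x δ : Vec nx) (u ω : Vec nu) (d : Vec nd) :
    P.runningForm t (x + δ) (u + ω) d = P.runningForm t x u d +
      2 * (⟪P.stateGradient t x u d, δ⟫_ℝ + ⟪P.controlGradient t x u d, ω⟫_ℝ) +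
        P.runningForm t δ ω 0 := by
  have hQ := inner_add_apply_add_self (h.isPositive_Q t).isSymmetric x δ
  have hR := inner_add_apply_add_self (h.isPositive_R t).isSymmetric u ω
  simp only [runningForm, stateGradient, controlGradient, map_zero, map_add, inner_zero_left,
    inner_zero_right, inner_add_left, inner_add_right, ContinuousLinearMap.adjoint_inner_right,
    ContinuousLinearMap.adjoint_inner_left, real_inner_comm ω (P.H t _),
    real_inner_comm u (P.H t _), real_inner_comm d (P.G t _), real_inner_comm d (P.W t _)]
    at hQ hR ⊢
  linarith

theorem terminalForm_add (h : P.Regular c) (x δ : Vec nx) (d : Vec nd) :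
    P.terminalForm (x + δ) d = P.terminalForm x d + 2 * ⟪P.QT x + (P.GT†) d, δ⟫_ℝ +
      ⟪δ, P.QT δ⟫_ℝ := by
  have hQT := inner_add_apply_add_self h.isPositive_QT.isSymmetric x δ
  simp only [terminalForm, map_add, inner_add_left, inner_add_right,
    ContinuousLinearMap.adjoint_inner_right, ContinuousLinearMap.adjoint_inner_left,
    real_inner_comm d (P.GT _)] at hQT ⊢
  linarith

variable {x : ℝ → Vec nx} {u : ℝ → Vec nu} {d : ℝ → Vec nd}

theorem isBoundedInput_stateGradient (h : P.Regular c) (hx : P.IsBoundedInput x)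
    (hu : P.IsBoundedInput u) (hd : P.IsBoundedInput d) :
    P.IsBoundedInput fun t => P.stateGradient t (x t) (u t) (d t) :=
  ((hx.clm_apply h.contQ).add (hu.clm_apply (continuous_adjoint h.contH))).add
    (hd.clm_apply (continuous_adjoint h.contG))

theorem isBoundedInput_controlGradient (h : P.Regular c) (hx : P.IsBoundedInput x)
    (hu : P.IsBoundedInput u) (hd : P.IsBoundedInput d) :
    P.IsBoundedInput fun t => P.controlGradient t (x t) (u t) (d t) :=
  ((hx.clm_apply h.contH).add (hu.clm_apply h.contR)).add
    (hd.clm_apply (continuous_adjoint h.contW))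

theorem isBoundedInput_dynamics (h : P.Regular c) (hx : P.IsBoundedInput x)
    (hu : P.IsBoundedInput u) (hd : P.IsBoundedInput d) :
    P.IsBoundedInput fun t => P.A t (x t) + P.B t (u t) + P.C t (d t) :=
  ((hx.clm_apply h.contA).add (hu.clm_apply h.contB)).add (hd.clm_apply h.contC)

theorem intervalIntegrable_runningForm (h : P.Regular c) (hx : P.IsBoundedInput x)
    (hu : P.IsBoundedInput u) (hd : P.IsBoundedInput d) :
    IntervalIntegrable (fun t => P.runningForm t (x t) (u t) (d t)) volume 0 P.T :=
  ((hx.intervalIntegrable_inner (h.isBoundedInput_stateGradient hx hu hd) h.zero_mem h.T_mem).add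
    (hu.intervalIntegrable_inner (h.isBoundedInput_controlGradient hx hu hd)
      h.zero_mem h.T_mem)).add
    (hd.intervalIntegrable_inner ((hx.clm_apply h.contG).add (hu.clm_apply h.contW))
      h.zero_mem h.T_mem)

end Regular

end LQProblem

section IntervalIntegral

variable {E F : Type*} [NormedAddCommGroup E] [NormedSpace ℝ E] [CompleteSpace E]
  [NormedAddCommGroup F] [NormedSpace ℝ F] [CompleteSpace F]

theorem intervalIntegral_prodMk {f : ℝ → E} {g : ℝ → F} {a b : ℝ}
    (hf : IntervalIntegrable f volume a b) (hg : IntervalIntegrable g volume a b) :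
    ∫ t in a..b, (f t, g t) = (∫ t in a..b, f t, ∫ t in a..b, g t) := by
  simp only [intervalIntegral, integral_pair hf.1 hg.1, integral_pair hf.2 hg.2, Prod.mk_sub_mk]

end IntervalIntegral

namespace LQProblem

variable {nx nu nd : ℕ} {P : LQProblem nx nu nd} {c : LQConstants}

/-- The control `-R⁻¹ (H x + Bᵀ p + Wᵀ d)` given by the stationarity condition of the maximum
principle. -/
def extremalControl (P : LQProblem nx nu nd) (d : ℝ → Vec nd) (x p : ℝ → Vec nx) (t : ℝ) :
    Vec nu :=
  -(P.Rinv t (P.H t (x t) + ((P.B t)†) (p t) + ((P.W t)†) (d t)))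

/-- The inhomogeneous term in the Hamiltonian system for the state and the costate that is driven by
`d`. It is cut off outside the horizon, so that it is integrable on the whole line. -/
def forcing (P : LQProblem nx nu nd) (d : ℝ → Vec nd) : ℝ → Vec nx × Vec nx :=
  (Icc 0 P.T).indicator fun t =>
    (P.C t (d t) - P.B t (P.Rinv t (((P.W t)†) (d t))),
      ((P.H t)†) (P.Rinv t (((P.W t)†) (d t))) - ((P.G t)†) (d t))

/-- `(x, p)` solves the two-point boundary value problem of the maximum principle with parameters
`(d, d₀, d_T)`. The Hamiltonian system is stated on the whole line, in integrated form. -/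
structure IsExtremal (P : LQProblem nx nu nd) (d : ℝ → Vec nd) (d0 : Vec nx) (dT : Vec nd)
    (x p : ℝ → Vec nx) : Prop where
  continuous_state : Continuous x
  continuous_costate : Continuous p
  trajectory : ∀ t, (x t, p t) = (x P.T, p P.T) + (∫ s in P.T..t, P.forcing d s) +
    ∫ s in P.T..t, P.hamiltonian s (x s, p s)
  initial : x 0 = d0
  terminal : p P.T = P.QT (x P.T) + (P.GT†) dT

namespace Regular

variable {d : ℝ → Vec nd} {x p : ℝ → Vec nx}

theorem integrable_forcing (h : P.Regular c) (hd : P.IsBoundedInput d) :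
    Integrable (P.forcing d) := by
  have hRW : P.IsBoundedInput fun t => P.Rinv t (((P.W t)†) (d t)) :=
    (hd.clm_apply (continuous_adjoint h.contW)).clm_apply h.continuous_Rinv
  have hstate := ((hd.clm_apply h.contC).sub (hRW.clm_apply h.contB)).integrableOn
  have hcostate := ((hRW.clm_apply (continuous_adjoint h.contH)).sub
    (hd.clm_apply (continuous_adjoint h.contG))).integrableOn
  exact (integrable_indicator_iff measurableSet_Icc).2 (hstate.prodMk hcostate)

theorem exists_isExtremal (h : P.Regular c) (hd : P.IsBoundedInput d) (d0 : Vec nx) (dT : Vec nd) :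
    ∃ x p, P.IsExtremal d d0 dT x p := by
  obtain ⟨z, hz, htraj, hinit, hterm⟩ :=
    h.exists_trajectory (h.integrable_forcing hd) d0 ((P.GT†) dT)
  exact ⟨fun t => (z t).1, fun t => (z t).2, hz.fst, hz.snd, htraj, hinit, hterm⟩

theorem adjoint_reducedA_apply (h : P.Regular c) (t : ℝ) (p : Vec nx) :
    ((P.reducedA t)†) p = ((P.A t)†) p - ((P.H t)†) (P.Rinv t (((P.B t)†) p)) := by
  refine ext_inner_right ℝ fun b => ?_
  simp only [reducedA, ContinuousLinearMap.adjoint_inner_left, inner_sub_left, inner_sub_right,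
    sub_apply, ContinuousLinearMap.comp_apply, (h.isPositive_Rinv t).inner_left_eq_inner_right]

theorem controlGradient_extremalControl (h : P.Regular c) (d : ℝ → Vec nd) (x p : ℝ → Vec nx)
    (t : ℝ) :
    P.controlGradient t (x t) (P.extremalControl d x p t) (d t) = -((P.B t)†) (p t) := by
  rw [controlGradient, extremalControl, map_neg, h.R_Rinv]
  abel

theorem forcing_add_hamiltonian (h : P.Regular c) {t : ℝ} (ht : t ∈ Icc 0 P.T) :
    P.forcing d t + P.hamiltonian t (x t, p t) =
      (P.A t (x t) + P.B t (P.extremalControl d x p t) + P.C t (d t),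
        -(P.stateGradient t (x t) (P.extremalControl d x p t) (d t) + ((P.A t)†) (p t))) := by
  rw [forcing, indicator_of_mem ht, hamiltonian_apply, Prod.mk_add_mk]
  simp only [h.adjoint_reducedA_apply]
  simp only [extremalControl, stateGradient, reducedA, reducedQ, inputWeight, map_add, map_neg,
    sub_apply, ContinuousLinearMap.comp_apply]
  congr 1 <;> abel

theorem isBoundedInput_extremalControl (h : P.Regular c) (hd : P.IsBoundedInput d)
    (hx : Continuous x) (hp : Continuous p) : P.IsBoundedInput (P.extremalControl d x p) :=
  (((IsBoundedInput.of_continuous ((h.contH.clm_apply hx).add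
    ((continuous_adjoint h.contB).clm_apply hp))).add
      (hd.clm_apply (continuous_adjoint h.contW))).clm_apply h.continuous_Rinv).neg

theorem continuousOn_extremalControl (h : P.Regular c) (hd : ContinuousOn d (Icc 0 P.T))
    (hx : Continuous x) (hp : Continuous p) :
    ContinuousOn (P.extremalControl d x p) (Icc 0 P.T) :=
  (h.continuous_Rinv.continuousOn.clm_apply (((h.contH.clm_apply hx).add
    ((continuous_adjoint h.contB).clm_apply hp)).continuousOn.add
      ((continuous_adjoint h.contW).continuousOn.clm_apply hd))).neg

end Regular

theorem IsAdmissible.sub_eq_integral (h : P.Regular c) {d : ℝ → Vec nd} (hd : P.IsBoundedInput d)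
    {d0 : Vec nx} {x y : ℝ → Vec nx} {u w : ℝ → Vec nu} (hyw : P.IsAdmissible d d0 y w)
    (hxu : P.IsAdmissible d d0 x u) {t : ℝ} (ht : t ∈ Icc 0 P.T) :
    y t - x t = ∫ s in (0 : ℝ)..t, (P.A s (y s - x s) + P.B s (w s - u s)) := by
  rw [hyw.dynamics t ht, hxu.dynamics t ht, add_sub_add_left_eq_sub,
    ← intervalIntegral.integral_sub
      ((h.isBoundedInput_dynamics (.of_continuousOn hyw.continuousOn) hyw.control
        hd).intervalIntegrable h.zero_mem ht)
      ((h.isBoundedInput_dynamics (.of_continuousOn hxu.continuousOn) hxu.control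
        hd).intervalIntegrable h.zero_mem ht)]
  refine intervalIntegral.integral_congr fun s _ => ?_
  simp only [map_sub]
  abel

namespace IsExtremal

variable {d : ℝ → Vec nd} {d0 : Vec nx} {dT : Vec nd} {x p : ℝ → Vec nx}

theorem isBoundedInput_control (h : P.Regular c) (hd : P.IsBoundedInput d)
    (hE : P.IsExtremal d d0 dT x p) : P.IsBoundedInput (P.extremalControl d x p) :=
  h.isBoundedInput_extremalControl hd hE.continuous_state hE.continuous_costate

theorem isBoundedInput_adjoint_rate (h : P.Regular c) (hd : P.IsBoundedInput d)
    (hE : P.IsExtremal d d0 dT x p) :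
    P.IsBoundedInput fun t =>
      P.stateGradient t (x t) (P.extremalControl d x p t) (d t) + ((P.A t)†) (p t) :=
  (h.isBoundedInput_stateGradient (.of_continuous hE.continuous_state)
    (hE.isBoundedInput_control h hd) hd).add
    ((IsBoundedInput.of_continuous hE.continuous_costate).clm_apply (continuous_adjoint h.contA))

theorem eq_add_integral (h : P.Regular c) (hd : P.IsBoundedInput d)
    (hE : P.IsExtremal d d0 dT x p) {s t : ℝ} (hs : s ∈ Icc 0 P.T) (ht : t ∈ Icc 0 P.T) :
    x t = x s + (∫ r in s..t,
        (P.A r (x r) + P.B r (P.extremalControl d x p r) + P.C r (d r))) ∧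
      p t = p s + ∫ r in s..t,
        -(P.stateGradient r (x r) (P.extremalControl d x p r) (d r) + ((P.A r)†) (p r)) := by
  have hf : ∀ a b, IntervalIntegrable (P.forcing d) volume a b := fun _ _ =>
    (h.integrable_forcing hd).intervalIntegrable
  have hH : ∀ a b, IntervalIntegrable (fun r => P.hamiltonian r (x r, p r)) volume a b :=
    (h.continuous_hamiltonian.clm_apply
      (hE.continuous_state.prodMk hE.continuous_costate)).intervalIntegrable
  have hx := (h.isBoundedInput_dynamics (.of_continuous hE.continuous_state)
    (hE.isBoundedInput_control h hd) hd).intervalIntegrable hs ht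
  have hp := (hE.isBoundedInput_adjoint_rate h hd).neg.intervalIntegrable hs ht
  rw [← Prod.mk.injEq, ← Prod.mk_add_mk, ← intervalIntegral_prodMk hx hp,
    ← intervalIntegral.integral_congr fun r hr =>
      h.forcing_add_hamiltonian (uIcc_subset_Icc hs ht hr),
    intervalIntegral.integral_add (hf s t) (hH s t),
    ← intervalIntegral.integral_interval_sub_left (hf P.T t) (hf P.T s),
    ← intervalIntegral.integral_interval_sub_left (hH P.T t) (hH P.T s), hE.trajectory t,
    hE.trajectory s]
  abel

theorem isAdmissible (h : P.Regular c) (hd : P.IsBoundedInput d)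
    (hE : P.IsExtremal d d0 dT x p) : P.IsAdmissible d d0 x (P.extremalControl d x p) where
  control := hE.isBoundedInput_control h hd
  continuousOn := hE.continuous_state.continuousOn
  dynamics _ ht := hE.initial ▸ (hE.eq_add_integral h hd h.zero_mem ht).1

theorem costate_eq (h : P.Regular c) (hd : P.IsBoundedInput d)
    (hE : P.IsExtremal d d0 dT x p) {t : ℝ} (ht : t ∈ Icc 0 P.T) :
    p t = P.QT (x P.T) + (P.GT†) dT + ∫ s in t..P.T,
      (P.stateGradient s (x s) (P.extremalControl d x p s) (d s) + ((P.A s)†) (p s)) := by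
  have hp := (hE.eq_add_integral h hd h.T_mem ht).2
  rwa [intervalIntegral.integral_neg, ← intervalIntegral.integral_symm, hE.terminal] at hp

/- Integration by parts moves the adjoint equation onto the variation `δ`. -/
theorem integral_first_variation (h : P.Regular c) (hd : P.IsBoundedInput d)
    (hE : P.IsExtremal d d0 dT x p) {δ : ℝ → Vec nx} {ω : ℝ → Vec nu}
    (hδ : P.IsBoundedInput δ) (hω : P.IsBoundedInput ω)
    (hδω : ∀ t ∈ Icc 0 P.T, δ t = ∫ s in (0 : ℝ)..t, (P.A s (δ s) + P.B s (ω s))) :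
    ∫ t in (0 : ℝ)..P.T,
        (⟪P.stateGradient t (x t) (P.extremalControl d x p t) (d t), δ t⟫_ℝ +
          ⟪P.controlGradient t (x t) (P.extremalControl d x p t) (d t), ω t⟫_ℝ) =
      -⟪P.QT (x P.T) + (P.GT†) dT, δ P.T⟫_ℝ := by
  have hδ₀ : δ 0 = 0 := by rw [hδω 0 h.zero_mem, intervalIntegral.integral_same]
  have huIcc : uIcc 0 P.T = Icc 0 P.T := uIcc_of_le h.T_pos.le
  have hparts := integral_inner_add_inner_primitive (x := p) (y := δ)
    ((hE.isBoundedInput_adjoint_rate h hd).neg.intervalIntegrable h.zero_mem h.T_mem)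
    (((hδ.clm_apply h.contA).add (hω.clm_apply h.contB)).intervalIntegrable h.zero_mem h.T_mem)
    (fun t ht => (hE.eq_add_integral h hd h.zero_mem (huIcc ▸ ht)).2)
    (fun t ht => by rw [hδ₀, zero_add]; exact hδω t (huIcc ▸ ht))
  rw [hδ₀, inner_zero_right, sub_zero, hE.terminal] at hparts
  rw [← hparts, ← intervalIntegral.integral_neg]
  refine intervalIntegral.integral_congr fun t _ => ?_
  simp only [h.controlGradient_extremalControl, inner_neg_left, inner_add_left, inner_add_right,
    ContinuousLinearMap.adjoint_inner_left]
  ring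

theorem integral_runningForm_eq (h : P.Regular c) (hd : P.IsBoundedInput d)
    (hE : P.IsExtremal d d0 dT x p) {y : ℝ → Vec nx} {w : ℝ → Vec nu}
    (hyw : P.IsAdmissible d d0 y w) :
    ∫ t in (0 : ℝ)..P.T, P.runningForm t (y t) (w t) (d t) =
      (∫ t in (0 : ℝ)..P.T, P.runningForm t (x t) (P.extremalControl d x p t) (d t)) +
        2 * -⟪P.QT (x P.T) + (P.GT†) dT, y P.T - x P.T⟫_ℝ +
        ∫ t in (0 : ℝ)..P.T,
          P.runningForm t (y t - x t) (w t - P.extremalControl d x p t) 0 := by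
  have hxu := hE.isAdmissible h hd
  have hx : P.IsBoundedInput x := .of_continuous hE.continuous_state
  have hδ := (IsBoundedInput.of_continuousOn hyw.continuousOn).sub hx
  have hω := hyw.control.sub hxu.control
  have hrun := h.intervalIntegrable_runningForm hx hxu.control hd
  have hgrad := ((h.isBoundedInput_stateGradient hx hxu.control hd).intervalIntegrable_inner hδ
    h.zero_mem h.T_mem).add ((h.isBoundedInput_controlGradient hx hxu.control
      hd).intervalIntegrable_inner hω h.zero_mem h.T_mem) |>.const_mul 2
  rw [← hE.integral_first_variation h hd hδ hω fun t ht => hyw.sub_eq_integral h hd hxu ht,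
    ← intervalIntegral.integral_const_mul, ← intervalIntegral.integral_add hrun hgrad,
    ← intervalIntegral.integral_add (hrun.add hgrad)
      (h.intervalIntegrable_runningForm hδ hω (.of_continuous continuous_const))]
  refine intervalIntegral.integral_congr fun t _ => ?_
  simp only [← h.runningForm_add, add_sub_cancel]

theorem cost_eq_add (h : P.Regular c) (hd : P.IsBoundedInput d) (hE : P.IsExtremal d d0 dT x p)
    {y : ℝ → Vec nx} {w : ℝ → Vec nu} (hyw : P.IsAdmissible d d0 y w) :
    P.cost d dT y w = P.cost d dT x (P.extremalControl d x p) +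
      1 / 2 * (∫ t in (0 : ℝ)..P.T,
        P.runningForm t (y t - x t) (w t - P.extremalControl d x p t) 0) +
      1 / 2 * ⟪y P.T - x P.T, P.QT (y P.T - x P.T)⟫_ℝ := by
  have hterm := h.terminalForm_add (x P.T) (y P.T - x P.T) dT
  rw [add_sub_cancel] at hterm
  rw [cost_eq, cost_eq, hE.integral_runningForm_eq h hd hyw, hterm]
  ring

theorem isOptimal (h : P.Regular c) (hd : P.IsBoundedInput d) (hE : P.IsExtremal d d0 dT x p) :
    P.IsOptimal d d0 dT x (P.extremalControl d x p) p where
  admissible := hE.isAdmissible h hd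
  optimal y w hyw := by
    have hrun : 0 ≤ ∫ t in (0 : ℝ)..P.T,
        P.runningForm t (y t - x t) (w t - P.extremalControl d x p t) 0 :=
      intervalIntegral.integral_nonneg h.T_pos.le fun t _ => h.runningForm_zero_nonneg t _ _
    have hterm := h.isPositive_QT.inner_nonneg_right (y P.T - x P.T)
    rw [hE.cost_eq_add h hd hyw]
    linarith
  adjoint_continuousOn := hE.continuous_costate.continuousOn
  adjoint_equation _ ht := hE.costate_eq h hd ht

theorem integral_runningForm_sub_eq_zero (h : P.Regular c) (hd : P.IsBoundedInput d)
    (hE : P.IsExtremal d d0 dT x p) {y q : ℝ → Vec nx} {w : ℝ → Vec nu}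
    (hO : P.IsOptimal d d0 dT y w q) :
    ∫ t in (0 : ℝ)..P.T,
      P.runningForm t (y t - x t) (w t - P.extremalControl d x p t) 0 = 0 := by
  have hcost := hO.optimal x _ (hE.isAdmissible h hd)
  rw [hE.cost_eq_add h hd hO.admissible] at hcost
  have hterm := h.isPositive_QT.inner_nonneg_right (y P.T - x P.T)
  refine le_antisymm (by linarith) ?_
  exact intervalIntegral.integral_nonneg h.T_pos.le fun t _ => h.runningForm_zero_nonneg t _ _

theorem ae_eq_of_isOptimal (h : P.Regular c) (hd : P.IsBoundedInput d)
    (hE : P.IsExtremal d d0 dT x p) {y q : ℝ → Vec nx} {w : ℝ → Vec nu}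
    (hO : P.IsOptimal d d0 dT y w q) :
    ∀ᵐ t ∂volume.restrict (Icc 0 P.T), y t = x t ∧ w t = P.extremalControl d x p t := by
  have hint := h.intervalIntegrable_runningForm
    ((IsBoundedInput.of_continuousOn hO.admissible.continuousOn).sub
      (.of_continuous hE.continuous_state))
    (hO.admissible.control.sub (hE.isBoundedInput_control h hd))
    (.of_continuous (continuous_const (y := (0 : Vec nd))))
  have hzero := hE.integral_runningForm_sub_eq_zero h hd hO
  rw [intervalIntegral.integral_of_le h.T_pos.le, integral_eq_zero_iff_of_nonneg
    (fun t => h.runningForm_zero_nonneg t _ _)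
    ((intervalIntegrable_iff_integrableOn_Ioc_of_le h.T_pos.le).1 hint)] at hzero
  rw [← Measure.restrict_congr_set Ioc_ae_eq_Icc]
  filter_upwards [hzero] with t ht
  exact (h.eq_zero_of_runningForm_zero_eq_zero ht).imp sub_eq_zero.1 sub_eq_zero.1

theorem state_eqOn_of_isOptimal (h : P.Regular c) (hd : P.IsBoundedInput d)
    (hE : P.IsExtremal d d0 dT x p) {y q : ℝ → Vec nx} {w : ℝ → Vec nu}
    (hO : P.IsOptimal d d0 dT y w q) : EqOn y x (Icc 0 P.T) :=
  Measure.eqOn_Icc_of_ae_eq volume h.T_pos.ne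
    ((hE.ae_eq_of_isOptimal h hd hO).mono fun _ => And.left) hO.admissible.continuousOn
    hE.continuous_state.continuousOn

theorem costate_eqOn_of_isOptimal (h : P.Regular c) (hd : P.IsBoundedInput d)
    (hE : P.IsExtremal d d0 dT x p) {y q : ℝ → Vec nx} {w : ℝ → Vec nu}
    (hO : P.IsOptimal d d0 dT y w q) : EqOn q p (Icc 0 P.T) := by
  have hA := continuous_adjoint h.contA
  refine fun t ht => sub_eq_zero.1 (eqOn_zero_of_eq_integral (w := fun t => q t - p t)
    hA.continuousOn (hO.adjoint_continuousOn.sub hE.continuous_costate.continuousOn)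
    (fun t ht => ?_) ht)
  have hq := ((h.isBoundedInput_stateGradient (.of_continuousOn hO.admissible.continuousOn)
    hO.admissible.control hd).add
    ((IsBoundedInput.of_continuousOn hO.adjoint_continuousOn).clm_apply hA)).intervalIntegrable
      ht h.T_mem
  have hp := (hE.isBoundedInput_adjoint_rate h hd).intervalIntegrable ht h.T_mem
  rw [hE.costate_eq h hd ht, ← hE.state_eqOn_of_isOptimal h hd hO h.T_mem,
    (hO.adjoint_equation t ht).trans rfl, add_sub_add_left_eq_sub]
  refine (intervalIntegral.integral_sub hq hp).symm.trans (intervalIntegral.integral_congr_ae ?_)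
  filter_upwards [(ae_restrict_iff' measurableSet_Icc).1 (hE.ae_eq_of_isOptimal h hd hO)]
    with s hs hst
  obtain ⟨hyx, hwu⟩ := hs (uIcc_subset_Icc ht h.T_mem (uIoc_subset_uIcc hst))
  rw [hyx, hwu, map_sub, add_sub_add_left_eq_sub]

end IsExtremal

end LQProblem

theorem integral_exp_neg_mul_sub_le {ρ : ℝ} (hρ : 0 < ρ) (t : ℝ) :
    ∫ s in (0 : ℝ)..t, Real.exp (-ρ * (t - s)) ≤ 1 / ρ := by
  have hsplit : ∀ s, Real.exp (-ρ * (t - s)) = Real.exp (-(ρ * t)) * Real.exp (ρ * (s - 0)) :=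
    fun s => by rw [← Real.exp_add]; ring_nf
  simp_rw [hsplit]
  rw [intervalIntegral.integral_const_mul, integral_exp_mul_sub hρ.ne', sub_zero,
    ← mul_div_assoc, mul_sub, ← Real.exp_add, neg_add_cancel, Real.exp_zero, mul_one]
  gcongr
  linarith [Real.exp_pos (-(ρ * t))]

namespace LQProblem

variable {nx nu nd : ℕ} {P : LQProblem nx nu nd} {c : LQConstants}

/- The Hamiltonian flow preserves the canonical symplectic form. -/
theorem IsHamiltonian.inner_sub_inner_eq (h : P.Regular c) {x y ξ q : ℝ → Vec nx}
    (hxy : P.IsHamiltonian x y) (hξq : P.IsHamiltonian ξ q) (s t : ℝ) :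
    ⟪q s, x s⟫_ℝ - ⟪y s, ξ s⟫_ℝ = ⟪q t, x t⟫_ℝ - ⟪y t, ξ t⟫_ℝ := by
  have hderiv : ∀ t, HasDerivAt (fun t => ⟪q t, x t⟫_ℝ - ⟪y t, ξ t⟫_ℝ) 0 t := fun t => by
    refine ((hasDerivAt_inner_adjoint (hξq.costate t)
      ((hxy.state t).congr_deriv (sub_eq_add_neg _ _))).sub
      (hasDerivAt_inner_adjoint (hxy.costate t)
        ((hξq.state t).congr_deriv (sub_eq_add_neg _ _)))).congr_deriv ?_
    have hweight : ⟪y t, P.inputWeight t (q t)⟫_ℝ = ⟪q t, P.inputWeight t (y t)⟫_ℝ := by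
      rw [← (h.isPositive_inputWeight t).inner_left_eq_inner_right, real_inner_comm]
    have hcost : ⟪P.reducedQ t (ξ t), x t⟫_ℝ = ⟪P.reducedQ t (x t), ξ t⟫_ℝ := by
      rw [(h.isPositive_reducedQ t).inner_left_eq_inner_right, real_inner_comm]
    simp only [inner_neg_left, inner_neg_right, hweight, hcost]
    ring
  exact is_const_of_deriv_eq_zero (fun r => (hderiv r).differentiableAt)
    (fun r => (hderiv r).deriv) s t

/-- The solution `Π = Y X⁻¹` of the Riccati equation of the reduced problem, for a fundamental
solution `(X, Y)` of the Hamiltonian system. It is meaningful on the horizon only, where `X` is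
invertible: `Ring.inverse` returns `0` on non-units. -/
def riccati {nx : ℕ} (X Y : ℝ → Mat nx nx) (t : ℝ) : Mat nx nx :=
  Y t ∘L Ring.inverse (X t)

namespace IsFundamental

variable {X Y : ℝ → Mat nx nx}

theorem X_inverse_apply (h : P.Regular c) (hXY : P.IsFundamental X Y) {t : ℝ}
    (ht : t ∈ Icc 0 P.T) (z : Vec nx) : X t (Ring.inverse (X t) z) = z :=
  DFunLike.congr_fun (Ring.mul_inverse_cancel _ (hXY.isUnit_X h ht)) z

theorem norm_X_inverse_apply_le (h : P.Regular c) (hXY : P.IsFundamental X Y) {s t : ℝ}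
    (hs : 0 ≤ s) (hst : s ≤ t) (ht : t ≤ P.T) (z : Vec nx) :
    ‖X t (Ring.inverse (X s) z)‖ ≤ c.cZ * Real.exp (-c.ρZ * (t - s)) * ‖z‖ := by
  have hdecay := (hXY.isClosedLoop (Ring.inverse (X s) z)).norm_le_decay h hs hst ht
  rwa [hXY.X_inverse_apply h ⟨hs, hst.trans ht⟩] at hdecay

theorem hasDerivAt_inverse_X (h : P.Regular c) (hXY : P.IsFundamental X Y) {t : ℝ}
    (ht : t ∈ Icc 0 P.T) :
    HasDerivAt (fun t => Ring.inverse (X t))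
      (-(Ring.inverse (X t) * (P.reducedA t ∘L X t - P.inputWeight t ∘L Y t) *
        Ring.inverse (X t))) t := by
  obtain ⟨u, hu⟩ := hXY.isUnit_X h ht
  have hinv := hasFDerivAt_ringInverse (𝕜 := ℝ) u
  rw [hu] at hinv
  refine (hinv.comp_hasDerivAt t (hXY.state t)).congr_deriv ?_
  rw [← hu, Ring.inverse_unit]
  rfl

theorem continuousOn_inverse_X (h : P.Regular c) (hXY : P.IsFundamental X Y) :
    ContinuousOn (fun t => Ring.inverse (X t)) (Icc 0 P.T) := fun _ ht =>
  (hXY.hasDerivAt_inverse_X h ht).continuousAt.continuousWithinAt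

theorem continuousOn_riccati (h : P.Regular c) (hXY : P.IsFundamental X Y) :
    ContinuousOn (riccati X Y) (Icc 0 P.T) := fun t ht =>
  (hXY.costate t).continuousAt.continuousWithinAt.clm_comp (hXY.continuousOn_inverse_X h t ht)

theorem inner_Y_X (h : P.Regular c) (hXY : P.IsFundamental X Y) (t : ℝ) (a b : Vec nx) :
    ⟪Y t a, X t b⟫_ℝ = ⟪Y t b, X t a⟫_ℝ := by
  have hsymp := (hXY.isClosedLoop b).inner_sub_inner_eq h (hXY.isClosedLoop a).toIsHamiltonian t P.T
  simp only [hXY.X_terminal, hXY.Y_terminal, one_apply_eq_self] at hsymp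
  rw [h.isPositive_QT.inner_left_eq_inner_right, real_inner_comm (P.QT b) a, sub_self] at hsymp
  exact sub_eq_zero.1 hsymp

theorem isSymmetric_riccati (h : P.Regular c) (hXY : P.IsFundamental X Y) {t : ℝ}
    (ht : t ∈ Icc 0 P.T) : (riccati X Y t).IsSymmetric := fun a b => by
  have hYX := hXY.inner_Y_X h t (Ring.inverse (X t) a) (Ring.inverse (X t) b)
  rw [hXY.X_inverse_apply h ht, hXY.X_inverse_apply h ht] at hYX
  exact hYX.trans (real_inner_comm _ _)

theorem norm_riccati_le (h : P.Regular c) (hXY : P.IsFundamental X Y) {t : ℝ}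
    (ht : t ∈ Icc 0 P.T) : ‖riccati X Y t‖ ≤ c.c₁ := by
  refine opNorm_le_of_abs_inner_le (hXY.isSymmetric_riccati h ht) c.c₁_pos.le fun z => ?_
  have hloop := hXY.isClosedLoop (Ring.inverse (X t) z)
  have hnonneg := hloop.inner_nonneg h ht.2
  have hle := hloop.inner_le_c₁_mul h ht
  rw [hXY.X_inverse_apply h ht] at hnonneg hle
  exact (abs_of_nonneg hnonneg).trans_le hle

variable {ξ q : ℝ → Vec nx}

theorem inner_costate_sub_riccati_X (h : P.Regular c) (hXY : P.IsFundamental X Y)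
    (hξq : P.IsHamiltonian ξ q) {t : ℝ} (ht : t ∈ Icc 0 P.T) (b : Vec nx) :
    ⟪q t - riccati X Y t (ξ t), X t b⟫_ℝ = ⟪q P.T - P.QT (ξ P.T), b⟫_ℝ := by
  have hsymp := (hXY.isClosedLoop b).inner_sub_inner_eq h hξq t P.T
  simp only [hXY.X_terminal, hXY.Y_terminal, one_apply_eq_self] at hsymp
  rw [h.isPositive_QT.inner_left_eq_inner_right, real_inner_comm (P.QT (ξ P.T)) b] at hsymp
  have hYX := hXY.inner_Y_X h t (Ring.inverse (X t) (ξ t)) b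
  rw [hXY.X_inverse_apply h ht] at hYX
  rw [riccati, ContinuousLinearMap.comp_apply, inner_sub_left, inner_sub_left, hYX, hsymp]

theorem norm_costate_sub_riccati_le (h : P.Regular c) (hXY : P.IsFundamental X Y)
    (hξq : P.IsHamiltonian ξ q) {t : ℝ} (ht : t ∈ Icc 0 P.T) :
    ‖q t - riccati X Y t (ξ t)‖ ≤
      c.cZ * Real.exp (-c.ρZ * (P.T - t)) * ‖q P.T - P.QT (ξ P.T)‖ := by
  have := c.cZ_pos
  set r : Vec nx := q t - riccati X Y t (ξ t)
  set b : Vec nx := Ring.inverse (X t) r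
  have hb : ‖b‖ ≤ c.cZ * Real.exp (-c.ρZ * (P.T - t)) * ‖r‖ := by
    simpa only [hXY.X_terminal, one_apply_eq_self] using
      hXY.norm_X_inverse_apply_le h ht.1 ht.2 le_rfl r
  have hr : ‖r‖ ^ 2 = ⟪q P.T - P.QT (ξ P.T), b⟫_ℝ := by
    rw [← hXY.inner_costate_sub_riccati_X h hξq ht b, hXY.X_inverse_apply h ht,
      real_inner_self_eq_norm_sq]
  rcases (norm_nonneg r).eq_or_lt with hr₀ | hr₀
  · rw [← hr₀]
    positivity
  · refine le_of_mul_le_mul_right ?_ hr₀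
    calc ‖r‖ * ‖r‖ = ⟪q P.T - P.QT (ξ P.T), b⟫_ℝ := by rw [← pow_two, hr]
      _ ≤ ‖q P.T - P.QT (ξ P.T)‖ * ‖b‖ := real_inner_le_norm _ _
      _ ≤ ‖q P.T - P.QT (ξ P.T)‖ * (c.cZ * Real.exp (-c.ρZ * (P.T - t)) * ‖r‖) := by gcongr
      _ = c.cZ * Real.exp (-c.ρZ * (P.T - t)) * ‖q P.T - P.QT (ξ P.T)‖ * ‖r‖ := by ring

theorem hasDerivAt_inverse_X_apply (h : P.Regular c) (hXY : P.IsFundamental X Y)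
    (hξq : P.IsHamiltonian ξ q) {t : ℝ} (ht : t ∈ Icc 0 P.T) :
    HasDerivAt (fun t => Ring.inverse (X t) (ξ t))
      (-(Ring.inverse (X t) (P.inputWeight t (q t - riccati X Y t (ξ t))))) t := by
  refine ((hXY.hasDerivAt_inverse_X h ht).clm_apply (hξq.state t)).congr_deriv ?_
  simp only [riccati, neg_apply, mul_apply_eq_comp, sub_apply, ContinuousLinearMap.comp_apply,
    map_sub, hXY.X_inverse_apply h ht]
  abel

/- Variation of constants for the feedback dynamics `ξ' = (A - S Π) ξ - S (q - Π ξ)`, whose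
evolution operator is `X t (X s)⁻¹`. -/
theorem state_eq_add_integral (h : P.Regular c) (hXY : P.IsFundamental X Y)
    (hξq : P.IsHamiltonian ξ q) {t : ℝ} (ht : t ∈ Icc 0 P.T) :
    ξ t = X t (Ring.inverse (X 0) (ξ 0)) - ∫ s in (0 : ℝ)..t,
      X t (Ring.inverse (X s) (P.inputWeight s (q s - riccati X Y s (ξ s)))) := by
  have hξ : Continuous ξ := continuous_iff_continuousAt.2 fun t => (hξq.state t).continuousAt
  have hq : Continuous q := continuous_iff_continuousAt.2 fun t => (hξq.costate t).continuousAt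
  have hcont : ContinuousOn
      (fun s => Ring.inverse (X s) (P.inputWeight s (q s - riccati X Y s (ξ s)))) (Icc 0 P.T) :=
    (hXY.continuousOn_inverse_X h).clm_apply (h.continuous_inputWeight.continuousOn.clm_apply
      (hq.continuousOn.sub ((hXY.continuousOn_riccati h).clm_apply hξ.continuousOn)))
  have hsub : uIcc 0 t ⊆ Icc 0 P.T := uIcc_subset_Icc h.zero_mem ht
  have hint := (hcont.mono hsub).intervalIntegrable (μ := volume)
  have hftc := intervalIntegral.integral_eq_sub_of_hasDerivAt
    (fun s hs => hXY.hasDerivAt_inverse_X_apply h hξq (hsub hs)) hint.neg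
  rw [intervalIntegral.integral_neg, neg_eq_iff_eq_neg, neg_sub] at hftc
  rw [(X t).intervalIntegral_comp_comm hint, hftc, map_sub, sub_sub_cancel,
    hXY.X_inverse_apply h ht]

theorem norm_X_inverse_inputWeight_le (h : P.Regular c) (hXY : P.IsFundamental X Y)
    (hξq : P.IsHamiltonian ξ q) {s t : ℝ} (hs : 0 ≤ s) (hst : s ≤ t) (ht : t ≤ P.T) :
    ‖X t (Ring.inverse (X s) (P.inputWeight s (q s - riccati X Y s (ξ s))))‖ ≤
      Real.exp (-(2 * c.ρZ) * (t - s)) * (c.cZ ^ 2 * (c.lamB ^ 2 / c.γR) *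
        Real.exp (-c.ρZ * (P.T - t)) * ‖q P.T - P.QT (ξ P.T)‖) := by
  have := c.cZ_pos; have := c.γR_pos
  calc _ ≤ c.cZ * Real.exp (-c.ρZ * (t - s)) *
        ‖P.inputWeight s (q s - riccati X Y s (ξ s))‖ :=
        hXY.norm_X_inverse_apply_le h hs hst ht _
    _ ≤ c.cZ * Real.exp (-c.ρZ * (t - s)) * (c.lamB ^ 2 / c.γR *
        (c.cZ * Real.exp (-c.ρZ * (P.T - s)) * ‖q P.T - P.QT (ξ P.T)‖)) := by
        gcongr
        exact (P.inputWeight s).le_of_opNorm_le_of_le (h.norm_inputWeight_le s)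
          (hXY.norm_costate_sub_riccati_le h hξq ⟨hs, hst.trans ht⟩)
    _ = Real.exp (-c.ρZ * (t - s) + -c.ρZ * (P.T - s)) *
        (c.cZ ^ 2 * (c.lamB ^ 2 / c.γR) * ‖q P.T - P.QT (ξ P.T)‖) := by
        rw [Real.exp_add]; ring
    _ = Real.exp (-(2 * c.ρZ) * (t - s) + -c.ρZ * (P.T - t)) *
        (c.cZ ^ 2 * (c.lamB ^ 2 / c.γR) * ‖q P.T - P.QT (ξ P.T)‖) := by ring_nf
    _ = _ := by rw [Real.exp_add]; ring

theorem norm_state_le (h : P.Regular c) (hXY : P.IsFundamental X Y)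
    (hξq : P.IsHamiltonian ξ q) {t : ℝ} (ht : t ∈ Icc 0 P.T) :
    ‖ξ t‖ ≤ c.cZ * Real.exp (-c.ρZ * t) * ‖ξ 0‖ +
      c.cZ ^ 2 * (c.lamB ^ 2 / c.γR) / (2 * c.ρZ) * Real.exp (-c.ρZ * (P.T - t)) *
        ‖q P.T - P.QT (ξ P.T)‖ := by
  have := c.ρZ_pos; have := c.γR_pos
  have hinit := hXY.norm_X_inverse_apply_le h le_rfl ht.1 ht.2 (ξ 0)
  rw [sub_zero] at hinit
  rw [hXY.state_eq_add_integral h hξq ht]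
  refine (norm_sub_le _ _).trans (add_le_add hinit ?_)
  set D : ℝ := c.cZ ^ 2 * (c.lamB ^ 2 / c.γR) * Real.exp (-c.ρZ * (P.T - t)) *
    ‖q P.T - P.QT (ξ P.T)‖ with hD
  calc _ ≤ ∫ s in (0 : ℝ)..t, Real.exp (-(2 * c.ρZ) * (t - s)) * D :=
        intervalIntegral.norm_integral_le_of_norm_le ht.1
          (.of_forall fun s hs => hXY.norm_X_inverse_inputWeight_le h hξq hs.1.le hs.2 ht.2)
          (Continuous.intervalIntegrable (by fun_prop) _ _)
    _ = (∫ s in (0 : ℝ)..t, Real.exp (-(2 * c.ρZ) * (t - s))) * D :=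
        intervalIntegral.integral_mul_const _ _
    _ ≤ 1 / (2 * c.ρZ) * D := by
        gcongr
        exact integral_exp_neg_mul_sub_le (by positivity) t
    _ = _ := by rw [hD]; ring

end IsFundamental

theorem extremalControl_sub (d : ℝ → Vec nd) (x p xp pp : ℝ → Vec nx) (t : ℝ) :
    P.extremalControl d xp pp t - P.extremalControl d x p t =
      -(P.Rinv t (P.H t (xp t - x t) + ((P.B t)†) (pp t - p t))) := by
  simp only [extremalControl, map_sub, map_add]
  abel

theorem Regular.norm_extremalControl_sub_le (h : P.Regular c) (d : ℝ → Vec nd)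
    (x p xp pp : ℝ → Vec nx) (t : ℝ) :
    ‖P.extremalControl d xp pp t - P.extremalControl d x p t‖ ≤
      1 / c.γR * (c.lamH * ‖xp t - x t‖ + c.lamB * ‖pp t - p t‖) := by
  have := c.γR_pos
  rw [extremalControl_sub, norm_neg]
  refine (h.norm_Rinv_apply_le t _).trans (mul_le_mul_of_nonneg_left ?_ (by positivity))
  exact (norm_add_le _ _).trans (add_le_add ((P.H t).le_of_opNorm_le (h.boundH t) _)
    (((P.B t)†).le_of_opNorm_le (norm_adjoint_le (h.boundB t)) _))

namespace IsExtremal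

variable {d : ℝ → Vec nd} {d0 d0' : Vec nx} {dT dT' : Vec nd} {x p xp pp : ℝ → Vec nx}

theorem isHamiltonian_sub (h : P.Regular c) (hE : P.IsExtremal d d0 dT x p)
    (hE' : P.IsExtremal d d0' dT' xp pp) :
    P.IsHamiltonian (fun t => xp t - x t) fun t => pp t - p t := by
  have hcont : Continuous fun t => P.hamiltonian t (xp t - x t, pp t - p t) :=
    h.continuous_hamiltonian.clm_apply ((hE'.continuous_state.sub hE.continuous_state).prodMk
      (hE'.continuous_costate.sub hE.continuous_costate))
  have hint : ∀ {x p : ℝ → Vec nx}, Continuous x → Continuous p → ∀ t,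
      IntervalIntegrable (fun s => P.hamiltonian s (x s, p s)) volume P.T t := fun hx hp t =>
    (h.continuous_hamiltonian.clm_apply (hx.prodMk hp)).intervalIntegrable _ _
  have hsub : (fun t => (xp t - x t, pp t - p t)) = fun t =>
      (xp P.T - x P.T, pp P.T - p P.T) +
        ∫ s in P.T..t, P.hamiltonian s (xp s - x s, pp s - p s) := by
    funext t
    simp only [← Prod.mk_sub_mk, map_sub]
    rw [intervalIntegral.integral_sub (hint hE'.continuous_state hE'.continuous_costate t)
      (hint hE.continuous_state hE.continuous_costate t), hE.trajectory t, hE'.trajectory t]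
    abel
  refine isHamiltonian_iff_hasDerivAt_prod.2 fun t => ?_
  rw [hsub]
  exact (intervalIntegral.integral_hasDerivAt_right (hcont.intervalIntegrable _ _)
    hcont.aestronglyMeasurable.stronglyMeasurableAtFilter hcont.continuousAt).const_add _

variable {l0 : Vec nx} {lT : Vec nd}

theorem norm_terminal_defect_sub_le (h : P.Regular c) (hE : P.IsExtremal d d0 dT x p)
    (hE' : P.IsExtremal d d0' (dT + lT) xp pp) :
    ‖pp P.T - p P.T - P.QT (xp P.T - x P.T)‖ ≤ c.lamG * ‖lT‖ := by
  have hdefect : pp P.T - p P.T - P.QT (xp P.T - x P.T) = (P.GT†) lT := by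
    rw [hE.terminal, hE'.terminal, map_add, map_sub]
    abel
  rw [hdefect]
  exact (P.GT†).le_of_opNorm_le (norm_adjoint_le h.boundGT) _

theorem norm_state_sub_le (h : P.Regular c) (hE : P.IsExtremal d d0 dT x p)
    (hE' : P.IsExtremal d (d0 + l0) (dT + lT) xp pp) {t : ℝ} (ht : t ∈ Icc 0 P.T) :
    ‖xp t - x t‖ ≤ max c.cZ (c.cZ ^ 2 * c.lamB ^ 2 * c.lamG / (2 * c.ρZ * c.γR)) *
      (‖l0‖ * Real.exp (-c.ρZ * t) + ‖lT‖ * Real.exp (-c.ρZ * (P.T - t))) := by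
  have := c.ρZ_pos; have := c.γR_pos
  obtain ⟨X, Y, hXY⟩ := h.exists_isFundamental
  have hstate := hXY.norm_state_le h (hE.isHamiltonian_sub h hE') ht
  have hinit : xp 0 - x 0 = l0 := by rw [hE.initial, hE'.initial, add_sub_cancel_left]
  rw [hinit] at hstate
  calc ‖xp t - x t‖ ≤ _ := hstate
    _ ≤ c.cZ * Real.exp (-c.ρZ * t) * ‖l0‖ + c.cZ ^ 2 * (c.lamB ^ 2 / c.γR) / (2 * c.ρZ) *
        Real.exp (-c.ρZ * (P.T - t)) * (c.lamG * ‖lT‖) := by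
        gcongr
        exact hE.norm_terminal_defect_sub_le h hE'
    _ = c.cZ * (‖l0‖ * Real.exp (-c.ρZ * t)) +
        c.cZ ^ 2 * c.lamB ^ 2 * c.lamG / (2 * c.ρZ * c.γR) *
          (‖lT‖ * Real.exp (-c.ρZ * (P.T - t))) := by field_simp
    _ ≤ _ := by
        rw [mul_add]
        gcongr
        · exact le_max_left _ _
        · exact le_max_right _ _

theorem norm_costate_sub_le (h : P.Regular c) (hE : P.IsExtremal d d0 dT x p)
    (hE' : P.IsExtremal d (d0 + l0) (dT + lT) xp pp) {t : ℝ} (ht : t ∈ Icc 0 P.T) :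
    ‖pp t - p t‖ ≤ (c.c₁ + c.lamG) *
      (max c.cZ (c.cZ ^ 2 * c.lamB ^ 2 * c.lamG / (2 * c.ρZ * c.γR)) *
        (‖l0‖ * Real.exp (-c.ρZ * t) + ‖lT‖ * Real.exp (-c.ρZ * (P.T - t)))) := by
  have := c.cZ_pos; have := c.c₁_pos; have := c.lamG_pos
  obtain ⟨X, Y, hXY⟩ := h.exists_isFundamental
  set M := max c.cZ (c.cZ ^ 2 * c.lamB ^ 2 * c.lamG / (2 * c.ρZ * c.γR))
  set e := ‖l0‖ * Real.exp (-c.ρZ * t) + ‖lT‖ * Real.exp (-c.ρZ * (P.T - t))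
  have hfeedback : ‖riccati X Y t (xp t - x t)‖ ≤ c.c₁ * (M * e) :=
    (riccati X Y t).le_of_opNorm_le_of_le (hXY.norm_riccati_le h ht)
      (hE.norm_state_sub_le h hE' ht)
  have hdefect : ‖pp t - p t - riccati X Y t (xp t - x t)‖ ≤ c.lamG * (M * e) :=
    calc _ ≤ c.cZ * Real.exp (-c.ρZ * (P.T - t)) * (c.lamG * ‖lT‖) :=
          (hXY.norm_costate_sub_riccati_le h (hE.isHamiltonian_sub h hE') ht).trans (by
            gcongr
            exact hE.norm_terminal_defect_sub_le h hE')
      _ = c.lamG * (c.cZ * (‖lT‖ * Real.exp (-c.ρZ * (P.T - t)))) := by ring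
      _ ≤ c.lamG * (M * e) := by
          gcongr
          · exact le_max_left _ _
          · exact le_add_of_nonneg_left (by positivity)
  calc ‖pp t - p t‖
      = ‖riccati X Y t (xp t - x t) + (pp t - p t - riccati X Y t (xp t - x t))‖ := by
        rw [add_sub_cancel]
    _ ≤ c.c₁ * (M * e) + c.lamG * (M * e) := norm_add_le_of_le hfeedback hdefect
    _ = (c.c₁ + c.lamG) * (M * e) := by ring

theorem sensitivity (h : P.Regular c) (hE : P.IsExtremal d d0 dT x p)
    (hE' : P.IsExtremal d (d0 + l0) (dT + lT) xp pp) {t : ℝ} (ht : t ∈ Icc 0 P.T) :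
    ‖xp t - x t‖ + ‖P.extremalControl d xp pp t - P.extremalControl d x p t‖ +
        ‖pp t - p t‖ ≤
      c.Lamb * (‖l0‖ * Real.exp (-c.ρZ * t) + ‖lT‖ * Real.exp (-c.ρZ * (P.T - t))) := by
  have := c.γR_pos; have := c.lamB_pos; have := c.lamH_pos
  have hstate := hE.norm_state_sub_le h hE' ht
  have hcostate := hE.norm_costate_sub_le h hE' ht
  have hcontrol := h.norm_extremalControl_sub_le d x p xp pp t
  set M := max c.cZ (c.cZ ^ 2 * c.lamB ^ 2 * c.lamG / (2 * c.ρZ * c.γR)) with hM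
  set e := ‖l0‖ * Real.exp (-c.ρZ * t) + ‖lT‖ * Real.exp (-c.ρZ * (P.T - t))
  calc _ ≤ ‖xp t - x t‖ + 1 / c.γR * (c.lamH * ‖xp t - x t‖ + c.lamB * ‖pp t - p t‖) +
        ‖pp t - p t‖ := by gcongr
    _ = (1 + c.lamH / c.γR) * ‖xp t - x t‖ + (1 + c.lamB / c.γR) * ‖pp t - p t‖ := by ring
    _ ≤ (1 + c.lamH / c.γR) * (M * e) +
        (1 + c.lamB / c.γR) * ((c.c₁ + c.lamG) * (M * e)) := by gcongr
    _ = c.Lamb * e := by rw [LQConstants.Lamb, ← hM]; ring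

end IsExtremal

end LQProblem

theorem coe_projIcc_of_mem {α : Type*} [LinearOrder α] {a b t : α} (hab : a ≤ b)
    (ht : t ∈ Icc a b) : (projIcc a b hab t : α) = t :=
  congrArg Subtype.val (projIcc_of_mem hab ht)

namespace LQProblem

variable {nx nu nd : ℕ} {P : LQProblem nx nu nd} {c : LQConstants}

namespace Regular

variable {d : ℝ → Vec nd} {d0 l0 : Vec nx} {dT lT : Vec nd} {x p xp pp : ℝ → Vec nx}
  {u up : ℝ → Vec nu}

theorem exists_isOptimal (h : P.Regular c) (hd : P.IsBoundedInput d) (d0 : Vec nx)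
    (dT : Vec nd) : ∃ x u p, P.IsOptimal d d0 dT x u p ∧
      (ContinuousOn d (Icc 0 P.T) → ContinuousOn u (Icc 0 P.T)) := by
  obtain ⟨x, p, hE⟩ := h.exists_isExtremal hd d0 dT
  exact ⟨x, _, p, hE.isOptimal h hd, fun hdc =>
    h.continuousOn_extremalControl hdc hE.continuous_state hE.continuous_costate⟩

/- The discontinuous input `d` cancels. -/
theorem continuous_extremalControl_sub (h : P.Regular c) (d : ℝ → Vec nd) (hx : Continuous x)
    (hp : Continuous p) (hxp : Continuous xp) (hpp : Continuous pp) :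
    Continuous fun t => P.extremalControl d xp pp t - P.extremalControl d x p t := by
  simp only [extremalControl_sub]
  exact (h.continuous_Rinv.clm_apply ((h.contH.clm_apply (hxp.sub hx)).add
    ((continuous_adjoint h.contB).clm_apply (hpp.sub hp)))).neg

theorem sensitivity (h : P.Regular c) (hd : P.IsBoundedInput d)
    (hO : P.IsOptimal d d0 dT x u p) (hO' : P.IsOptimal d (d0 + l0) (dT + lT) xp up pp) :
    (∀ᵐ t ∂volume.restrict (Icc 0 P.T), ‖xp t - x t‖ + ‖up t - u t‖ + ‖pp t - p t‖ ≤
      c.Lamb * (‖l0‖ * Real.exp (-c.ρZ * t) + ‖lT‖ * Real.exp (-c.ρZ * (P.T - t)))) ∧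
    (ContinuousOn u (Icc 0 P.T) → ContinuousOn up (Icc 0 P.T) → ∀ t ∈ Icc 0 P.T,
      ‖xp t - x t‖ + ‖up t - u t‖ + ‖pp t - p t‖ ≤
        c.Lamb * (‖l0‖ * Real.exp (-c.ρZ * t) + ‖lT‖ * Real.exp (-c.ρZ * (P.T - t)))) := by
  obtain ⟨ξ, q, hE⟩ := h.exists_isExtremal hd d0 dT
  obtain ⟨ξ', q', hE'⟩ := h.exists_isExtremal hd (d0 + l0) (dT + lT)
  set v := fun t => P.extremalControl d ξ' q' t - P.extremalControl d ξ q t with hv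
  have hcontrol : (fun t => up t - u t) =ᵐ[volume.restrict (Icc 0 P.T)] v := by
    filter_upwards [hE.ae_eq_of_isOptimal h hd hO, hE'.ae_eq_of_isOptimal h hd hO'] with t ht ht'
    rw [hv, ht.2, ht'.2]
  have hbound : ∀ t ∈ Icc 0 P.T, up t - u t = v t →
      ‖xp t - x t‖ + ‖up t - u t‖ + ‖pp t - p t‖ ≤
        c.Lamb * (‖l0‖ * Real.exp (-c.ρZ * t) + ‖lT‖ * Real.exp (-c.ρZ * (P.T - t))) := by
    intro t ht huv
    rw [huv, hE.state_eqOn_of_isOptimal h hd hO ht, hE.costate_eqOn_of_isOptimal h hd hO ht,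
      hE'.state_eqOn_of_isOptimal h hd hO' ht, hE'.costate_eqOn_of_isOptimal h hd hO' ht]
    exact hE.sensitivity h hE' ht
  refine ⟨?_, fun hu hup t ht => hbound t ht ?_⟩
  · filter_upwards [hcontrol, ae_restrict_mem measurableSet_Icc] with t huv ht
    exact hbound t ht huv
  · exact Measure.eqOn_Icc_of_ae_eq volume h.T_pos.ne hcontrol (hup.sub hu)
      (h.continuous_extremalControl_sub d hE.continuous_state hE.continuous_costate
        hE'.continuous_state hE'.continuous_costate).continuousOn ht

end Regular

/-- The problem whose coefficients are extended to the real line, constantly on both sides of the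
horizon. -/
def extend (P : LQProblem nx nu nd) (hT : 0 ≤ P.T) : LQProblem nx nu nd where
  T := P.T
  A t := P.A (projIcc 0 P.T hT t)
  B t := P.B (projIcc 0 P.T hT t)
  C t := P.C (projIcc 0 P.T hT t)
  Q t := P.Q (projIcc 0 P.T hT t)
  H t := P.H (projIcc 0 P.T hT t)
  R t := P.R (projIcc 0 P.T hT t)
  G t := P.G (projIcc 0 P.T hT t)
  W t := P.W (projIcc 0 P.T hT t)
  QT := P.QT
  GT := P.GT

theorem gramian_extend (hT : 0 ≤ P.T) {t₀ t₁ : ℝ} (ht₀ : t₀ ∈ Icc 0 P.T) (ht₁ : t₁ ∈ Icc 0 P.T) :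
    gramian (P.extend hT).A (P.extend hT).B t₀ t₁ = gramian P.A P.B t₀ t₁ := by
  have hA : EqOn (P.extend hT).A P.A (Icc 0 P.T) := fun t ht => by
    simp only [extend, coe_projIcc_of_mem hT ht]
  refine intervalIntegral.integral_congr fun s hs => ?_
  have hs' := uIcc_subset_Icc ht₀ ht₁ hs
  have hB : (P.extend hT).B s = P.B s := by simp only [extend, coe_projIcc_of_mem hT hs']
  simp only [evolution_congr hA hs' ht₀, hB]

theorem Assumptions.controllable_extend (hP : P.Assumptions c) (hT : 0 ≤ P.T) {t₀ : ℝ}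
    (ht₀ : t₀ ∈ Icc 0 (P.T - c.σ)) : ∃ t₁ ∈ Icc t₀ (t₀ + c.σ),
      c.α₀ • (1 : Mat nx nx) ≤ gramian (P.extend hT).A (P.extend hT).B t₀ t₁ ∧
      gramian (P.extend hT).A (P.extend hT).B t₀ t₁ ≤ c.α₁ • (1 : Mat nx nx) := by
  obtain ⟨t₁, ht₁, hlower, hupper, -, -⟩ := hP.controllable t₀ ht₀
  have ht₁T : t₁ ≤ P.T := by linarith [ht₁.2, ht₀.2]
  rw [← gramian_extend hT ⟨ht₀.1, ht₁.1.trans ht₁T⟩ ⟨ht₀.1.trans ht₁.1, ht₁T⟩] at hlower hupper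
  exact ⟨t₁, ht₁, hlower, hupper⟩

theorem Assumptions.regular_extend (hP : P.Assumptions c) (hT : 0 ≤ P.T) :
    (P.extend hT).Regular c :=
  have hcont {E : Type} [TopologicalSpace E] {f : ℝ → E} (hf : ContinuousOn f (Icc 0 P.T)) :
      Continuous fun t => f (projIcc 0 P.T hT t) :=
    hf.comp_continuous (continuous_subtype_val.comp continuous_projIcc)
      fun t => (projIcc _ _ hT t).2
  have hmem (t : ℝ) : (projIcc 0 P.T hT t : ℝ) ∈ Icc 0 P.T := (projIcc 0 P.T hT t).2
  { σ_lt_T := hP.σ_lt_T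
    contA := hcont hP.contA
    contB := hcont hP.contB
    contC := hcont hP.contC
    contQ := hcont hP.contQ
    contH := hcont hP.contH
    contR := hcont hP.contR
    contG := hcont hP.contG
    contW := hcont hP.contW
    boundA t := hP.boundA _ (hmem t)
    boundB t := hP.boundB _ (hmem t)
    boundQ t := hP.boundQ _ (hmem t)
    boundH t := hP.boundH _ (hmem t)
    boundR t := hP.boundR _ (hmem t)
    boundGT := hP.boundGT
    controllable _ ht₀ := hP.controllable_extend hT ht₀
    coerciveR t := hP.coerciveR _ (hmem t)
    coerciveQ t := hP.coerciveQ _ (hmem t)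
    coerciveQT := hP.coerciveQT
    boundQT := hP.boundQT }

theorem isAdmissible_extend_iff (hT : 0 ≤ P.T) {d : ℝ → Vec nd} {d0 : Vec nx} {x : ℝ → Vec nx}
    {u : ℝ → Vec nu} : (P.extend hT).IsAdmissible d d0 x u ↔ P.IsAdmissible d d0 x u := by
  have hdyn : ∀ t ∈ Icc 0 P.T, (∫ s in (0 : ℝ)..t, ((P.extend hT).A s (x s) +
      (P.extend hT).B s (u s) + (P.extend hT).C s (d s))) =
      ∫ s in (0 : ℝ)..t, (P.A s (x s) + P.B s (u s) + P.C s (d s)) := fun t ht =>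
    intervalIntegral.integral_congr fun s hs => by
      simp only [extend, coe_projIcc_of_mem hT (uIcc_subset_Icc ⟨le_rfl, hT⟩ ht hs)]
  exact ⟨fun h => ⟨h.control, h.continuousOn, fun t ht => hdyn t ht ▸ h.dynamics t ht⟩,
    fun h => ⟨h.control, h.continuousOn, fun t ht => (hdyn t ht).symm ▸ h.dynamics t ht⟩⟩

theorem cost_extend (hT : 0 ≤ P.T) (d : ℝ → Vec nd) (dT : Vec nd) (x : ℝ → Vec nx)
    (u : ℝ → Vec nu) : (P.extend hT).cost d dT x u = P.cost d dT x u := by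
  unfold cost
  congr 2
  refine intervalIntegral.integral_congr fun s hs => ?_
  have hs' : s ∈ Icc 0 P.T := uIcc_subset_Icc ⟨le_rfl, hT⟩ ⟨hT, le_rfl⟩ hs
  simp only [extend, coe_projIcc_of_mem hT hs']

theorem isOptimal_extend_iff (hT : 0 ≤ P.T) {d : ℝ → Vec nd} {d0 : Vec nx} {dT : Vec nd}
    {x p : ℝ → Vec nx} {u : ℝ → Vec nu} :
    (P.extend hT).IsOptimal d d0 dT x u p ↔ P.IsOptimal d d0 dT x u p := by
  have hadj : ∀ t ∈ Icc 0 P.T, (∫ s in t..P.T, ((P.extend hT).Q s (x s) +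
      (((P.extend hT).H s)†) (u s) + (((P.extend hT).G s)†) (d s) +
        (((P.extend hT).A s)†) (p s))) =
      ∫ s in t..P.T, (P.Q s (x s) + ((P.H s)†) (u s) + ((P.G s)†) (d s) + ((P.A s)†) (p s)) :=
    fun t ht => intervalIntegral.integral_congr fun s hs => by
      simp only [extend, coe_projIcc_of_mem hT (uIcc_subset_Icc ht ⟨hT, le_rfl⟩ hs)]
  constructor
  · exact fun h =>
      { admissible := (isAdmissible_extend_iff hT).1 h.admissible
        optimal := fun y w hyw => by
          simpa only [cost_extend] using h.optimal y w ((isAdmissible_extend_iff hT).2 hyw)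
        adjoint_continuousOn := h.adjoint_continuousOn
        adjoint_equation := fun t ht =>
          (h.adjoint_equation t ht).trans (congrArg _ (hadj t ht)) }
  · exact fun h =>
      { admissible := (isAdmissible_extend_iff hT).2 h.admissible
        optimal := fun y w hyw => by
          simpa only [cost_extend] using h.optimal y w ((isAdmissible_extend_iff hT).1 hyw)
        adjoint_continuousOn := h.adjoint_continuousOn
        adjoint_equation := fun t ht =>
          (h.adjoint_equation t ht).trans (congrArg _ (hadj t ht).symm) }

end LQProblem

end

theorem mainTheorem3 {nx nu nd : ℕ} (c : LQConstants) :
    0 < c.Lamb ∧ 0 < c.ρZ ∧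
    ∀ P : LQProblem nx nu nd, P.Assumptions c →
    ∀ d : ℝ → Vec nd, P.IsBoundedInput d →
      -- for all boundary parameters there is an optimal state, control and adjoint
      (∀ (d0 : Vec nx) (dT : Vec nd), ∃ (x : ℝ → Vec nx) (u : ℝ → Vec nu) (p : ℝ → Vec nx),
        P.IsOptimal d d0 dT x u p ∧
        (ContinuousOn d (Set.Icc 0 P.T) → ContinuousOn u (Set.Icc 0 P.T))) ∧
      -- sensitivity to the boundary parameters
      ∀ (d0 l0 : Vec nx) (dT lT : Vec nd)
        (x : ℝ → Vec nx) (u : ℝ → Vec nu) (p : ℝ → Vec nx)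
        (xp : ℝ → Vec nx) (up : ℝ → Vec nu) (pp : ℝ → Vec nx),
        P.IsOptimal d d0 dT x u p →
        P.IsOptimal d (d0 + l0) (dT + lT) xp up pp →
        (∀ᵐ t ∂(MeasureTheory.volume.restrict (Set.Icc 0 P.T)),
          ‖xp t - x t‖ + ‖up t - u t‖ + ‖pp t - p t‖ ≤
            c.Lamb * (‖l0‖ * Real.exp (-c.ρZ * t) + ‖lT‖ * Real.exp (-c.ρZ * (P.T - t)))) ∧
        (ContinuousOn u (Set.Icc 0 P.T) → ContinuousOn up (Set.Icc 0 P.T) →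
          ∀ t ∈ Set.Icc 0 P.T,
            ‖xp t - x t‖ + ‖up t - u t‖ + ‖pp t - p t‖ ≤
              c.Lamb * (‖l0‖ * Real.exp (-c.ρZ * t) + ‖lT‖ * Real.exp (-c.ρZ * (P.T - t)))) := by
  refine ⟨c.Lamb_pos, c.ρZ_pos, fun P hP d hd => ?_⟩
  have hT : 0 ≤ P.T := (c.σ_pos.trans hP.σ_lt_T).le
  have h := hP.regular_extend hT
  refine ⟨fun d0 dT => ?_, fun d0 l0 dT lT x u p xp up pp hO hO' => ?_⟩
  · obtain ⟨x, u, p, hO, hu⟩ := h.exists_isOptimal (d := d) hd d0 dT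
    exact ⟨x, u, p, (LQProblem.isOptimal_extend_iff hT).1 hO, hu⟩
  · exact h.sensitivity (d := d) hd ((LQProblem.isOptimal_extend_iff hT).2 hO)
      ((LQProblem.isOptimal_extend_iff hT).2 hO')
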